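/- **Theorem 2.4.** Let $\gamma>1$, $g>0$, $f\ge 0$, $\rho_l>0$, $0\le\alpha<\frac1\gamma$, and let $\theta\in(0,\frac{\gamma}{2}]\cap(0,\gamma-1)\cap(0,1-\alpha\gamma]$. Consider on $(0,1)\times(0,\infty)$ the problem $$c_t=0,\qquad Q_t+\rho_lQ^2u_x=0,\qquad u_t+\big((cQ)^\gamma\big)_x=-h(Q)u|u|+g+\big(c^\theta Q^{1+\theta}u_x\big)_x,\qquad h(Q)=f\rho_l^2\frac{Q^2}{(1+Q)^2},$$ with initial data $(cQ,u)(x,0)=(c_0Q_0,u_0)(x)$ and boundary conditions $(cQ)(0,t)=0$, $u(1,t)=0$ for $t>0$. Thus $c(x,t)=c_0(x)$. Let $(cQ_\infty)(x)=(gx)^{1/\gamma}$ be the stationary profile. *Weak solution.* A pair $(cQ,u)$ with $cQ\ge0$ is a weak solution if $c_0\in C^1((0,1])$; $cQ,u\in L^\infty([0,1]\times[0,\infty))\cap C^1([0,\infty);L^2(0,1))$; $u(\cdot,t)$ has a weak derivative $u_x(\cdot,t)$ on $(0,1)$ for every $t\ge0$; $c^\theta Q^{1+\theta}u_x\in L^\infty([0,1]\times[0,\infty))\cap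 C^{1/2}([0,\infty);L^2(0,1))$ (Hölder continuity on bounded time intervals); the initial values hold a.e. and the boundary values hold as essential limits $x\to0^+$ and $x\to1^-$; $Q_t+\rho_lQ^2u_x=0$ a.e.; and $$\int_0^\infty\!\!\int_0^1\big\{u\phi_t+\big((cQ)^\gamma-c^\theta Q^{1+\theta}u_x\big)\phi_x+g\phi-h(Q)u|u|\phi\big\}\,dx\,dt+\int_0^1u_0(x)\phi(x,0)\,dx=0$$ for every smooth $\phi$ with compact support in $[0,1)\times[0,\infty)$ (not required to vanish at $x=0$ or $t=0$). *Assumptions on the data.* For constants $0<C_1\le C_2$, $0<C_3\le C_4$: * $(A_1)$ $C_1x^{1/\gamma}\le c_0Q_0(x)\le C_2x^{1/\gamma}$ and $C_3x^\alpha\le c_0(x)\le C_4x^\alpha$ for $0<x\le1$; * $(A_2)$ $u_0\in H^1(0,1)\cap L^5(0,1)$ and $\int_0^1x^{\frac{(2+\alpha)\gamma-\theta-1}{\gamma}}\big(((c_0Q_0)^\theta)_x-((cQ_\infty)^\theta)_x\big)^2dx<\infty$; * $(A_3)$ $(c_0^\theta Q_0^{1+\theta}u_{0x})_x\in L^2(0,1)$.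 *Claim.* There is $\epsilon_0\in(0,1)$, depending only on $\gamma,\theta,\alpha,g,f,\rho_l,C_1,\dots,C_4$, such that for all data satisfying $(A_1)$–$(A_3)$ together with $$\|u_0\|_{L^2}^2\le\epsilon_0,\qquad\int_0^1x^{1-3/\gamma}(c_0Q_0-cQ_\infty)^2dx\le\epsilon_0,$$ there is a constant $C>0$, depending only on the parameters and the data (not on $t$), such that every weak solution satisfies, for all $t\ge0$, $$\|(cQ)^\theta(\cdot,t)-(cQ_\infty)^\theta\|_{L^\infty(0,1)}\le C(1+t)^{-\frac{2\theta}{4\gamma+\alpha\gamma-2}},\qquad\|u(\cdot,t)\|_{L^\infty(0,1)}\le C(1+t)^{-\frac12}.$$ -/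

import Mathlib

open Set Filter Topology MeasureTheory
open scoped ENNReal NNReal ContDiff

noncomputable section

namespace GasLiquid

/-- Lebesgue measure on the interval `(0,1)`. -/
abbrev muI : Measure ℝ := volume.restrict (Ioo (0 : ℝ) 1)

/-- The space `L²(0,1)`. -/
abbrev L2I : Type := Lp ℝ 2 muI

/-- `w` is the weak derivative of `v` on the open interval `(0,1)`. -/
def HasWeakDeriv (v w : ℝ → ℝ) : Prop :=
  LocallyIntegrableOn v (Ioo 0 1) ∧ LocallyIntegrableOn w (Ioo 0 1) ∧
    ∀ φ : ℝ → ℝ, ContDiff ℝ ∞ φ → HasCompactSupport φ → tsupport φ ⊆ Ioo 0 1 →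
      ∫ x in Ioo (0 : ℝ) 1, v x * deriv φ x = -∫ x in Ioo (0 : ℝ) 1, w x * φ x

/-- The stationary profile `(cQ_∞)(x) = (g x)^(1/γ)`. -/
def cQinf (γ g x : ℝ) : ℝ := (g * x) ^ (1 / γ)

/-- The profile vanishes at `0` and solves `((cQ_∞)^γ)_x = g`. -/
theorem cQinf_stationary {γ g : ℝ} (hγ : 1 < γ) (hg : 0 < g) :
    cQinf γ g 0 = 0 ∧ ∀ x, 0 < x → HasDerivAt (fun y => (cQinf γ g y) ^ γ) g x := by
  have hγ0 : γ ≠ 0 := by positivity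
  refine ⟨?_, fun x hx => ?_⟩
  · simp [cQinf, Real.zero_rpow (inv_ne_zero hγ0)]
  · have h : HasDerivAt (fun y : ℝ => g * y) g x := by
      simpa using (hasDerivAt_id x).const_mul g
    refine h.congr_of_eventuallyEq ?_
    filter_upwards [lt_mem_nhds hx] with y hy
    have hgy : 0 ≤ g * y := by positivity
    simp only [cQinf]
    rw [← Real.rpow_mul hgy, one_div, inv_mul_cancel₀ hγ0, Real.rpow_one]

/-- The friction coefficient `h(Q) = f ρ² Q² / (1 + Q)²`. -/
def friction (f ρ q : ℝ) : ℝ := f * ρ ^ 2 * (q ^ 2 / (1 + q) ^ 2)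

/-- The viscous flux `c^θ Q^(1+θ) u_x`. -/
def viscousFlux (θ c q v : ℝ) : ℝ := c ^ θ * q ^ (1 + θ) * v

/-- The two-sided bounds
`C₁ x^(1/γ) ≤ c₀ Q₀ ≤ C₂ x^(1/γ)` and `C₃ x^α ≤ c₀ ≤ C₄ x^α` on `(0,1]`. -/
def InitialBounds (γ α C₁ C₂ C₃ C₄ : ℝ) (c₀ Q₀ : ℝ → ℝ) : Prop :=
  ∀ x ∈ Ioc (0 : ℝ) 1,
    C₁ * x ^ (1 / γ) ≤ c₀ x * Q₀ x ∧ c₀ x * Q₀ x ≤ C₂ * x ^ (1 / γ) ∧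
    C₃ * x ^ α ≤ c₀ x ∧ c₀ x ≤ C₄ * x ^ α

/-- Regularity of the initial data:
`u₀ ∈ H¹ ∩ L⁵`; the weak derivative of `(c₀ Q₀)^θ` satisfies
`∫₀¹ x^(((2+α)γ-θ-1)/γ) (((c₀Q₀)^θ)_x - ((cQ_∞)^θ)_x)² dx < ∞`;
and `(c₀^θ Q₀^(1+θ) u₀ₓ)_x ∈ L²`. -/
def InitialRegularity (γ θ α g : ℝ) (c₀ Q₀ u₀ : ℝ → ℝ) : Prop :=
  ∃ u₀x w₀ s₀ : ℝ → ℝ,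
    (MemLp u₀ 2 muI ∧ HasWeakDeriv u₀ u₀x ∧ MemLp u₀x 2 muI) ∧
    MemLp u₀ 5 muI ∧
    (HasWeakDeriv (fun x => (c₀ x * Q₀ x) ^ θ) w₀ ∧
      Integrable (fun x => x ^ (((2 + α) * γ - θ - 1) / γ) *
        (w₀ x - deriv (fun y => (cQinf γ g y) ^ θ) x) ^ 2) muI) ∧
    (HasWeakDeriv (fun x => viscousFlux θ (c₀ x) (Q₀ x) (u₀x x)) s₀ ∧ MemLp s₀ 2 muI)

/-- Membership in `L^∞([0,1] × [0,∞))`; the argument order is `v x t`. -/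
def MemLinfty (v : ℝ → ℝ → ℝ) : Prop :=
  MemLp (Function.uncurry v) ⊤ (volume.restrict (Icc (0 : ℝ) 1 ×ˢ Ici (0 : ℝ)))

/-- The curve `t ↦ V t` in `L²(0,1)` is `t ↦ v(·,t)`, for every `t ≥ 0`. -/
def IsCurveOf (V : ℝ → L2I) (v : ℝ → ℝ → ℝ) : Prop :=
  ∀ t, 0 ≤ t → (V t : ℝ → ℝ) =ᵐ[muI] fun x => v x t

/-- The weak form of the momentum equation with initial velocity `u₀`. The test functions are
smooth with compact support in `[0,1) × [0,∞)`: they are unrestricted at `x = 0` and `t = 0` and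
vanish near the wall `x = 1`, where `u = 0` is prescribed. -/
def WeakMomentum (γ θ g f ρ : ℝ) (c₀ u₀ : ℝ → ℝ) (Q u ux : ℝ → ℝ → ℝ) : Prop :=
  ∀ φ : ℝ × ℝ → ℝ, ContDiff ℝ ∞ φ → HasCompactSupport φ →
    tsupport φ ⊆ {p : ℝ × ℝ | p.1 < 1} →
    (∫ t in Ioi (0 : ℝ), ∫ x in Ioo (0 : ℝ) 1,
      (u x t * deriv (fun s => φ (x, s)) t
        + ((c₀ x * Q x t) ^ γ - viscousFlux θ (c₀ x) (Q x t) (ux x t))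
            * deriv (fun y => φ (y, t)) x
        + g * φ (x, t)
        - friction f ρ (Q x t) * u x t * |u x t| * φ (x, t)))
      + ∫ x in Ioo (0 : ℝ) 1, u₀ x * φ (x, 0) = 0

/-- `(cQ, u)` with `c(x,t) = c₀(x)` is a global weak solution of
`c_t = 0`, `Q_t + ρ Q² u_x = 0`,
`u_t + ((cQ)^γ)_x = -h(Q) u |u| + g + (c^θ Q^(1+θ) u_x)_x` on `(0,1) × (0,∞)`
with initial data `(c₀ Q₀, u₀)` and boundary values `(cQ)(0,t) = 0`, `u(1,t) = 0`. -/
def IsWeakSolution (γ θ g f ρ : ℝ) (c₀ Q₀ u₀ : ℝ → ℝ) (Q u : ℝ → ℝ → ℝ) : Prop :=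
  ∃ (ux : ℝ → ℝ → ℝ) (R U S : ℝ → L2I),
    -- `c` is `C¹` away from the vacuum point and `cQ` is nonnegative
    ContDiffOn ℝ 1 c₀ (Ioc 0 1) ∧
    (∀ t, 0 ≤ t → ∀ᵐ x ∂muI, 0 ≤ c₀ x * Q x t) ∧
    -- `ux` is the weak space derivative of `u`
    (∀ t, 0 ≤ t → HasWeakDeriv (fun x => u x t) (fun x => ux x t)) ∧
    -- `cQ, u ∈ L^∞ ∩ C¹([0,∞); L²(0,1))`
    MemLinfty (fun x t => c₀ x * Q x t) ∧ MemLinfty u ∧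
    IsCurveOf R (fun x t => c₀ x * Q x t) ∧ ContDiffOn ℝ 1 R (Ici 0) ∧
    IsCurveOf U u ∧ ContDiffOn ℝ 1 U (Ici 0) ∧
    -- `c^θ Q^(1+θ) u_x ∈ L^∞ ∩ C^(1/2)([0,∞); L²(0,1))`
    MemLinfty (fun x t => viscousFlux θ (c₀ x) (Q x t) (ux x t)) ∧
    IsCurveOf S (fun x t => viscousFlux θ (c₀ x) (Q x t) (ux x t)) ∧
    (∀ T : ℝ, ∃ K : ℝ≥0, HolderOnWith K (1 / 2) S (Icc 0 T)) ∧
    -- `Q_t + ρ Q² u_x = 0` a.e., where `Q_t = (cQ)_t / c`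
    (∀ᵐ t ∂(volume.restrict (Ici (0 : ℝ))), ∀ᵐ x ∂muI,
      ((derivWithin R (Ici 0) t : L2I) : ℝ → ℝ) x / c₀ x + ρ * (Q x t) ^ 2 * ux x t = 0) ∧
    WeakMomentum γ θ g f ρ c₀ u₀ Q u ux ∧
    -- initial and boundary values (the latter as essential limits)
    (∀ᵐ x ∂muI, c₀ x * Q x 0 = c₀ x * Q₀ x) ∧ (∀ᵐ x ∂muI, u x 0 = u₀ x) ∧
    (∀ t, 0 < t → Tendsto (fun x => c₀ x * Q x t) (𝓝[>] 0 ⊓ ae volume) (𝓝 0)) ∧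
    (∀ t, 0 < t → Tendsto (fun x => u x t) (𝓝[<] 1 ⊓ ae volume) (𝓝 0))

end GasLiquid

end

/-!
Write `ℓ = (g x) ^ (1 / γ)` for the stationary profile and `s = cQ / ℓ`. Since test functions need
not vanish at `x = 0`, that end is free of stress, and the momentum equation can be integrated from
there: at every time the viscous flux is `F = g x (s ^ γ - 1) + ∫_0^x (u_t + friction)`, see
`GasLiquid.ae_eq_of_weak_momentum`. Inserted into the mass equation this gives, for almost every
`x`, a relaxation equation in time `s_t = -ρ ℓ ^ (-θ) s ^ (1 - θ) F`, which holds classically after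
a modification on null sets (`GasLiquid.exists_pointwise_solution`, `GasLiquid.exists_sol`). The
structure `GasLiquid.Sol` records this form of the problem, and all estimates are proved for it.

*Uniform bounds.* The energy `E` satisfies `E' ≤ -D` with the viscous dissipation `D`, and `D`
controls `‖u‖_∞²`, because the weight `c ℓ ^ (-(1 + θ))` is integrable for `1 + θ < γ`
(`Bdd.E_hasDerivAt`, `Bdd.U_sq_le`). Since `u_t` in the flux is a time derivative, it can be
absorbed: `s ^ θ + W` with `W = ρ θ ℓ ^ (-θ) ∫_0^x u` solves an equation without acceleration term,
and `θ ≤ γ / 2` makes `W` bounded by the square root of the energy, uniformly up to the vacuum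
point. Therefore small energy keeps `s` between fixed positive bounds for all time
(`exists_energy_threshold`).

*Decay of energy and dissipation.* With `z = s ^ θ + W - 1`, the weighted square of `z` has time
derivative at most `-k E + K D`. Hence `∫ E dt` and `∫ (1 + t) D dt` are finite
(`exists_zz_slopeLE`, `exists_energy_decay`). Testing the momentum equation with time increments of
`u` bounds the growth of `Y = D / 2 - (work of the pressure excess)`. As `F` need not be
differentiable in time, this is phrased with upper support functions (`SlopeLE`), which exist
because `Y` is a convex function of the velocity gradient (`Global.Y_le_support`,
`exists_Y_slopeLE`). Grönwall's inequality then gives `D ≤ C / (1 + t)` (`exists_D_decay`), and with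
it the decay of `u`.

*Decay of the profile.* At each `x` the equation for `z` has relaxation rate
`μ = ρ θ ℓ ^ (γ - θ)` and forcing terms that decay at least like `(1 + t) ^ (-1 / 2)`. Comparison
with the barrier `(1 + η μ t) ^ (-q)` shows that `ℓ ^ θ |s ^ θ - 1|` decays like `(1 + t) ^ (-q)`
whenever `q ≤ 1 / 2` and `q (γ - θ) ≤ θ` (`le_barrier`, `exists_s_decay`). Both conditions hold for
`q = 2 θ / (4 γ + α γ - 2)`.

The initial energy is controlled by the two small norms of the data (`Sol.exists_E_zero_le`), and
the initial dissipation by `∫ u₀ₓ²` (`Sol.D_zero_le`).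
-/

noncomputable section

namespace GasLiquid

/-! ### Comparison principles on an interval -/

/-- `f` has an upper support function at `t` whose right derivative there is at most `d`: a
differentiable function that touches `f` at `t` and lies above `f` just after `t`. This replaces
the inequality `f' t ≤ d` where `f` is not known to be differentiable. -/
def SlopeLE (f : ℝ → ℝ) (t d : ℝ) : Prop :=
  ∃ (Υ : ℝ → ℝ) (d' : ℝ), HasDerivWithinAt Υ d' (Ici t) t ∧ Υ t = f t ∧
    (∀ᶠ z in 𝓝[>] t, f z ≤ Υ z) ∧ d' ≤ d

theorem HasDerivAt.slopeLE {f : ℝ → ℝ} {t d d' : ℝ} (h : HasDerivAt f d' t) (hd : d' ≤ d) :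
    SlopeLE f t d :=
  ⟨f, d', h.hasDerivWithinAt, rfl, Eventually.of_forall fun _ => le_rfl, hd⟩

theorem SlopeLE.mono {f : ℝ → ℝ} {t d d' : ℝ} (h : SlopeLE f t d) (hd : d ≤ d') :
    SlopeLE f t d' := by
  obtain ⟨Υ, e, h1, h2, h3, h4⟩ := h
  exact ⟨Υ, e, h1, h2, h3, h4.trans hd⟩

theorem SlopeLE.add {f f₁ : ℝ → ℝ} {t d d₁ : ℝ} (h : SlopeLE f t d) (h' : SlopeLE f₁ t d₁) :
    SlopeLE (fun x => f x + f₁ x) t (d + d₁) := by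
  obtain ⟨Υ, e, h1, h2, h3, h4⟩ := h
  obtain ⟨Υ', e', h1', h2', h3', h4'⟩ := h'
  refine ⟨fun x => Υ x + Υ' x, e + e', h1.add h1', by simp [h2, h2'], ?_, by linarith⟩
  filter_upwards [h3, h3'] with z hz hz'
  linarith

theorem SlopeLE.const_mul {f : ℝ → ℝ} {t d c : ℝ} (h : SlopeLE f t d) (hc : 0 ≤ c) :
    SlopeLE (fun x => c * f x) t (c * d) := by
  obtain ⟨Υ, e, h1, h2, h3, h4⟩ := h
  refine ⟨fun x => c * Υ x, c * e, h1.const_mul c, by simp [h2], ?_,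
    mul_le_mul_of_nonneg_left h4 hc⟩
  filter_upwards [h3] with z hz
  exact mul_le_mul_of_nonneg_left hz hc

/-- Product rule for one-sided slopes, with a nonnegative differentiable weight. -/
theorem SlopeLE.weight_mul {f w : ℝ → ℝ} {t d w' : ℝ} (h : SlopeLE f t d)
    (hw : HasDerivAt w w' t) (hw0 : ∀ᶠ z in 𝓝[>] t, 0 ≤ w z) (hwt : 0 ≤ w t) :
    SlopeLE (fun x => w x * f x) t (w' * f t + w t * d) := by
  obtain ⟨Υ, e, h1, h2, h3, h4⟩ := h
  refine ⟨fun x => w x * Υ x, w' * Υ t + w t * e, hw.hasDerivWithinAt.mul h1, by simp [h2], ?_, ?_⟩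
  · filter_upwards [h3, hw0] with z hz hz'
    exact mul_le_mul_of_nonneg_left hz hz'
  · rw [h2]
    linarith [mul_le_mul_of_nonneg_left h4 hwt]

theorem le_of_slopeLE_zero {f : ℝ → ℝ} {T : ℝ} (hT : 0 ≤ T) (hf : ContinuousOn f (Icc 0 T))
    (h : ∀ t ∈ Ioo 0 T, SlopeLE f t 0) : f T ≤ f 0 := by
  rcases hT.eq_or_lt with rfl | hT
  · exact le_rfl
  have key : ∀ ε ∈ Ioo 0 T, f T ≤ f ε := by
    intro ε hε
    have hsub : Icc ε T ⊆ Icc 0 T := Icc_subset_Icc_left hε.1.le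
    refine image_le_of_liminf_slope_right_le_deriv_boundary (hf.mono hsub)
      (B := fun _ => f ε) (B' := fun _ => 0) le_rfl continuousOn_const
      (fun x _ => hasDerivWithinAt_const _ _ _) ?_ (right_mem_Icc.2 hε.2.le)
    intro x hx r hr
    obtain ⟨Υ, e, h1, h2, h3, h4⟩ := h x ⟨hε.1.trans_le hx.1, hx.2⟩
    have h5 : Tendsto (slope Υ x) (𝓝[>] x) (𝓝 e) := by
      have := hasDerivWithinAt_iff_tendsto_slope.1 h1
      simpa using this
    have h6 := h5.eventually (gt_mem_nhds (h4.trans_lt hr))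
    refine Eventually.frequently ?_
    filter_upwards [h6, h3, self_mem_nhdsWithin] with z hz hz' hz''
    refine lt_of_le_of_lt ?_ hz
    rw [slope_def_field, slope_def_field, h2]
    have : 0 < z - x := sub_pos.2 hz''
    gcongr
  have hc : Tendsto f (𝓝[Ioo 0 T] 0) (𝓝 (f 0)) :=
    (hf 0 (left_mem_Icc.2 hT.le)).mono_left (nhdsWithin_mono _ Ioo_subset_Icc_self)
  have : (𝓝[Ioo 0 T] (0 : ℝ)).NeBot := by
    rw [nhdsWithin_Ioo_eq_nhdsGT hT]; infer_instance
  exact ge_of_tendsto hc (eventually_nhdsWithin_of_forall key)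

theorem hasDerivAt_primitive {k : ℝ → ℝ} {T t : ℝ} (hk : ContinuousOn k (Icc 0 T))
    (ht : t ∈ Ioo 0 T) : HasDerivAt (fun r => ∫ x in (0 : ℝ)..r, k x) (k t) t := by
  have hn : Icc 0 T ∈ 𝓝 t := Icc_mem_nhds ht.1 ht.2
  refine intervalIntegral.integral_hasDerivAt_right ?_ ?_ (hk.continuousAt hn)
  · refine ContinuousOn.intervalIntegrable (hk.mono ?_)
    rw [uIcc_of_le ht.1.le]
    exact Icc_subset_Icc_right ht.2.le
  · exact (hk.mono Ioo_subset_Icc_self).stronglyMeasurableAtFilter isOpen_Ioo t ht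

theorem continuousOn_primitive {k : ℝ → ℝ} {T : ℝ} (hT : 0 ≤ T) (hk : ContinuousOn k (Icc 0 T)) :
    ContinuousOn (fun r => ∫ x in (0 : ℝ)..r, k x) (Icc 0 T) := by
  have := intervalIntegral.continuousOn_primitive_interval (a := 0) (b := T) (f := k)
    (μ := volume) (by rw [uIcc_of_le hT]; exact hk.integrableOn_Icc)
  rwa [uIcc_of_le hT] at this

theorem le_add_integral_of_slopeLE {f k : ℝ → ℝ} {T : ℝ} (hT : 0 ≤ T)
    (hf : ContinuousOn f (Icc 0 T)) (hk : ContinuousOn k (Icc 0 T))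
    (h : ∀ t ∈ Ioo 0 T, SlopeLE f t (k t)) : f T ≤ f 0 + ∫ t in (0 : ℝ)..T, k t := by
  have := le_of_slopeLE_zero (f := fun t => f t + -(∫ x in (0 : ℝ)..t, k x)) hT
    (hf.add (continuousOn_primitive hT hk).neg) (fun t ht => by
      have := (h t ht).add (HasDerivAt.slopeLE (hasDerivAt_primitive hk ht).neg le_rfl)
      simpa using this)
  simp at this
  linarith

/-- Grönwall's inequality for one-sided slopes. -/
theorem gronwall_of_slopeLE {f k : ℝ → ℝ} {T : ℝ} (hT : 0 ≤ T)
    (hf : ContinuousOn f (Icc 0 T)) (hk : ContinuousOn k (Icc 0 T))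
    (h : ∀ t ∈ Ioo 0 T, SlopeLE f t (k t * f t)) :
    f T ≤ f 0 * Real.exp (∫ t in (0 : ℝ)..T, k t) := by
  have := le_of_slopeLE_zero (f := fun t => Real.exp (-(∫ x in (0 : ℝ)..t, k x)) * f t) hT
    ((Real.continuous_exp.comp_continuousOn (continuousOn_primitive hT hk).neg).mul hf)
    (fun t ht => by
      have := (h t ht).weight_mul ((hasDerivAt_primitive hk ht).neg.exp)
        (Eventually.of_forall fun _ => (Real.exp_pos _).le) (Real.exp_pos _).le
      refine this.mono (le_of_eq ?_)
      simp
      ring)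
  simp only [intervalIntegral.integral_same, neg_zero, Real.exp_zero, one_mul] at this
  rw [Real.exp_neg, inv_mul_le_iff₀ (Real.exp_pos _)] at this
  linarith

/-- If `Z` decreases where `y > 1`, increases where `y < 1` and stays `δ`-close to `y`, then `y`
stays between `min (y 0) 1` and `max (y 0) 1` up to `3 δ`. -/
theorem bounds_of_relaxation {y Z Z' : ℝ → ℝ} {T δ : ℝ} (hδ : 0 < δ)
    (hZ : ContinuousOn Z (Icc 0 T))
    (hZ' : ∀ t ∈ Ico 0 T, HasDerivWithinAt Z (Z' t) (Ici t) t)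
    (h1 : ∀ t ∈ Ico 0 T, 1 < y t → Z' t < 0) (h2 : ∀ t ∈ Ico 0 T, y t < 1 → 0 < Z' t)
    (hd : ∀ t ∈ Icc 0 T, |Z t - y t| ≤ δ) (h0 : Z 0 = y 0) :
    ∀ t ∈ Icc 0 T, min (y 0) 1 - 3 * δ ≤ y t ∧ y t ≤ max (y 0) 1 + 3 * δ := by
  intro t ht
  have hb := abs_le.1 (hd t ht)
  constructor
  · have := image_le_of_deriv_right_lt_deriv_boundary' (f := fun t => -Z t) (f' := fun t => -Z' t)
      (B := fun _ => -(min (y 0) 1 - 2 * δ)) (B' := fun _ => 0) hZ.neg (fun x hx => (hZ' x hx).neg)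
      (by rw [h0]; linarith [min_le_left (y 0) 1]) continuousOn_const
      (fun x _ => hasDerivWithinAt_const _ _ _) (fun x hx hxe => by
        have := abs_le.1 (hd x (Ico_subset_Icc_self hx))
        have := h2 x hx (by linarith [min_le_right (y 0) 1])
        linarith) ht
    linarith
  · have := image_le_of_deriv_right_lt_deriv_boundary' (f := Z) (f' := Z')
      (B := fun _ => (max (y 0) 1 + 2 * δ)) (B' := fun _ => 0) hZ hZ'
      (by rw [h0]; linarith [le_max_left (y 0) 1]) continuousOn_const
      (fun x _ => hasDerivWithinAt_const _ _ _) (fun x hx hxe => by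
        have := abs_le.1 (hd x (Ico_subset_Icc_self hx))
        exact h1 x hx (by linarith [le_max_right (y 0) 1])) ht
    linarith

/-! ### Powers and the potential energy density -/

theorem exists_abs_rpow_sub_one_le (p : ℝ) {a b : ℝ} (ha : 0 < a) (ha1 : a ≤ 1) (hb1 : 1 ≤ b) :
    ∃ K : ℝ, 0 < K ∧ ∀ s ∈ Icc a b, |s ^ p - 1| ≤ K * |s - 1| := by
  have hb : 0 < b := by linarith
  refine ⟨|p| * (a ^ (p - 1) + b ^ (p - 1)) + 1, by positivity, fun s hs => ?_⟩
  have := Convex.norm_image_sub_le_of_norm_hasDerivWithin_le (f := fun s : ℝ => s ^ p)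
    (f' := fun s => p * s ^ (p - 1)) (s := Icc a b) (x := 1) (y := s)
    (C := |p| * (a ^ (p - 1) + b ^ (p - 1)))
    (fun x hx => (Real.hasDerivAt_rpow_const (Or.inl (ha.trans_le hx.1).ne')).hasDerivWithinAt)
    (fun x hx => by
      have hx0 := ha.trans_le hx.1
      rw [Real.norm_eq_abs, abs_mul, abs_of_nonneg (Real.rpow_nonneg hx0.le _)]
      refine mul_le_mul_of_nonneg_left ?_ (abs_nonneg _)
      rcases le_total 0 (p - 1) with hp | hp
      · exact (Real.rpow_le_rpow hx0.le hx.2 hp).trans (le_add_of_nonneg_left (by positivity))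
      · exact (Real.rpow_le_rpow_of_nonpos ha hx.1 hp).trans
          (le_add_of_nonneg_right (by positivity)))
    (convex_Icc a b) ⟨ha1, hb1⟩ hs
  simp only [Real.one_rpow, Real.norm_eq_abs] at this
  refine this.trans ?_
  nlinarith [abs_nonneg (s - 1)]

theorem exists_abs_sub_one_le_rpow {p : ℝ} (hp : 0 < p) {a b : ℝ} (ha : 0 < a) (ha1 : a ≤ 1)
    (hb1 : 1 ≤ b) : ∃ K : ℝ, 0 < K ∧ ∀ s ∈ Icc a b, |s - 1| ≤ K * |s ^ p - 1| := by
  obtain ⟨K, hK, h⟩ := exists_abs_rpow_sub_one_le p⁻¹ (Real.rpow_pos_of_pos ha p)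
    (Real.rpow_le_one ha.le ha1 hp.le) (Real.one_le_rpow hb1 hp.le)
  refine ⟨K, hK, fun s hs => ?_⟩
  have hs0 := ha.trans_le hs.1
  have := h (s ^ p) ⟨Real.rpow_le_rpow ha.le hs.1 hp.le, Real.rpow_le_rpow hs0.le hs.2 hp.le⟩
  rwa [Real.rpow_rpow_inv hs0.le hp.ne'] at this

/-- For `0 < θ ≤ γ` the numbers `s ^ γ - 1` and `s ^ θ - 1` have the same sign, and the former is
the larger one in absolute value. -/
theorem sq_le_rpow_sub_one_mul {γ θ s : ℝ} (hθ : 0 < θ) (h : θ ≤ γ) (hs : 0 < s) :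
    (s ^ θ - 1) ^ 2 ≤ (s ^ γ - 1) * (s ^ θ - 1) := by
  rcases le_total 1 s with h1 | h1
  · have := Real.rpow_le_rpow_of_exponent_le h1 h
    have := Real.one_le_rpow h1 hθ.le
    nlinarith
  · have := Real.rpow_le_rpow_of_exponent_ge hs h1 h
    have := Real.rpow_le_one hs.le h1 hθ.le
    nlinarith

/-- The normalized potential energy density: its derivative is `(s ^ γ - 1) / s ^ 2` and it
vanishes at the equilibrium `s = 1`. -/
def phi (γ s : ℝ) : ℝ := s ^ (γ - 1) / (γ - 1) + s⁻¹ - γ / (γ - 1)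

theorem hasDerivAt_phi {γ s : ℝ} (hγ : 1 < γ) (hs : 0 < s) :
    HasDerivAt (phi γ) ((s ^ γ - 1) * (s ^ 2)⁻¹) s := by
  have h1 : HasDerivAt (fun s : ℝ => s ^ (γ - 1) / (γ - 1))
      ((γ - 1) * s ^ (γ - 1 - 1) / (γ - 1)) s :=
    (Real.hasDerivAt_rpow_const (Or.inl hs.ne')).div_const _
  have h2 := ((h1.add (hasDerivAt_inv hs.ne')).sub_const (γ / (γ - 1)))
  refine h2.congr_deriv ?_
  have h3 : γ - 1 ≠ 0 := by linarith
  rw [show γ - 1 - 1 = γ - (2 : ℕ) by push_cast; ring, Real.rpow_sub_natCast hs.ne']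
  field_simp
  ring

theorem phi_one {γ : ℝ} (hγ : 1 < γ) : phi γ 1 = 0 := by
  have h3 : γ - 1 ≠ 0 := by linarith
  simp [phi]
  field_simp
  ring

/-- A function on an interval around `1` whose derivative has the sign of `s - 1` has its minimum
at `1`. -/
theorem le_of_deriv_mul_sub_one_nonneg {f f' : ℝ → ℝ} {a b : ℝ}
    (hf : ∀ s ∈ Icc a b, HasDerivAt f (f' s) s) (h : ∀ s ∈ Icc a b, 0 ≤ f' s * (s - 1))
    (h1 : (1 : ℝ) ∈ Icc a b) {s : ℝ} (hs : s ∈ Icc a b) : f 1 ≤ f s := by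
  rcases lt_trichotomy s 1 with hlt | rfl | hlt
  · have hsub : Icc s 1 ⊆ Icc a b := Icc_subset_Icc hs.1 h1.2
    obtain ⟨c, hc, hc'⟩ := exists_hasDerivAt_eq_slope f f' hlt
      (fun x hx => (hf x (hsub hx)).continuousAt.continuousWithinAt)
      (fun x hx => hf x (hsub (Ioo_subset_Icc_self hx)))
    have h2 := h c (hsub (Ioo_subset_Icc_self hc))
    have h3 : f' c ≤ 0 := by nlinarith [hc.2]
    rw [hc', div_le_iff₀ (by linarith)] at h3
    linarith
  · exact le_rfl
  · have hsub : Icc 1 s ⊆ Icc a b := Icc_subset_Icc h1.1 hs.2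
    obtain ⟨c, hc, hc'⟩ := exists_hasDerivAt_eq_slope f f' hlt
      (fun x hx => (hf x (hsub hx)).continuousAt.continuousWithinAt)
      (fun x hx => hf x (hsub (Ioo_subset_Icc_self hx)))
    have h2 := h c (hsub (Ioo_subset_Icc_self hc))
    have h3 : 0 ≤ f' c := by nlinarith [hc.1]
    rw [hc', le_div_iff₀ (by linarith)] at h3
    linarith

theorem exists_phi_bounds {γ a b : ℝ} (hγ : 1 < γ) (ha : 0 < a) (ha1 : a ≤ 1) (hb1 : 1 ≤ b) :
    ∃ k K : ℝ, 0 < k ∧ 0 < K ∧ ∀ s ∈ Icc a b,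
      k * (s - 1) ^ 2 ≤ phi γ s ∧ phi γ s ≤ K * (s - 1) ^ 2 := by
  obtain ⟨M, hM, hMs⟩ := exists_abs_rpow_sub_one_le γ ha ha1 hb1
  have hb : 0 < b := by linarith
  have hq : ∀ c s : ℝ, HasDerivAt (fun s : ℝ => c * (s - 1) ^ 2) (c * (2 * (s - 1))) s := by
    intro c s
    have := (((hasDerivAt_id s).sub_const 1).pow 2).const_mul c
    simpa using this
  refine ⟨(b ^ 2)⁻¹ / 2, M * (a ^ 2)⁻¹ / 2, by positivity, by positivity, fun s hs => ⟨?_, ?_⟩⟩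
  · have := le_of_deriv_mul_sub_one_nonneg (fun s hs => (hasDerivAt_phi hγ (ha.trans_le hs.1)).sub
      (hq ((b ^ 2)⁻¹ / 2) s)) (a := a) (b := b) (fun s hs => ?_) ⟨ha1, hb1⟩ hs
    · simp [phi_one hγ] at this
      linarith
    · have hs0 := ha.trans_le hs.1
      have h1 : (s - 1) ^ 2 ≤ (s ^ γ - 1) * (s - 1) := by
        simpa using sq_le_rpow_sub_one_mul one_pos hγ.le hs0
      have h2 : (b ^ 2)⁻¹ ≤ (s ^ 2)⁻¹ := by
        have := hs.2
        gcongr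
      have h3 : 0 ≤ (b ^ 2)⁻¹ := by positivity
      nlinarith [mul_le_mul h2 h1 (sq_nonneg _) (by positivity)]
  · have := le_of_deriv_mul_sub_one_nonneg (fun s hs => (hq (M * (a ^ 2)⁻¹ / 2) s).sub
      (hasDerivAt_phi hγ (ha.trans_le hs.1))) (a := a) (b := b) (fun s hs => ?_) ⟨ha1, hb1⟩ hs
    · simp [phi_one hγ] at this
      linarith
    · have hs0 := ha.trans_le hs.1
      have h1 : (s ^ γ - 1) * (s - 1) ≤ M * (s - 1) ^ 2 := by
        calc (s ^ γ - 1) * (s - 1) ≤ |(s ^ γ - 1) * (s - 1)| := le_abs_self _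
          _ = |s ^ γ - 1| * |s - 1| := abs_mul _ _
          _ ≤ M * |s - 1| * |s - 1| := by gcongr; exact hMs s hs
          _ = M * (s - 1) ^ 2 := by rw [mul_assoc, abs_mul_abs_self, sq]
      have h2 : (s ^ 2)⁻¹ ≤ (a ^ 2)⁻¹ := by
        have := hs.1
        gcongr
      have h3 : 0 ≤ (s ^ 2)⁻¹ := by positivity
      have h4 := mul_le_mul_of_nonneg_left h1 h3
      have h5 : (s ^ 2)⁻¹ * (M * (s - 1) ^ 2) ≤ (a ^ 2)⁻¹ * (M * (s - 1) ^ 2) := by gcongr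
      nlinarith

/-! ### Primitives of square integrable functions on the unit interval -/

/-- The primitive `x ↦ ∫_0^x k` of `k ∈ L²(0,1)`. -/
def prim (k : L2I) (x : ℝ) : ℝ := ∫ y in Iio x, (k : ℝ → ℝ) y ∂muI

theorem integrable_coe (k : L2I) : Integrable (k : ℝ → ℝ) muI :=
  (Lp.memLp k).integrable (by norm_num)

theorem prim_eq_inner (k : L2I) (x : ℝ) :
    prim k x = inner ℝ (indicatorConstLp 2 (μ := muI) (measurableSet_Iio (a := x))
      (measure_ne_top _ _) (1 : ℝ)) k :=
  (L2.inner_indicatorConstLp_one _ _ _).symm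

theorem prim_add (k k' : L2I) (x : ℝ) : prim (k + k') x = prim k x + prim k' x := by
  simp only [prim_eq_inner, inner_add_right]

theorem measureReal_Iio {x : ℝ} (hx : x ∈ Ioo (0 : ℝ) 1) : muI.real (Iio x) = x := by
  rw [measureReal_restrict_apply measurableSet_Iio]
  have : Iio x ∩ Ioo 0 1 = Ioo 0 x := by
    ext y
    simp only [mem_inter_iff, mem_Iio, mem_Ioo]
    constructor
    · rintro ⟨h1, h2, h3⟩; exact ⟨h2, h1⟩
    · rintro ⟨h1, h2⟩; exact ⟨h2, h1, h2.trans hx.2⟩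
  rw [this]
  simp [Real.volume_real_Ioo, hx.1.le]

theorem abs_prim_le (k : L2I) {x : ℝ} (hx : x ∈ Ioo (0 : ℝ) 1) :
    |prim k x| ≤ √x * ‖k‖ := by
  rw [prim_eq_inner]
  refine (abs_real_inner_le_norm _ _).trans (mul_le_mul_of_nonneg_right ?_ (norm_nonneg _))
  rw [norm_indicatorConstLp (by norm_num) (by norm_num), measureReal_Iio hx]
  simp [Real.sqrt_eq_rpow]

theorem abs_prim_le_of_ae {k : L2I} {M : ℝ} (hM : ∀ᵐ y ∂muI, |(k : ℝ → ℝ) y| ≤ M)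
    {x : ℝ} (hx : x ∈ Ioo (0 : ℝ) 1) : |prim k x| ≤ M * x := by
  have := norm_setIntegral_le_of_norm_le_const_ae' (μ := muI) (s := Iio x) (C := M)
    (f := (k : ℝ → ℝ)) (measure_lt_top _ _) (hM.mono fun y hy _ => hy)
  rwa [measureReal_Iio hx] at this

theorem continuousOn_prim {K : ℝ → L2I} {s : Set ℝ} (hK : ContinuousOn K s) (x : ℝ) :
    ContinuousOn (fun t => prim (K t) x) s := by
  simp only [prim_eq_inner]
  exact continuousOn_const.inner hK

theorem hasDerivWithinAt_prim {K : ℝ → L2I} {K' : L2I} {s : Set ℝ} {t : ℝ}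
    (hK : HasDerivWithinAt K K' s t) (x : ℝ) :
    HasDerivWithinAt (fun t => prim (K t) x) (prim K' x) s t := by
  simp only [prim_eq_inner]
  simpa using (hasDerivWithinAt_const t s _).inner ℝ hK

theorem measurable_prim (k : L2I) : Measurable (prim k) := by
  have h : StronglyMeasurable fun p : ℝ × ℝ => (Iio p.1).indicator (k : ℝ → ℝ) p.2 := by
    have h1 : MeasurableSet {p : ℝ × ℝ | p.2 < p.1} :=
      measurableSet_lt measurable_snd measurable_fst
    exact ((Lp.stronglyMeasurable k).comp_measurable measurable_snd).indicator h1
  have := (h.integral_prod_right' (ν := muI)).measurable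
  have h2 : prim k = fun x => ∫ y, (Iio x).indicator (k : ℝ → ℝ) y ∂muI := by
    funext x
    exact (integral_indicator measurableSet_Iio).symm
  rw [h2]
  exact this

/-- Integration by parts in the form of an exchange of integrals over the triangle `x < y`. -/
theorem integral_tail_mul {q k : ℝ → ℝ} (hq : Integrable q muI) (hk : Integrable k muI) :
    ∫ x, (∫ y in Ioi x, q y ∂muI) * k x ∂muI = ∫ y, q y * ∫ x in Iio y, k x ∂muI ∂muI := by
  have hm : MeasurableSet {p : ℝ × ℝ | p.1 < p.2} := measurableSet_lt measurable_fst measurable_snd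
  have hI : Integrable (Function.uncurry fun x y => (Ioi x).indicator (fun y => k x * q y) y)
      (muI.prod muI) := (hk.mul_prod hq).indicator hm
  have := integral_integral_swap hI
  calc _ = ∫ x, ∫ y, (Ioi x).indicator (fun y => k x * q y) y ∂muI ∂muI := by
        congr 1; funext x
        rw [integral_indicator measurableSet_Ioi, integral_const_mul, mul_comm]
    _ = _ := this
    _ = _ := by
        congr 1; funext y
        rw [← integral_indicator measurableSet_Iio, ← integral_const_mul]
        congr 1; funext x
        by_cases h : x < y
        · simp [indicator, h, mul_comm]
        · simp [indicator, h]

/-- An almost everywhere bound on `L²` functions is a closed condition. -/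
theorem isClosed_ae_abs_le (M : ℝ) : IsClosed {k : L2I | ∀ᵐ x ∂muI, |(k : ℝ → ℝ) x| ≤ M} := by
  refine isSeqClosed_iff_isClosed.1 ?_
  intro k k₀ hk hlim
  obtain ⟨ns, -, hns⟩ := (tendstoInMeasure_of_tendsto_Lp hlim).exists_seq_tendsto_ae
  have h1 : ∀ᵐ x ∂muI, ∀ n, |(k n : ℝ → ℝ) x| ≤ M := ae_all_iff.2 hk
  filter_upwards [hns, h1] with x hx hx1
  exact le_of_tendsto hx.abs (Eventually.of_forall fun n => hx1 _)

/-! ### Solutions in relaxation form -/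

/-- Parameters of the system in relaxation form. Here `k` bounds the friction coefficient and `κ`
bounds `c`; `a₀` and `b₀` bound the initial value of `cQ / cQ_∞`. -/
structure Params where
  (γ θ g ρ k κ a₀ b₀ : ℝ)
  one_lt_γ : 1 < γ
  g_pos : 0 < g
  ρ_pos : 0 < ρ
  k_nonneg : 0 ≤ k
  κ_pos : 0 < κ
  θ_pos : 0 < θ
  θ_le_one : θ ≤ 1
  θ_le_half : θ ≤ γ / 2
  θ_lt : 1 + θ < γ
  a₀_pos : 0 < a₀
  a₀_le_one : a₀ ≤ 1
  one_le_b₀ : 1 ≤ b₀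

namespace Params

variable (P : Params)

theorem γ_pos : 0 < P.γ := by linarith [P.one_lt_γ]

theorem θ_lt_γ : P.θ < P.γ := by linarith [P.θ_lt]

/-- The stationary profile, abbreviated `ℓ`; note `ℓ x ^ γ = g x`. -/
abbrev ℓ (x : ℝ) : ℝ := cQinf P.γ P.g x

theorem ℓ_pos {x : ℝ} (hx : 0 < x) : 0 < P.ℓ x :=
  Real.rpow_pos_of_pos (mul_pos P.g_pos hx) _

theorem ℓ_rpow {x : ℝ} (hx : 0 < x) (p : ℝ) : P.ℓ x ^ p = P.g ^ (p / P.γ) * x ^ (p / P.γ) := by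
  have := P.g_pos
  rw [Params.ℓ, cQinf, ← Real.rpow_mul (by positivity), Real.mul_rpow (by positivity) hx.le]
  ring_nf

theorem ℓ_rpow_γ {x : ℝ} (hx : 0 < x) : P.ℓ x ^ P.γ = P.g * x := by
  rw [P.ℓ_rpow hx, div_self P.γ_pos.ne', Real.rpow_one, Real.rpow_one]

theorem measurable_ℓ : Measurable P.ℓ := by
  unfold Params.ℓ cQinf
  fun_prop

theorem ℓ_rpow_le {x : ℝ} (hx : x ∈ Ioo (0 : ℝ) 1) {p : ℝ} (hp : 0 ≤ p) :
    P.ℓ x ^ p ≤ P.g ^ (p / P.γ) := by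
  rw [P.ℓ_rpow hx.1]
  have := P.γ_pos
  have h1 : x ^ (p / P.γ) ≤ 1 := Real.rpow_le_one hx.1.le hx.2.le (by positivity)
  have h2 : 0 < P.g ^ (p / P.γ) := Real.rpow_pos_of_pos P.g_pos _
  nlinarith

/-- The constant in `ℓ x ^ (-θ) * √x ≤ cθ`; this is where `θ ≤ γ / 2` enters. -/
def cθ : ℝ := P.g ^ (-P.θ / P.γ)

theorem cθ_pos : 0 < P.cθ := Real.rpow_pos_of_pos P.g_pos _

theorem ℓ_neg_mul_sqrt_le {x : ℝ} (hx : x ∈ Ioo (0 : ℝ) 1) : P.ℓ x ^ (-P.θ) * √x ≤ P.cθ := by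
  rw [P.ℓ_rpow hx.1, Real.sqrt_eq_rpow, mul_assoc, ← Real.rpow_add hx.1]
  have h := P.θ_le_half
  have h3 := P.γ_pos
  have h1 : x ^ (-P.θ / P.γ + 1 / 2) ≤ 1 := by
    refine Real.rpow_le_one hx.1.le hx.2.le ?_
    rw [neg_div, neg_add_eq_sub, sub_nonneg, div_le_iff₀ h3]
    linarith
  have := P.cθ_pos
  unfold cθ at *
  nlinarith

theorem ℓ_neg_mul_le {x : ℝ} (hx : x ∈ Ioo (0 : ℝ) 1) : P.ℓ x ^ (-P.θ) * x ≤ P.cθ := by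
  refine le_trans ?_ (P.ℓ_neg_mul_sqrt_le hx)
  have := P.ℓ_pos hx.1
  have h1 : x ≤ √x := Real.le_sqrt_of_sq_le (by nlinarith [hx.1, hx.2])
  gcongr

theorem ℓ_neg_mul_gx {x : ℝ} (hx : 0 < x) : P.ℓ x ^ (-P.θ) * (P.g * x) = P.ℓ x ^ (P.γ - P.θ) := by
  rw [← P.ℓ_rpow_γ hx, ← Real.rpow_add (P.ℓ_pos hx)]
  ring_nf

theorem integrable_ℓ_rpow : Integrable (fun x => P.ℓ x ^ (-(1 + P.θ))) muI := by
  have h1 : IntegrableOn (fun x : ℝ => P.g ^ (-(1 + P.θ) / P.γ) * x ^ (-(1 + P.θ) / P.γ))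
      (Ioo 0 1) := by
    refine Integrable.const_mul ?_ _
    refine (intervalIntegral.integrableOn_Ioo_rpow_iff one_pos).2 ?_
    rw [neg_div, neg_lt_neg_iff, div_lt_one P.γ_pos]
    exact P.θ_lt
  refine h1.congr_fun (fun x hx => (P.ℓ_rpow hx.1 _).symm) measurableSet_Ioo

/-- A bound on the total mass of the measure `c ℓ ^ (-(1 + θ)) dx`. -/
def mass : ℝ := P.κ * ∫ x, P.ℓ x ^ (-(1 + P.θ)) ∂muI

end Params

/-- A solution in relaxation form. The variables are `s = cQ / ℓ` and the velocity `U`, with time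
derivative `V` and friction force `H`, as curves in `L²(0,1)`; further `σ = c ℓ ^ (-(1 + θ))`.
Integrating the momentum equation from the stress-free end `x = 0` gives the viscous flux
`F = g x (s ^ γ - 1) + ∫_0^x (V + H)`, in terms of which the mass equation is an ordinary
differential equation in time for each `x` in a set `G` of full measure, and
`u_x = σ s ^ (-(1 + θ)) F` wherever `s` is positive. The field `U_repr` integrates the latter from
the wall `x = 1`; it is only asked for where `s` is bounded away from vacuum. -/
structure Sol (P : Params) where
  (G : Set ℝ) (σ : ℝ → ℝ) (s : ℝ → ℝ → ℝ) (U V H : ℝ → L2I)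
  G_sub : G ⊆ Ioo 0 1
  ae_G : ∀ᵐ x ∂muI, x ∈ G
  σ_meas : Measurable σ
  σ_nonneg : ∀ x, 0 ≤ σ x
  σ_le : ∀ x ∈ Ioo (0 : ℝ) 1, σ x ≤ P.κ * P.ℓ x ^ (-(1 + P.θ))
  s_meas : ∀ t, 0 ≤ t → AEMeasurable (fun x => s x t) muI
  s_nonneg : ∀ x ∈ G, ∀ t, 0 ≤ t → 0 ≤ s x t
  s_init : ∀ x ∈ G, s x 0 ∈ Icc P.a₀ P.b₀
  U_deriv : ∀ t, 0 ≤ t → HasDerivWithinAt U (V t) (Ici 0) t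
  V_cont : ContinuousOn V (Ici 0)
  H_cont : ContinuousOn H (Ici 0)
  H_le : ∀ t, 0 ≤ t → ∀ᵐ x ∂muI, |(H t : ℝ → ℝ) x| ≤ P.k * (U t : ℝ → ℝ) x ^ 2
  UH_nonneg : ∀ t, 0 ≤ t → ∀ᵐ x ∂muI, 0 ≤ (U t : ℝ → ℝ) x * (H t : ℝ → ℝ) x
  s_deriv : ∀ x ∈ G, ∀ t, 0 ≤ t → HasDerivWithinAt (s x)
    (-(P.ρ * P.ℓ x ^ (-P.θ) * s x t ^ (1 - P.θ) *
      (P.g * x * (s x t ^ P.γ - 1) + prim (V t + H t) x))) (Ici 0) t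
  U_repr : ∀ t, 0 < t → (∃ a > 0, ∀ x ∈ G, a ≤ s x t) → ∀ᵐ x ∂muI, (U t : ℝ → ℝ) x =
    -∫ y in Ioi x, σ y * (s y t ^ (-(1 + P.θ)) *
      (P.g * y * (s y t ^ P.γ - 1) + prim (V t + H t) y)) ∂muI

namespace Sol

variable {P : Params} (S : Sol P)

/-- The viscous flux. -/
def F (x t : ℝ) : ℝ := P.g * x * (S.s x t ^ P.γ - 1) + prim (S.V t + S.H t) x

/-- The measure `σ dx`; the velocity gradient has density `s ^ (-(1 + θ)) F` with respect to it. -/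
def τ : Measure ℝ := muI.withDensity fun x => ENNReal.ofReal (S.σ x)

theorem integral_τ (f : ℝ → ℝ) : ∫ x, f x ∂S.τ = ∫ x, S.σ x * f x ∂muI := by
  rw [τ, integral_withDensity_eq_integral_toReal_smul (by have := S.σ_meas; fun_prop)
    (Eventually.of_forall fun _ => ENNReal.ofReal_lt_top)]
  simp [ENNReal.toReal_ofReal (S.σ_nonneg _)]

theorem integrable_τ_iff {f : ℝ → ℝ} :
    Integrable f S.τ ↔ Integrable (fun x => S.σ x * f x) muI := by
  rw [τ, integrable_withDensity_iff_integrable_smul' (by have := S.σ_meas; fun_prop)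
    (Eventually.of_forall fun _ => ENNReal.ofReal_lt_top)]
  simp [ENNReal.toReal_ofReal (S.σ_nonneg _)]

theorem ae_muI_le : ∀ᵐ x ∂muI, S.σ x ≤ P.κ * P.ℓ x ^ (-(1 + P.θ)) := by
  filter_upwards [ae_restrict_mem measurableSet_Ioo] with x hx using S.σ_le x hx

theorem integrable_σ : Integrable S.σ muI := by
  refine (P.integrable_ℓ_rpow.const_mul P.κ).mono' S.σ_meas.aestronglyMeasurable ?_
  filter_upwards [S.ae_muI_le] with x hx
  rwa [Real.norm_eq_abs, abs_of_nonneg (S.σ_nonneg x)]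

instance : IsFiniteMeasure S.τ := by
  have : Integrable (fun _ : ℝ => (1 : ℝ)) S.τ := by
    rw [S.integrable_τ_iff]
    simpa using S.integrable_σ
  exact (integrable_const_iff.1 this).resolve_left one_ne_zero

theorem τ_real_le : S.τ.real univ ≤ P.mass := by
  have h := S.integral_τ fun _ => 1
  simp only [integral_const, smul_eq_mul, mul_one] at h
  rw [h, Params.mass, ← integral_const_mul]
  exact integral_mono_ae S.integrable_σ (P.integrable_ℓ_rpow.const_mul P.κ) S.ae_muI_le

theorem τ_ac : S.τ ≪ muI := withDensity_absolutelyContinuous _ _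

theorem ae_τ : ∀ᵐ x ∂S.τ, x ∈ S.G := S.τ_ac.ae_le S.ae_G

theorem pos_of_mem {x : ℝ} (hx : x ∈ S.G) : 0 < x := (S.G_sub hx).1

theorem aemeas_s {t : ℝ} (ht : 0 ≤ t) : AEMeasurable (fun x => S.s x t) S.τ :=
  (S.s_meas t ht).mono_ac S.τ_ac

theorem aemeas_F {t : ℝ} (ht : 0 ≤ t) : AEMeasurable (fun x => S.F x t) S.τ := by
  have h1 := S.aemeas_s ht
  have h2 := measurable_prim (S.V t + S.H t)
  unfold F
  fun_prop

/-- Almost everywhere measurable functions bounded on `G` are integrable for the finite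
measure `τ`. -/
theorem integrable_of_bdd {f : ℝ → ℝ} {C : ℝ} (hf : AEMeasurable f S.τ)
    (hC : ∀ x ∈ S.G, |f x| ≤ C) : Integrable f S.τ :=
  Integrable.of_bound hf.aestronglyMeasurable C (S.ae_τ.mono fun x hx => hC x hx)

theorem continuousOn_integral {f : ℝ → ℝ → ℝ} {w : ℝ → ℝ} {T : ℝ}
    (hm : ∀ t ∈ Icc 0 T, AEMeasurable (fun x => f x t) S.τ)
    (hc : ∀ x ∈ S.G, ContinuousOn (f x) (Icc 0 T)) (hw : Integrable w S.τ)
    (hb : ∀ x ∈ S.G, ∀ t ∈ Icc 0 T, |f x t| ≤ w x) :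
    ContinuousOn (fun t => ∫ x, f x t ∂S.τ) (Icc 0 T) := fun t ht =>
  continuousWithinAt_of_dominated
    (eventually_nhdsWithin_of_forall fun r hr => (hm r hr).aestronglyMeasurable)
    (eventually_nhdsWithin_of_forall fun r hr => S.ae_τ.mono fun x hx => hb x hx r hr) hw
    (S.ae_τ.mono fun x hx => hc x hx t ht)

theorem hasDerivAt_integral {f f' : ℝ → ℝ → ℝ} {w : ℝ → ℝ} {T t : ℝ} (ht : t ∈ Ioo 0 T)
    (hm : ∀ t ∈ Ioo 0 T, AEMeasurable (fun x => f x t) S.τ)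
    (hi : Integrable (fun x => f x t) S.τ)
    (hm' : AEMeasurable (fun x => f' x t) S.τ) (hw : Integrable w S.τ)
    (hd : ∀ x ∈ S.G, ∀ t ∈ Ioo 0 T, HasDerivAt (f x) (f' x t) t)
    (hb : ∀ x ∈ S.G, ∀ t ∈ Ioo 0 T, |f' x t| ≤ w x) :
    HasDerivAt (fun t => ∫ x, f x t ∂S.τ) (∫ x, f' x t ∂S.τ) t := by
  have hn : Ioo 0 T ∈ 𝓝 t := Ioo_mem_nhds ht.1 ht.2
  refine (hasDerivAt_integral_of_dominated_loc_of_deriv_le (F := fun t x => f x t)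
    (F' := fun t x => f' x t) hn ?_ hi hm'.aestronglyMeasurable
    (S.ae_τ.mono fun x hx r hr => hb x hx r hr) hw
    (S.ae_τ.mono fun x hx r hr => hd x hx r hr)).2
  filter_upwards [hn] with r hr using (hm r hr).aestronglyMeasurable

theorem U_cont : ContinuousOn S.U (Ici 0) := fun t ht => (S.U_deriv t ht).continuousWithinAt

theorem VH_cont : ContinuousOn (fun t => S.V t + S.H t) (Ici 0) := S.V_cont.add S.H_cont

theorem s_cont {x : ℝ} (hx : x ∈ S.G) : ContinuousOn (S.s x) (Ici 0) :=
  fun t ht => (S.s_deriv x hx t ht).continuousWithinAt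

theorem F_cont {x : ℝ} (hx : x ∈ S.G) : ContinuousOn (S.F x) (Ici 0) := by
  have h1 := (S.s_cont hx).rpow_const (p := P.γ) (fun t _ => Or.inr P.γ_pos.le)
  exact ((h1.sub continuousOn_const).const_smul (P.g * x)).add (continuousOn_prim S.VH_cont x)

theorem s_deriv_F {x : ℝ} (hx : x ∈ S.G) {t : ℝ} (ht : 0 ≤ t) : HasDerivWithinAt (S.s x)
    (-(P.ρ * P.ℓ x ^ (-P.θ) * S.s x t ^ (1 - P.θ) * S.F x t)) (Ici 0) t :=
  S.s_deriv x hx t ht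

theorem s_hasDerivAt {x : ℝ} (hx : x ∈ S.G) {t : ℝ} (ht : 0 < t) : HasDerivAt (S.s x)
    (-(P.ρ * P.ℓ x ^ (-P.θ) * S.s x t ^ (1 - P.θ) * S.F x t)) t :=
  (S.s_deriv_F hx ht.le).hasDerivAt (Ici_mem_nhds ht)

theorem abs_F_le {x t a b : ℝ} (hx : x ∈ S.G) (ha : 0 ≤ a)
    (hs : S.s x t ∈ Icc a b) :
    |S.F x t| ≤ P.g * (b ^ P.γ + 1) + ‖S.V t + S.H t‖ := by
  have hx' := S.G_sub hx
  have h1 := abs_prim_le (S.V t + S.H t) hx'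
  have h2 : √x ≤ 1 := Real.sqrt_le_one.2 hx'.2.le
  have h3 : S.s x t ^ P.γ ≤ b ^ P.γ := Real.rpow_le_rpow (ha.trans hs.1) hs.2 P.γ_pos.le
  have h4 : 0 ≤ S.s x t ^ P.γ := Real.rpow_nonneg (ha.trans hs.1) _
  have h5 : |S.s x t ^ P.γ - 1| ≤ b ^ P.γ + 1 := by rw [abs_le]; constructor <;> linarith
  have hg := P.g_pos
  calc |S.F x t| ≤ |P.g * x * (S.s x t ^ P.γ - 1)| + |prim (S.V t + S.H t) x| := abs_add_le _ _
    _ ≤ _ := by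
        gcongr
        · rw [abs_mul, abs_of_pos (mul_pos hg hx'.1)]
          have : P.g * x ≤ P.g := by nlinarith [hx'.2]
          gcongr
        · exact h1.trans (by nlinarith [norm_nonneg (S.V t + S.H t)])

/-- The normalized profile stays in `[a, b]` up to time `T`. -/
def Bdd (a b T : ℝ) : Prop := ∀ x ∈ S.G, ∀ t ∈ Icc 0 T, S.s x t ∈ Icc a b

theorem exists_VH_bound (T : ℝ) : ∃ M, ∀ t ∈ Icc 0 T, ‖S.V t + S.H t‖ ≤ M :=
  isCompact_Icc.exists_bound_of_continuousOn (S.VH_cont.mono Icc_subset_Ici_self)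

variable {S} {a b T : ℝ}

theorem Bdd.pos (h : S.Bdd a b T) (ha : 0 < a) {x t : ℝ} (hx : x ∈ S.G) (ht : t ∈ Icc 0 T) :
    0 < S.s x t := ha.trans_le (h x hx t ht).1

theorem Bdd.exists_F_bound (h : S.Bdd a b T) (ha : 0 < a) (hab : a ≤ b) :
    ∃ M, 0 ≤ M ∧ ∀ x ∈ S.G, ∀ t ∈ Icc 0 T, |S.F x t| ≤ M := by
  obtain ⟨M, hM⟩ := S.exists_VH_bound T
  have hb : 0 < b := ha.trans_le hab
  refine ⟨P.g * (b ^ P.γ + 1) + |M|, ?_, fun x hx t ht => ?_⟩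
  · have := P.g_pos; positivity
  · refine (S.abs_F_le hx ha.le (h x hx t ht)).trans ?_
    gcongr
    exact (hM t ht).trans (le_abs_self _)

theorem Bdd.rpow_cont (h : S.Bdd a b T) (ha : 0 < a) {x : ℝ} (hx : x ∈ S.G) (p : ℝ) :
    ContinuousOn (fun t => S.s x t ^ p) (Icc 0 T) :=
  ((S.s_cont hx).mono Icc_subset_Ici_self).rpow_const fun _ ht => Or.inl (h.pos ha hx ht).ne'

theorem rpow_le_add {a b s : ℝ} (ha : 0 < a) (hs : s ∈ Icc a b) (p : ℝ) :
    s ^ p ≤ a ^ p + b ^ p := by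
  have hs0 : 0 < s := ha.trans_le hs.1
  have hb : 0 < b := hs0.trans_le hs.2
  rcases le_total 0 p with hp | hp
  · exact (Real.rpow_le_rpow hs0.le hs.2 hp).trans (le_add_of_nonneg_left (by positivity))
  · exact (Real.rpow_le_rpow_of_nonpos ha hs.1 hp).trans (le_add_of_nonneg_right (by positivity))

variable (S)

/-- The velocity gradient `u_x / σ` with respect to the measure `τ`. -/
def grad (x t : ℝ) : ℝ := S.s x t ^ (-(1 + P.θ)) * S.F x t

/-- The viscous dissipation `∫ c ^ θ Q ^ (1 + θ) u_x² dx`. -/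
def D (t : ℝ) : ℝ := ∫ x, S.grad x t * S.F x t ∂S.τ

/-- The total energy: kinetic energy plus potential energy relative to the stationary profile. -/
def E (t : ℝ) : ℝ :=
  ‖S.U t‖ ^ 2 / 2 + P.ρ⁻¹ * ∫ x, P.ℓ x ^ (P.γ + P.θ) * phi P.γ (S.s x t) ∂S.τ

variable {S}

theorem aemeas_grad {t : ℝ} (ht : 0 ≤ t) : AEMeasurable (fun x => S.grad x t) S.τ := by
  have h1 := S.aemeas_s ht
  have h2 := S.aemeas_F ht
  unfold grad
  fun_prop

theorem Bdd.grad_cont (h : S.Bdd a b T) (ha : 0 < a) {x : ℝ} (hx : x ∈ S.G) :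
    ContinuousOn (S.grad x) (Icc 0 T) :=
  (h.rpow_cont ha hx _).mul ((S.F_cont hx).mono Icc_subset_Ici_self)

theorem Bdd.exists_grad_bound (h : S.Bdd a b T) (ha : 0 < a) (hab : a ≤ b) :
    ∃ M, 0 ≤ M ∧ ∀ x ∈ S.G, ∀ t ∈ Icc 0 T, |S.grad x t| ≤ M := by
  obtain ⟨M, hM0, hM⟩ := h.exists_F_bound ha hab
  have hb : 0 < b := ha.trans_le hab
  refine ⟨(a ^ (-(1 + P.θ)) + b ^ (-(1 + P.θ))) * M, by positivity, fun x hx t ht => ?_⟩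
  have hs := h.pos ha hx ht
  rw [grad, abs_mul, abs_of_pos (Real.rpow_pos_of_pos hs _)]
  exact mul_le_mul (rpow_le_add ha (h x hx t ht) _) (hM x hx t ht) (abs_nonneg _) (by positivity)

theorem Bdd.integrable_grad_mul (h : S.Bdd a b T) (ha : 0 < a) (hab : a ≤ b) {t : ℝ}
    (ht : t ∈ Icc 0 T) {f : ℝ → ℝ} {C : ℝ} (hf : AEMeasurable f S.τ)
    (hC : ∀ x ∈ S.G, |f x| ≤ C) : Integrable (fun x => S.grad x t * f x) S.τ := by
  obtain ⟨M, hM0, hM⟩ := h.exists_grad_bound ha hab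
  refine S.integrable_of_bdd (C := M * C) ((aemeas_grad ht.1).mul hf) fun x hx => ?_
  rw [abs_mul]
  exact mul_le_mul (hM x hx t ht) (hC x hx) (abs_nonneg _) hM0

theorem abs_prim_le_norm (k : L2I) {x : ℝ} (hx : x ∈ S.G) : |prim k x| ≤ ‖k‖ := by
  have hx' := S.G_sub hx
  refine (abs_prim_le k hx').trans ?_
  have h2 : √x ≤ 1 := Real.sqrt_le_one.2 hx'.2.le
  nlinarith [norm_nonneg k]

theorem Bdd.D_cont (h : S.Bdd a b T) (ha : 0 < a) (hab : a ≤ b) : ContinuousOn S.D (Icc 0 T) := by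
  obtain ⟨M, hM0, hM⟩ := h.exists_grad_bound ha hab
  obtain ⟨M', hM0', hM'⟩ := h.exists_F_bound ha hab
  refine S.continuousOn_integral (w := fun _ => M * M')
    (fun t ht => (aemeas_grad ht.1).mul (S.aemeas_F ht.1))
    (fun x hx => (h.grad_cont ha hx).mul ((S.F_cont hx).mono Icc_subset_Ici_self))
    (integrable_const _) fun x hx t ht => ?_
  rw [abs_mul]
  exact mul_le_mul (hM x hx t ht) (hM' x hx t ht) (abs_nonneg _) hM0

/-- Testing the velocity against `k` in `L²`, by parts. -/
theorem Bdd.inner_U_of_pos (h : S.Bdd a b T) (ha : 0 < a) (hab : a ≤ b) {t : ℝ} (ht : t ∈ Ioc 0 T)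
    (k : L2I) : inner ℝ (S.U t) k = -∫ x, S.grad x t * prim k x ∂S.τ := by
  have ht' : t ∈ Icc 0 T := Ioc_subset_Icc_self ht
  have hrep : ∀ᵐ x ∂muI, (S.U t : ℝ → ℝ) x = -∫ y in Ioi x, S.σ y * S.grad y t ∂muI :=
    S.U_repr t ht.1 ⟨a, ha, fun x hx => (h x hx t ht').1⟩
  have hq : Integrable (fun y => S.σ y * S.grad y t) muI := by
    rw [← S.integrable_τ_iff]
    simpa using h.integrable_grad_mul ha hab ht' (f := fun _ => 1) (C := 1) (by fun_prop)
      (by simp)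
  have := integral_tail_mul hq (integrable_coe k)
  rw [L2.inner_def]
  calc ∫ x, inner ℝ ((S.U t : ℝ → ℝ) x) ((k : ℝ → ℝ) x) ∂muI
      = ∫ x, -((∫ y in Ioi x, S.σ y * S.grad y t ∂muI) * (k : ℝ → ℝ) x) ∂muI := by
        refine integral_congr_ae ?_
        filter_upwards [hrep] with x hx
        simp only [RCLike.inner_apply, conj_trivial, hx]
        ring
    _ = _ := by
        rw [integral_neg, this, S.integral_τ]
        simp only [prim, mul_assoc]

theorem Bdd.inner_U (h : S.Bdd a b T) (ha : 0 < a) (hab : a ≤ b) (hT : 0 < T) {t : ℝ}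
    (ht : t ∈ Icc 0 T) (k : L2I) :
    inner ℝ (S.U t) k = -∫ x, S.grad x t * prim k x ∂S.τ := by
  rcases ht.1.eq_or_lt with rfl | ht0
  swap
  · exact h.inner_U_of_pos ha hab ⟨ht0, ht.2⟩ k
  obtain ⟨M, hM0, hM⟩ := h.exists_grad_bound ha hab
  have hc1 : ContinuousOn (fun t => inner ℝ (S.U t) k) (Icc 0 T) :=
    (S.U_cont.mono Icc_subset_Ici_self).inner continuousOn_const
  have hc2 : ContinuousOn (fun t => -∫ x, S.grad x t * prim k x ∂S.τ) (Icc 0 T) := by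
    refine (S.continuousOn_integral (f := fun x t => S.grad x t * prim k x)
      (w := fun _ => M * ‖k‖)
      (fun t ht => (aemeas_grad ht.1).mul (measurable_prim k).aemeasurable)
      (fun x hx => (h.grad_cont ha hx).mul continuousOn_const)
      (integrable_const _) fun x hx t ht => ?_).neg
    rw [abs_mul]
    exact mul_le_mul (hM x hx t ht) (abs_prim_le_norm k hx) (abs_nonneg _) hM0
  have h1 : Tendsto (fun t => inner ℝ (S.U t) k) (𝓝[Ioc 0 T] 0) (𝓝 _) :=
    (hc1 0 ht).mono_left (nhdsWithin_mono _ Ioc_subset_Icc_self)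
  have h2 := (hc2 0 ht).mono_left (nhdsWithin_mono _ Ioc_subset_Icc_self)
  have : (𝓝[Ioc 0 T] (0 : ℝ)).NeBot := by
    rw [nhdsWithin_Ioc_eq_nhdsGT hT]; infer_instance
  refine tendsto_nhds_unique (h1.congr' ?_) h2
  exact eventually_nhdsWithin_of_forall fun r hr => h.inner_U_of_pos ha hab hr k

end Sol

/-! ### The energy inequality -/

theorem sq_integral_le {α : Type*} [MeasurableSpace α] {μ : Measure α} [IsFiniteMeasure μ]
    {f : α → ℝ} (hf : Integrable f μ) (hf2 : Integrable (fun x => f x ^ 2) μ) :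
    (∫ x, f x ∂μ) ^ 2 ≤ μ.real univ * ∫ x, f x ^ 2 ∂μ := by
  set m := μ.real univ with hm
  set B := ∫ x, f x ∂μ with hB
  have h0 : 0 ≤ m := measureReal_nonneg
  have key : 0 ≤ ∫ x, (m * f x - B) ^ 2 ∂μ := integral_nonneg fun x => sq_nonneg _
  have h1 : ∫ x, (m * f x - B) ^ 2 ∂μ = m ^ 2 * (∫ x, f x ^ 2 ∂μ) - m * B ^ 2 := by
    have : ∀ x, (m * f x - B) ^ 2 = m ^ 2 * f x ^ 2 - 2 * m * B * f x + B ^ 2 := fun x => by ring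
    simp only [this]
    have i1 : Integrable (fun x => m ^ 2 * f x ^ 2 - 2 * m * B * f x) μ :=
      (hf2.const_mul _).sub (hf.const_mul _)
    rw [integral_add i1 (integrable_const _),
      integral_sub (hf2.const_mul _) (hf.const_mul _), integral_const_mul, integral_const_mul,
      integral_const, smul_eq_mul, ← hm, ← hB]
    ring
  rw [h1] at key
  rcases h0.eq_or_lt with h | h
  · have hμ : μ = 0 := by
      have : μ univ = 0 := by
        have := h.symm
        rwa [hm, measureReal_def, ENNReal.toReal_eq_zero_iff, or_iff_left (measure_ne_top _ _)]
          at this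
      exact Measure.measure_univ_eq_zero.1 this
    simp [hB, hμ]
  · have : m * B ^ 2 ≤ m * (m * ∫ x, f x ^ 2 ∂μ) := by nlinarith
    exact le_of_mul_le_mul_left this h

namespace Params

variable (P : Params)

/-- The constant in `‖u‖_∞ ² ≤ kU a * D` for profiles bounded below by `a`. -/
def kU (a : ℝ) : ℝ := P.mass * a ^ (-(1 + P.θ))

theorem mass_nonneg : 0 ≤ P.mass := by
  refine mul_nonneg P.κ_pos.le (integral_nonneg_of_ae ?_)
  filter_upwards [ae_restrict_mem measurableSet_Ioo] with x hx
  exact Real.rpow_nonneg (P.ℓ_pos hx.1).le _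

theorem kU_nonneg {a : ℝ} (ha : 0 < a) : 0 ≤ P.kU a :=
  mul_nonneg P.mass_nonneg (Real.rpow_nonneg ha.le _)

end Params

namespace Sol

variable {P : Params} {S : Sol P} {a b T : ℝ}

variable (S) in
/-- The pressure excess `(cQ) ^ γ - g x`. -/
def pr (x t : ℝ) : ℝ := P.g * x * (S.s x t ^ P.γ - 1)

theorem F_eq (x t : ℝ) : S.F x t = S.pr x t + prim (S.V t + S.H t) x := rfl

theorem abs_pr_le {x t : ℝ} (hx : x ∈ S.G) (ha : 0 ≤ a) (hs : S.s x t ∈ Icc a b) :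
    |S.pr x t| ≤ P.g * x * (b ^ P.γ + 1) := by
  have hx' := S.G_sub hx
  have h3 : S.s x t ^ P.γ ≤ b ^ P.γ := Real.rpow_le_rpow (ha.trans hs.1) hs.2 P.γ_pos.le
  have h4 : 0 ≤ S.s x t ^ P.γ := Real.rpow_nonneg (ha.trans hs.1) _
  have h5 : |S.s x t ^ P.γ - 1| ≤ b ^ P.γ + 1 := by rw [abs_le]; constructor <;> linarith
  have hg := mul_pos P.g_pos hx'.1
  rw [pr, abs_mul, abs_of_pos hg]
  gcongr

/-- The relaxation speed `ℓ ^ (-θ) |F|` is bounded uniformly up to the vacuum point. -/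
theorem ℓ_mul_abs_F_le {x t : ℝ} (hx : x ∈ S.G) (ha : 0 ≤ a) (hs : S.s x t ∈ Icc a b) :
    P.ℓ x ^ (-P.θ) * |S.F x t| ≤ P.cθ * (P.g * (b ^ P.γ + 1) + ‖S.V t + S.H t‖) := by
  have hx' := S.G_sub hx
  have hℓ := Real.rpow_pos_of_pos (P.ℓ_pos hx'.1) (-P.θ)
  have hb : 0 ≤ b := ha.trans (hs.1.trans hs.2)
  have hg := P.g_pos
  have h1 : |S.F x t| ≤ P.g * x * (b ^ P.γ + 1) + √x * ‖S.V t + S.H t‖ :=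
    (abs_add_le _ _).trans (add_le_add (abs_pr_le hx ha hs) (abs_prim_le _ hx'))
  calc P.ℓ x ^ (-P.θ) * |S.F x t|
      ≤ P.ℓ x ^ (-P.θ) * (P.g * x * (b ^ P.γ + 1) + √x * ‖S.V t + S.H t‖) := by gcongr
    _ = (P.ℓ x ^ (-P.θ) * x) * (P.g * (b ^ P.γ + 1)) +
          (P.ℓ x ^ (-P.θ) * √x) * ‖S.V t + S.H t‖ := by ring
    _ ≤ P.cθ * (P.g * (b ^ P.γ + 1)) + P.cθ * ‖S.V t + S.H t‖ := by
        gcongr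
        · exact P.ℓ_neg_mul_le hx'
        · exact P.ℓ_neg_mul_sqrt_le hx'
    _ = _ := by ring

theorem grad_mul_F_nonneg {x t : ℝ} (hs : 0 ≤ S.s x t) : 0 ≤ S.grad x t * S.F x t := by
  rw [grad, mul_assoc, ← sq]
  have := Real.rpow_nonneg hs (-(1 + P.θ))
  positivity

theorem D_nonneg {t : ℝ} (ht : 0 ≤ t) : 0 ≤ S.D t :=
  integral_nonneg_of_ae (S.ae_τ.mono fun x hx => grad_mul_F_nonneg (S.s_nonneg x hx t ht))

theorem Bdd.mono {T' : ℝ} (h : S.Bdd a b T) (hT : T' ≤ T) : S.Bdd a b T' :=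
  fun x hx t ht => h x hx t ⟨ht.1, ht.2.trans hT⟩

theorem phi_nonneg {γ s : ℝ} (hγ : 1 < γ) (hs : 0 < s) : 0 ≤ phi γ s := by
  obtain ⟨k, K, hk, -, h⟩ := exists_phi_bounds hγ (lt_min hs one_pos) (min_le_right s 1)
    (le_max_right s 1)
  exact le_trans (by positivity) (h s ⟨min_le_left _ _, le_max_left _ _⟩).1

theorem aemeas_phi {t : ℝ} (ht : 0 ≤ t) : AEMeasurable (fun x => phi P.γ (S.s x t)) S.τ := by
  have h1 := S.aemeas_s ht
  unfold phi
  fun_prop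

theorem aemeas_pr {t : ℝ} (ht : 0 ≤ t) : AEMeasurable (fun x => S.pr x t) S.τ := by
  have h1 := S.aemeas_s ht
  unfold pr
  fun_prop

theorem Bdd.exists_phi_le (h : S.Bdd a b T) (ha : 0 < a) (ha1 : a ≤ 1) (hb1 : 1 ≤ b) :
    ∃ C, ∀ x ∈ S.G, ∀ t ∈ Icc 0 T, |P.ℓ x ^ (P.γ + P.θ) * phi P.γ (S.s x t)| ≤ C := by
  obtain ⟨k, K, hk, hK, hφ⟩ := exists_phi_bounds P.one_lt_γ ha ha1 hb1
  have := P.γ_pos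
  have := P.θ_pos
  refine ⟨P.g ^ ((P.γ + P.θ) / P.γ) * (K * b ^ 2), fun x hx t ht => ?_⟩
  have hs := h x hx t ht
  rw [abs_mul, abs_of_nonneg (phi_nonneg P.one_lt_γ (h.pos ha hx ht)),
    abs_of_nonneg (Real.rpow_nonneg (P.ℓ_pos (S.pos_of_mem hx)).le _)]
  have h0 := phi_nonneg P.one_lt_γ (h.pos ha hx ht)
  have hg : 0 ≤ P.g ^ ((P.γ + P.θ) / P.γ) := Real.rpow_nonneg P.g_pos.le _
  refine mul_le_mul (P.ℓ_rpow_le (S.G_sub hx) (by linarith)) ?_ h0 hg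
  refine (hφ _ hs).2.trans ?_
  have : (S.s x t - 1) ^ 2 ≤ b ^ 2 := sq_le_sq' (by linarith [hs.1]) (by linarith [hs.2])
  gcongr

theorem phi_s_hasDerivAt {x t : ℝ} (hx : x ∈ S.G) (ht : 0 < t) (hs : 0 < S.s x t) :
    HasDerivAt (fun r => P.ℓ x ^ (P.γ + P.θ) * phi P.γ (S.s x r))
      (-(P.ρ * (S.pr x t * S.grad x t))) t := by
  have h1 := ((hasDerivAt_phi P.one_lt_γ hs).comp t (S.s_hasDerivAt hx ht)).const_mul
    (P.ℓ x ^ (P.γ + P.θ))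
  refine h1.congr_deriv ?_
  have hℓ := P.ℓ_pos (S.pos_of_mem hx)
  have e1 : P.ℓ x ^ (P.γ + P.θ) * P.ℓ x ^ (-P.θ) = P.g * x := by
    rw [← Real.rpow_add hℓ, ← P.ℓ_rpow_γ (S.pos_of_mem hx)]; ring_nf
  have e2 : (S.s x t ^ 2)⁻¹ * S.s x t ^ (1 - P.θ) = S.s x t ^ (-(1 + P.θ)) := by
    rw [← Real.rpow_natCast, ← Real.rpow_neg hs.le, ← Real.rpow_add hs]
    push_cast
    ring_nf
  rw [pr, grad, ← e1, ← e2]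
  ring

theorem Bdd.E_cont (h : S.Bdd a b T) (ha : 0 < a) (ha1 : a ≤ 1) (hb1 : 1 ≤ b) :
    ContinuousOn S.E (Icc 0 T) := by
  obtain ⟨C, hC⟩ := h.exists_phi_le ha ha1 hb1
  have h1 : ContinuousOn (fun t => ‖S.U t‖ ^ 2 / 2) (Icc 0 T) :=
    ((S.U_cont.mono Icc_subset_Ici_self).norm.pow 2).div_const 2
  refine h1.add (continuousOn_const.mul (S.continuousOn_integral (w := fun _ => C)
    (fun t ht => (P.measurable_ℓ.pow_const _).aemeasurable.mul (aemeas_phi ht.1))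
    (fun x hx => ContinuousOn.mul continuousOn_const fun t ht => ?_) (integrable_const _) hC))
  exact (hasDerivAt_phi P.one_lt_γ (h.pos ha hx ht)).continuousAt.comp_continuousWithinAt
    ((S.s_cont hx).mono Icc_subset_Ici_self t ht)

/-- The energy identity. The potential part of `E` contributes the work of the pressure excess and
the kinetic part, through `Bdd.inner_U`, the remaining part of the dissipation. -/
theorem Bdd.E_hasDerivAt (h : S.Bdd a b T) (ha : 0 < a) (ha1 : a ≤ 1) (hb1 : 1 ≤ b) {t : ℝ}
    (ht : t ∈ Ioo 0 T) : HasDerivAt S.E (-S.D t - inner ℝ (S.U t) (S.H t)) t := by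
  have hab := ha1.trans hb1
  have hT : 0 < T := ht.1.trans ht.2
  have ht' := Ioo_subset_Icc_self ht
  have hg := P.g_pos
  have hb : 0 < b := by linarith
  obtain ⟨C, hC⟩ := h.exists_phi_le ha ha1 hb1
  obtain ⟨M, hM0, hM⟩ := h.exists_grad_bound ha hab
  have hpr : ∀ x ∈ S.G, ∀ t ∈ Icc 0 T, |S.pr x t| ≤ P.g * (b ^ P.γ + 1) := fun x hx t ht => by
    refine (abs_pr_le hx ha.le (h x hx t ht)).trans ?_
    have : P.g * x ≤ P.g := by nlinarith [(S.G_sub hx).2]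
    gcongr
  have hm1 : ∀ t ∈ Icc 0 T,
      AEMeasurable (fun x => P.ℓ x ^ (P.γ + P.θ) * phi P.γ (S.s x t)) S.τ := fun t ht =>
    (P.measurable_ℓ.pow_const _).aemeasurable.mul (aemeas_phi ht.1)
  have h2 := S.hasDerivAt_integral (f := fun x t => P.ℓ x ^ (P.γ + P.θ) * phi P.γ (S.s x t))
    (f' := fun x t => -(P.ρ * (S.pr x t * S.grad x t)))
    (w := fun _ => P.ρ * (P.g * (b ^ P.γ + 1) * M)) ht
    (fun t ht => hm1 t (Ioo_subset_Icc_self ht))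
    (S.integrable_of_bdd (hm1 t ht') fun x hx => hC x hx t ht')
    ((((aemeas_pr ht'.1).mul (aemeas_grad ht'.1)).const_mul P.ρ).neg) (integrable_const _)
    (fun x hx r hr => phi_s_hasDerivAt hx hr.1 (h.pos ha hx (Ioo_subset_Icc_self hr)))
    (fun x hx r hr => by
      have hr' := Ioo_subset_Icc_self hr
      rw [abs_neg, abs_mul, abs_mul, abs_of_pos P.ρ_pos]
      have := P.ρ_pos
      gcongr
      · exact hpr x hx r hr'
      · exact hM x hx r hr')
  have h1 : HasDerivAt (fun t => ‖S.U t‖ ^ 2 / 2) (inner ℝ (S.U t) (S.V t)) t := by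
    have := (((S.U_deriv t ht'.1).hasDerivAt (Ici_mem_nhds ht.1)).norm_sq).div_const 2
    simpa using this
  refine (h1.add (h2.const_mul P.ρ⁻¹)).congr_deriv ?_
  have h3 : inner ℝ (S.U t) (S.V t) =
      inner ℝ (S.U t) (S.V t + S.H t) - inner ℝ (S.U t) (S.H t) := by
    rw [inner_add_right]; ring
  have hi1 : Integrable (fun x => S.grad x t * S.pr x t) S.τ :=
    h.integrable_grad_mul ha hab ht' (aemeas_pr ht'.1) fun x hx => hpr x hx t ht'
  have hi2 : Integrable (fun x => S.grad x t * prim (S.V t + S.H t) x) S.τ :=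
    h.integrable_grad_mul ha hab ht' (measurable_prim _).aemeasurable
      fun x hx => abs_prim_le_norm _ hx
  have h4 : S.D t = (∫ x, S.grad x t * S.pr x t ∂S.τ) +
      ∫ x, S.grad x t * prim (S.V t + S.H t) x ∂S.τ := by
    rw [← integral_add hi1 hi2, D]
    congr 1; funext x
    rw [F_eq]; ring
  rw [h3, h.inner_U ha hab hT ht', h4, integral_neg, integral_const_mul]
  have h5 : ∫ x, S.pr x t * S.grad x t ∂S.τ = ∫ x, S.grad x t * S.pr x t ∂S.τ := by
    congr 1; funext x; ring
  rw [h5]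
  have := P.ρ_pos.ne'
  field_simp
  ring

theorem inner_U_H_nonneg {t : ℝ} (ht : 0 ≤ t) : 0 ≤ inner ℝ (S.U t) (S.H t) := by
  rw [L2.inner_def]
  refine integral_nonneg_of_ae ?_
  filter_upwards [S.UH_nonneg t ht] with x hx
  simpa [mul_comm] using hx

theorem Bdd.E_slopeLE (h : S.Bdd a b T) (ha : 0 < a) (ha1 : a ≤ 1) (hb1 : 1 ≤ b) {t : ℝ}
    (ht : t ∈ Ioo 0 T) : SlopeLE S.E t (-S.D t) :=
  HasDerivAt.slopeLE (h.E_hasDerivAt ha ha1 hb1 ht)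
    (by linarith [inner_U_H_nonneg (S := S) ht.1.le])

theorem Bdd.energy_le (h : S.Bdd a b T) (ha : 0 < a) (ha1 : a ≤ 1) (hb1 : 1 ≤ b) (hT : 0 ≤ T) :
    S.E T + ∫ t in (0 : ℝ)..T, S.D t ≤ S.E 0 := by
  have := le_add_integral_of_slopeLE hT (h.E_cont ha ha1 hb1) (h.D_cont ha (ha1.trans hb1)).neg
    fun t ht => h.E_slopeLE ha ha1 hb1 ht
  simp only [Pi.neg_apply, intervalIntegral.integral_neg] at this
  linarith

theorem Bdd.potential_nonneg (h : S.Bdd a b T) (ha : 0 < a) {t : ℝ} (ht : t ∈ Icc 0 T) :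
    0 ≤ ∫ x, P.ℓ x ^ (P.γ + P.θ) * phi P.γ (S.s x t) ∂S.τ := by
  refine integral_nonneg_of_ae (S.ae_τ.mono fun x hx => ?_)
  exact mul_nonneg (Real.rpow_nonneg (P.ℓ_pos (S.pos_of_mem hx)).le _)
    (phi_nonneg P.one_lt_γ (h.pos ha hx ht))

theorem Bdd.norm_U_sq_le (h : S.Bdd a b T) (ha : 0 < a) {t : ℝ} (ht : t ∈ Icc 0 T) :
    ‖S.U t‖ ^ 2 ≤ 2 * S.E t := by
  have := h.potential_nonneg ha ht
  have := mul_nonneg (inv_nonneg.2 P.ρ_pos.le) this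
  unfold E
  linarith

theorem Bdd.E_nonneg (h : S.Bdd a b T) (ha : 0 < a) {t : ℝ} (ht : t ∈ Icc 0 T) : 0 ≤ S.E t := by
  have := h.norm_U_sq_le ha ht
  nlinarith [sq_nonneg ‖S.U t‖]

theorem Bdd.integral_D_nonneg (_h : S.Bdd a b T) (hT : 0 ≤ T) :
    0 ≤ ∫ t in (0 : ℝ)..T, S.D t :=
  intervalIntegral.integral_nonneg hT fun _ hu => D_nonneg hu.1

/-- The dissipation controls the velocity uniformly: the weight `σ` is integrable. -/
theorem Bdd.U_sq_le (h : S.Bdd a b T) (ha : 0 < a) (hab : a ≤ b) {t : ℝ} (ht : t ∈ Ioc 0 T) :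
    ∀ᵐ x ∂muI, (S.U t : ℝ → ℝ) x ^ 2 ≤ P.kU a * S.D t := by
  have ht' := Ioc_subset_Icc_self ht
  have hrep : ∀ᵐ x ∂muI, (S.U t : ℝ → ℝ) x = -∫ y in Ioi x, S.σ y * S.grad y t ∂muI :=
    S.U_repr t ht.1 ⟨a, ha, fun x hx => (h x hx t ht').1⟩
  obtain ⟨M, hM0, hM⟩ := h.exists_grad_bound ha hab
  have hi : Integrable (fun x => S.grad x t) S.τ :=
    S.integrable_of_bdd (aemeas_grad ht'.1) fun x hx => hM x hx t ht'
  have hi2 : Integrable (fun x => |S.grad x t| ^ 2) S.τ :=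
    S.integrable_of_bdd (C := M ^ 2) ((aemeas_grad ht'.1).abs.pow_const 2) fun x hx => by
      have := hM x hx t ht'
      rw [abs_pow, abs_abs]
      gcongr
  have hi3 : Integrable (fun x => S.σ x * S.grad x t) muI := S.integrable_τ_iff.1 hi
  obtain ⟨M', hM0', hM'⟩ := h.exists_F_bound ha hab
  have h1 := sq_integral_le hi.abs hi2
  have h2 : ∫ x, |S.grad x t| ^ 2 ∂S.τ ≤ a ^ (-(1 + P.θ)) * S.D t := by
    rw [D, ← integral_const_mul]
    refine integral_mono_ae hi2 ((h.integrable_grad_mul ha hab ht' (S.aemeas_F ht'.1)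
      fun x hx => hM' x hx t ht').const_mul _) (S.ae_τ.mono fun x hx => ?_)
    have hs := h x hx t ht'
    have h3 : S.s x t ^ (-(1 + P.θ)) ≤ a ^ (-(1 + P.θ)) :=
      Real.rpow_le_rpow_of_nonpos ha hs.1 (by linarith [P.θ_pos])
    have h4 := grad_mul_F_nonneg (S := S) (ha.trans_le hs.1).le
    calc |S.grad x t| ^ 2 = S.s x t ^ (-(1 + P.θ)) * (S.grad x t * S.F x t) := by
          rw [sq_abs, grad]; ring
      _ ≤ _ := mul_le_mul_of_nonneg_right h3 h4
  have hm : 0 ≤ ∫ x, |S.grad x t| ^ 2 ∂S.τ := integral_nonneg fun x => by positivity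
  have h5 : (∫ x, |S.grad x t| ∂S.τ) ^ 2 ≤ P.mass * (a ^ (-(1 + P.θ)) * S.D t) :=
    h1.trans (mul_le_mul S.τ_real_le h2 hm (measureReal_nonneg.trans S.τ_real_le))
  filter_upwards [hrep] with x hx
  rw [hx, Params.kU, mul_assoc]
  refine le_trans ?_ h5
  rw [neg_sq]
  refine sq_le_sq' ?_ ?_ <;> [rw [neg_le]; skip]
  all_goals
    refine le_trans (by first | exact neg_le_abs _ | exact le_abs_self _)
      ((abs_integral_le_integral_abs).trans ?_)
    rw [S.integral_τ]
    refine (setIntegral_le_integral hi3.abs (Eventually.of_forall fun x => abs_nonneg _)).trans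
      (le_of_eq ?_)
    congr 1; funext y
    rw [abs_mul, abs_of_nonneg (S.σ_nonneg y)]

theorem Bdd.H_le_D (h : S.Bdd a b T) (ha : 0 < a) (hab : a ≤ b) {t : ℝ} (ht : t ∈ Ioc 0 T) :
    ∀ᵐ x ∂muI, |(S.H t : ℝ → ℝ) x| ≤ P.k * P.kU a * S.D t := by
  filter_upwards [S.H_le t ht.1.le, h.U_sq_le ha hab ht] with x h1 h2
  refine h1.trans ?_
  rw [mul_assoc]
  exact mul_le_mul_of_nonneg_left h2 P.k_nonneg

theorem Bdd.abs_prim_H_le (h : S.Bdd a b T) (ha : 0 < a) (hab : a ≤ b) {t : ℝ}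
    (ht : t ∈ Ioc 0 T) {x : ℝ} (hx : x ∈ S.G) :
    |prim (S.H t) x| ≤ P.k * P.kU a * S.D t * x :=
  abs_prim_le_of_ae (h.H_le_D ha hab ht) (S.G_sub hx)

/-! ### Uniform bounds for the profile -/

variable (S) in
/-- The velocity potential that renormalizes `s ^ θ`: `s ^ θ + W` solves a pure relaxation
equation up to friction. -/
def W (x t : ℝ) : ℝ := P.ρ * P.θ * P.ℓ x ^ (-P.θ) * prim (S.U t) x

theorem rpow_s_hasDerivWithinAt {x t : ℝ} (hx : x ∈ S.G) (ht : 0 ≤ t) (hs : 0 < S.s x t) :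
    HasDerivWithinAt (fun r => S.s x r ^ P.θ)
      (-(P.ρ * P.θ * P.ℓ x ^ (-P.θ) * S.F x t)) (Ici 0) t := by
  refine ((S.s_deriv_F hx ht).rpow_const (p := P.θ) (Or.inl hs.ne')).congr_deriv ?_
  have : S.s x t ^ (1 - P.θ) * S.s x t ^ (P.θ - 1) = 1 := by
    rw [← Real.rpow_add hs]; simp
  linear_combination (-(P.ρ * P.θ * P.ℓ x ^ (-P.θ) * S.F x t)) * this

theorem rpow_s_add_W_hasDerivWithinAt {x t : ℝ} (hx : x ∈ S.G) (ht : 0 ≤ t) (hs : 0 < S.s x t) :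
    HasDerivWithinAt (fun r => S.s x r ^ P.θ + S.W x r)
      (-(P.ρ * P.θ * P.ℓ x ^ (-P.θ) * (S.pr x t + prim (S.H t) x))) (Ici 0) t := by
  have h1 := (hasDerivWithinAt_prim (S.U_deriv t ht) x).const_mul (P.ρ * P.θ * P.ℓ x ^ (-P.θ))
  refine ((rpow_s_hasDerivWithinAt hx ht hs).add h1).congr_deriv ?_
  rw [F_eq, prim_add]
  ring

theorem abs_W_le {x : ℝ} (hx : x ∈ S.G) (t : ℝ) :
    |S.W x t| ≤ P.ρ * P.θ * P.cθ * ‖S.U t‖ := by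
  have hx' := S.G_sub hx
  have hℓ := Real.rpow_pos_of_pos (P.ℓ_pos hx'.1) (-P.θ)
  have h1 := P.ρ_pos
  have h2 := P.θ_pos
  rw [W, abs_mul, abs_of_pos (by positivity)]
  calc _ ≤ P.ρ * P.θ * P.ℓ x ^ (-P.θ) * (√x * ‖S.U t‖) := by gcongr; exact abs_prim_le _ hx'
    _ = P.ρ * P.θ * (P.ℓ x ^ (-P.θ) * √x) * ‖S.U t‖ := by ring
    _ ≤ _ := by gcongr; exact P.ℓ_neg_mul_sqrt_le hx'

/-- For small initial energy a solution within loose bounds satisfies sharper ones: up to the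
friction impulse, `s ^ θ + W` relaxes monotonically towards `1` at each `x`, and both `W` and the
impulse are small. -/
theorem Bdd.improve (h : S.Bdd a b T) (ha : 0 < a) (ha1 : a ≤ 1) (hb1 : 1 ≤ b) (hT : 0 ≤ T)
    {δ : ℝ} (hδ : 0 < δ)
    (hE : P.ρ * P.θ * P.cθ * (2 * √(2 * S.E 0) + P.k * P.kU a * S.E 0) ≤ δ) :
    ∀ x ∈ S.G, ∀ t ∈ Icc 0 T,
      P.a₀ ^ P.θ - 3 * δ ≤ S.s x t ^ P.θ ∧ S.s x t ^ P.θ ≤ P.b₀ ^ P.θ + 3 * δ := by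
  intro x hx t ht
  have hab := ha1.trans hb1
  have hx' := S.G_sub hx
  have hρ := P.ρ_pos
  have hθ := P.θ_pos
  have hg := P.g_pos
  have hcθ := P.cθ_pos
  have hℓ := Real.rpow_pos_of_pos (P.ℓ_pos hx'.1) (-P.θ)
  have hkU := P.kU_nonneg ha
  have hk := P.k_nonneg
  -- The friction impulse; the time argument is truncated so that the integrand is continuous.
  set J : ℝ → ℝ := fun t => ∫ r in (0 : ℝ)..t, prim (S.H (max r 0)) x with hJ
  have hHc : Continuous fun r => prim (S.H (max r 0)) x :=
    (continuousOn_prim S.H_cont x).comp_continuous (by fun_prop) fun r =>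
      mem_Ici.2 (le_max_right r 0)
  have hJd : ∀ t, 0 ≤ t → HasDerivAt J (prim (S.H t) x) t := fun t ht => by
    have := intervalIntegral.integral_hasDerivAt_right (hHc.intervalIntegrable 0 t)
      (hHc.stronglyMeasurableAtFilter _ _) hHc.continuousAt
    simpa only [max_eq_left ht] using this
  have hZ : ∀ t ∈ Icc 0 T, HasDerivWithinAt
      (fun r => S.s x r ^ P.θ + S.W x r - S.W x 0 + P.ρ * P.θ * P.ℓ x ^ (-P.θ) * J r)
      (-(P.ρ * P.θ * P.ℓ x ^ (-P.θ) * S.pr x t)) (Ici 0) t := fun t ht => by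
    refine (((rpow_s_add_W_hasDerivWithinAt hx ht.1 (h.pos ha hx ht)).sub_const (S.W x 0)).add
      ((hJd t ht.1).hasDerivWithinAt.const_mul (P.ρ * P.θ * P.ℓ x ^ (-P.θ)))).congr_deriv ?_
    ring
  have hEm : ∀ t ∈ Icc 0 T, S.E t ≤ S.E 0 := fun t ht => by
    have h1 := (h.mono ht.2).energy_le ha ha1 hb1 ht.1
    have h2 := (h.mono ht.2).integral_D_nonneg ht.1
    linarith
  have hU : ∀ t ∈ Icc 0 T, ‖S.U t‖ ≤ √(2 * S.E 0) := fun t ht =>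
    Real.le_sqrt_of_sq_le ((h.norm_U_sq_le ha ht).trans (by linarith [hEm t ht]))
  have hJb : ∀ t ∈ Icc 0 T, |J t| ≤ P.k * P.kU a * S.E 0 * x := fun t ht => by
    have hDi : IntervalIntegrable S.D volume 0 t := by
      refine ContinuousOn.intervalIntegrable ?_
      rw [uIcc_of_le ht.1]
      exact (h.mono ht.2).D_cont ha hab
    have h1 := intervalIntegral.norm_integral_le_of_norm_le (μ := volume) ht.1
      (f := fun r => prim (S.H (max r 0)) x) (g := fun r => P.k * P.kU a * x * S.D r)
      (Eventually.of_forall fun r hr => by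
        rw [max_eq_left hr.1.le, Real.norm_eq_abs]
        refine (h.abs_prim_H_le ha hab ⟨hr.1, hr.2.trans ht.2⟩ hx).trans (le_of_eq (by ring)))
      (hDi.const_mul _)
    rw [Real.norm_eq_abs, intervalIntegral.integral_const_mul] at h1
    refine h1.trans ?_
    have h2 := (h.mono ht.2).energy_le ha ha1 hb1 ht.1
    have h3 := (h.mono ht.2).E_nonneg ha (right_mem_Icc.2 ht.1)
    have h4 : ∫ t in (0 : ℝ)..t, S.D t ≤ S.E 0 := by linarith
    have h5 : 0 ≤ P.k * P.kU a * x := mul_nonneg (mul_nonneg hk hkU) hx'.1.le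
    nlinarith
  have hclose : ∀ t ∈ Icc 0 T,
      |(S.s x t ^ P.θ + S.W x t - S.W x 0 + P.ρ * P.θ * P.ℓ x ^ (-P.θ) * J t) - S.s x t ^ P.θ|
        ≤ δ := fun t ht => by
    refine le_trans ?_ hE
    have e1 := (abs_W_le hx t).trans (mul_le_mul_of_nonneg_left (hU t ht) (by positivity))
    have e2 := (abs_W_le hx 0).trans
      (mul_le_mul_of_nonneg_left (hU 0 (left_mem_Icc.2 hT)) (by positivity))
    have hE0 : 0 ≤ S.E 0 := h.E_nonneg ha (left_mem_Icc.2 hT)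
    have e3 : |P.ρ * P.θ * P.ℓ x ^ (-P.θ) * J t| ≤ P.ρ * P.θ * P.cθ * (P.k * P.kU a * S.E 0) := by
      rw [abs_mul, abs_of_pos (by positivity)]
      calc _ ≤ P.ρ * P.θ * P.ℓ x ^ (-P.θ) * (P.k * P.kU a * S.E 0 * x) := by
            gcongr; exact hJb t ht
        _ = P.ρ * P.θ * (P.ℓ x ^ (-P.θ) * x) * (P.k * P.kU a * S.E 0) := by ring
        _ ≤ _ := by
          have := P.ℓ_neg_mul_le hx'
          gcongr
    have e4 : (S.s x t ^ P.θ + S.W x t - S.W x 0 + P.ρ * P.θ * P.ℓ x ^ (-P.θ) * J t)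
        - S.s x t ^ P.θ = S.W x t - S.W x 0 + P.ρ * P.θ * P.ℓ x ^ (-P.θ) * J t := by ring
    rw [e4]
    refine (abs_add_le _ _).trans ((add_le_add (abs_sub _ _) e3).trans ?_)
    linarith
  have hpr : ∀ t ∈ Icc 0 T, (1 < S.s x t ^ P.θ → 0 < S.pr x t) ∧
      (S.s x t ^ P.θ < 1 → S.pr x t < 0) := fun t ht => by
    have hs := h.pos ha hx ht
    have hgx := mul_pos hg hx'.1
    constructor
    · intro h1
      refine mul_pos hgx (sub_pos.2 (Real.one_lt_rpow ?_ P.γ_pos))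
      by_contra hc
      exact absurd (Real.rpow_le_one hs.le (not_lt.1 hc) hθ.le) (not_le.2 h1)
    · intro h1
      refine mul_neg_of_pos_of_neg hgx (sub_neg.2 (Real.rpow_lt_one hs.le ?_ P.γ_pos))
      by_contra hc
      exact absurd (Real.one_le_rpow (not_lt.1 hc) hθ.le) (not_le.2 h1)
  have hcoef : 0 < P.ρ * P.θ * P.ℓ x ^ (-P.θ) := by positivity
  have key := bounds_of_relaxation (y := fun t => S.s x t ^ P.θ) hδ
    (fun t ht => (hZ t ht).continuousWithinAt.mono Icc_subset_Ici_self)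
    (fun t ht => (hZ t (Ico_subset_Icc_self ht)).mono (Ici_subset_Ici.2 ht.1))
    (fun t ht h1 => by
      have := mul_pos hcoef ((hpr t (Ico_subset_Icc_self ht)).1 h1)
      linarith)
    (fun t ht h1 => by
      have := mul_neg_of_pos_of_neg hcoef ((hpr t (Ico_subset_Icc_self ht)).2 h1)
      linarith)
    hclose (by simp [hJ]) t ht
  have hi := S.s_init x hx
  have ha0 := P.a₀_pos
  have i1 : P.a₀ ^ P.θ ≤ S.s x 0 ^ P.θ := Real.rpow_le_rpow ha0.le hi.1 hθ.le
  have i2 : S.s x 0 ^ P.θ ≤ P.b₀ ^ P.θ := Real.rpow_le_rpow (ha0.le.trans hi.1) hi.2 hθ.le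
  have i3 : P.a₀ ^ P.θ ≤ 1 := Real.rpow_le_one ha0.le P.a₀_le_one hθ.le
  have i4 : 1 ≤ P.b₀ ^ P.θ := Real.one_le_rpow P.one_le_b₀ hθ.le
  exact ⟨by linarith [le_min i1 i3, key.1], by linarith [max_le i2 i4, key.2]⟩

end Sol

namespace Params

variable (P : Params)

/-- The lower bound for `s` that small solutions never reach. -/
def lo : ℝ := (1 / 2 : ℝ) ^ P.θ⁻¹ * P.a₀

/-- The upper bound for `s` that small solutions never reach. -/
def hi : ℝ := (2 : ℝ) ^ P.θ⁻¹ * P.b₀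

theorem lo_pos : 0 < P.lo := mul_pos (Real.rpow_pos_of_pos (by norm_num) _) P.a₀_pos

theorem lo_le_a₀ : P.lo ≤ P.a₀ := by
  have : (1 / 2 : ℝ) ^ P.θ⁻¹ ≤ 1 :=
    Real.rpow_le_one (by norm_num) (by norm_num) (inv_nonneg.2 P.θ_pos.le)
  have := P.a₀_pos
  unfold lo
  nlinarith

theorem b₀_le_hi : P.b₀ ≤ P.hi := by
  have : 1 ≤ (2 : ℝ) ^ P.θ⁻¹ := Real.one_le_rpow (by norm_num) (inv_nonneg.2 P.θ_pos.le)
  have := P.one_le_b₀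
  unfold hi
  nlinarith

theorem lo_le_one : P.lo ≤ 1 := P.lo_le_a₀.trans P.a₀_le_one

theorem one_le_hi : 1 ≤ P.hi := P.one_le_b₀.trans P.b₀_le_hi

theorem hi_pos : 0 < P.hi := one_pos.trans_le P.one_le_hi

theorem lo_le_hi : P.lo ≤ P.hi := P.lo_le_one.trans P.one_le_hi

theorem lo_rpow : P.lo ^ P.θ = P.a₀ ^ P.θ / 2 := by
  rw [lo, Real.mul_rpow (by positivity) P.a₀_pos.le, ← Real.rpow_mul (by norm_num),
    inv_mul_cancel₀ P.θ_pos.ne', Real.rpow_one]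
  ring

theorem hi_rpow : P.hi ^ P.θ = 2 * P.b₀ ^ P.θ := by
  have := P.one_le_b₀
  rw [hi, Real.mul_rpow (by positivity) (by linarith), ← Real.rpow_mul (by norm_num),
    inv_mul_cancel₀ P.θ_pos.ne', Real.rpow_one]

end Params

namespace Sol

variable {P : Params} {S : Sol P} {a b T : ℝ}

theorem bdd_zero : S.Bdd P.lo P.hi 0 := by
  intro x hx t ht
  obtain rfl : t = 0 := le_antisymm ht.2 ht.1
  have := S.s_init x hx
  exact ⟨P.lo_le_a₀.trans this.1, this.2.trans P.b₀_le_hi⟩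

theorem isClosed_bdd (T : ℝ) : IsClosed ({t | S.Bdd P.lo P.hi t} ∩ Icc 0 T) := by
  refine isClosed_of_closure_subset fun t ht => ?_
  have htI : t ∈ Icc 0 T :=
    closure_minimal inter_subset_right isClosed_Icc ht
  refine ⟨fun x hx r hr => ?_, htI⟩
  have hlt : ∀ r, 0 ≤ r → r < t → S.s x r ∈ Icc P.lo P.hi := fun r hr0 hrt => by
    obtain ⟨t', ht', ht'2⟩ := mem_closure_iff.1 ht (Ioi r) isOpen_Ioi hrt
    exact ht'2.1 x hx r ⟨hr0, (mem_Ioi.1 ht').le⟩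
  rcases hr.2.lt_or_eq with h | rfl
  · exact hlt r hr.1 h
  rcases hr.1.eq_or_lt with rfl | h0
  · exact bdd_zero x hx 0 ⟨le_rfl, le_rfl⟩
  · have h1 : Tendsto (S.s x) (𝓝[Ioo 0 r] r) (𝓝 (S.s x r)) :=
      (S.s_cont hx r hr.1).mono_left (nhdsWithin_mono _ fun y hy => hy.1.le)
    have : (𝓝[Ioo 0 r] r).NeBot := by
      rw [nhdsWithin_Ioo_eq_nhdsLT h0]; infer_instance
    exact isClosed_Icc.mem_of_tendsto h1
      (eventually_nhdsWithin_of_forall fun y hy => hlt y hy.1.le hy.2)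

/-- Strict bounds at time `t` persist as loose bounds for a short time, uniformly in `x`. -/
theorem Bdd.extend {t : ℝ} (h : S.Bdd P.lo P.hi t) (ht : 0 ≤ t) {r : ℝ} (hr : 0 < r)
    (hs : ∀ x ∈ S.G, S.s x t ∈ Icc (P.lo + r) (P.hi - r)) :
    ∃ δ > 0, ∀ δ' ∈ Ioc 0 δ, S.Bdd P.lo P.hi (t + δ') := by
  obtain ⟨M, hM⟩ := S.exists_VH_bound (t + 1)
  have hM0 : 0 ≤ M := (norm_nonneg _).trans (hM t ⟨ht, by linarith⟩)
  have hlo := P.lo_pos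
  have hhi := P.hi_pos
  have hρ := P.ρ_pos
  have hg := P.g_pos
  have hcθ := P.cθ_pos
  set C := P.ρ * ((P.lo ^ (1 - P.θ) + P.hi ^ (1 - P.θ)) * (P.cθ * (P.g * (P.hi ^ P.γ + 1) + M))) + 1
    with hC
  have hC0 : 0 < C := by positivity
  refine ⟨min 1 (r / C), by positivity, fun δ' hδ' x hx z hz => ?_⟩
  rcases le_total z t with hzt | hzt
  · exact h x hx z ⟨hz.1, hzt⟩
  have hδ1 : δ' ≤ 1 := hδ'.2.trans (min_le_left _ _)
  have hδ2 : C * δ' ≤ r := by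
    have := hδ'.2.trans (min_le_right _ _)
    rw [le_div_iff₀ hC0] at this
    linarith
  have hin : ∀ y ∈ Icc t (t + δ'), |S.s x y - S.s x t| ≤ C * (y - t) →
      S.s x y ∈ Icc P.lo P.hi := fun y hy hb => by
    have h1 : |S.s x y - S.s x t| ≤ r := hb.trans (le_trans (by gcongr; linarith [hy.2]) hδ2)
    have h2 := abs_le.1 h1
    have h3 := hs x hx
    exact ⟨by linarith [h3.1], by linarith [h3.2]⟩
  have hsub : Icc t (t + δ') ⊆ Ici 0 := fun y hy => mem_Ici.2 (ht.trans hy.1)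
  have key := image_norm_le_of_norm_deriv_right_lt_deriv_boundary'
    (f := fun y => S.s x y - S.s x t) (a := t) (b := t + δ')
    (((S.s_cont hx).mono hsub).sub continuousOn_const)
    (fun y hy => ((S.s_deriv_F hx (ht.trans hy.1)).sub_const (S.s x t)).mono
      (Ici_subset_Ici.2 (ht.trans hy.1)))
    (B := fun y => C * (y - t)) (B' := fun _ => C) (by simp) (by fun_prop)
    (fun y _ => by simpa using (((hasDerivWithinAt_id y _).sub_const t).const_mul C))
    (fun y hy hyB => by
      have hs' := hin y (Ico_subset_Icc_self hy) hyB.le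
      have hs0 := hlo.trans_le hs'.1
      have h1 := ℓ_mul_abs_F_le hx hlo.le hs'
      have h2 := hM y ⟨ht.trans hy.1, by linarith [hy.2]⟩
      have h3 := rpow_le_add hlo hs' (1 - P.θ)
      have h4 := Real.rpow_pos_of_pos (P.ℓ_pos (S.pos_of_mem hx)) (-P.θ)
      have h5 := Real.rpow_pos_of_pos hs0 (1 - P.θ)
      rw [Real.norm_eq_abs, abs_neg, abs_mul, abs_of_pos (by positivity)]
      calc P.ρ * P.ℓ x ^ (-P.θ) * S.s x y ^ (1 - P.θ) * |S.F x y|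
          = P.ρ * (S.s x y ^ (1 - P.θ) * (P.ℓ x ^ (-P.θ) * |S.F x y|)) := by ring
        _ ≤ P.ρ * ((P.lo ^ (1 - P.θ) + P.hi ^ (1 - P.θ)) *
              (P.cθ * (P.g * (P.hi ^ P.γ + 1) + M))) := by
            refine mul_le_mul_of_nonneg_left (mul_le_mul h3 (h1.trans (by gcongr)) ?_ ?_) hρ.le
            all_goals positivity
        _ < C := by rw [hC]; linarith)
    ⟨hzt, hz.2⟩
  exact hin z ⟨hzt, hz.2⟩ key

/-- Solutions of small initial energy stay within fixed multiples of the stationary profile. -/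
theorem exists_energy_threshold (P : Params) :
    ∃ ε : ℝ, 0 < ε ∧ ε ≤ 1 ∧ ∀ S : Sol P, S.E 0 ≤ ε → ∀ T, S.Bdd P.lo P.hi T := by
  have ha0 : 0 < P.a₀ ^ P.θ := Real.rpow_pos_of_pos P.a₀_pos _
  have hcont : Tendsto (fun e : ℝ => P.ρ * P.θ * P.cθ * (2 * √(2 * e) + P.k * P.kU P.lo * e))
      (𝓝 0) (𝓝 0) := by
    have : Continuous fun e : ℝ => P.ρ * P.θ * P.cθ * (2 * √(2 * e) + P.k * P.kU P.lo * e) := by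
      fun_prop
    simpa using this.tendsto 0
  obtain ⟨ε, hε, hb⟩ := Metric.eventually_nhds_iff.1
    (hcont.eventually (gt_mem_nhds (show 0 < P.a₀ ^ P.θ / 12 by positivity)))
  refine ⟨min 1 (ε / 2), by positivity, min_le_left _ _, fun S hS T => ?_⟩
  rcases le_or_gt 0 T with hT | hT
  swap
  · intro x _ t ht
    exact absurd (ht.1.trans ht.2) (not_le.2 hT)
  have hlo := P.lo_pos
  have hE0 : 0 ≤ S.E 0 := bdd_zero.E_nonneg hlo ⟨le_rfl, le_rfl⟩
  have hδ := (hb (y := S.E 0) (by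
    rw [Real.dist_eq, sub_zero, abs_of_nonneg hE0]
    linarith [hS.trans (min_le_right _ _)])).le
  refine IsClosed.Icc_subset_of_forall_exists_gt (a := 0) (b := T)
    (s := {t | S.Bdd P.lo P.hi t}) (isClosed_bdd T) bdd_zero ?_ (right_mem_Icc.2 hT)
  rintro t ⟨htB, ht0, -⟩ y hy
  have hB : S.Bdd P.lo P.hi t := htB
  have himp := hB.improve hlo P.lo_le_one P.one_le_hi ht0 (by positivity) hδ
  have hθ := P.θ_pos
  set a' := (3 / 4 * P.a₀ ^ P.θ) ^ P.θ⁻¹ with ha'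
  set b' := (5 / 4 * P.b₀ ^ P.θ) ^ P.θ⁻¹ with hb'
  have hb0 : 1 ≤ P.b₀ ^ P.θ := Real.one_le_rpow P.one_le_b₀ hθ.le
  have ha01 : P.a₀ ^ P.θ ≤ 1 := Real.rpow_le_one P.a₀_pos.le P.a₀_le_one hθ.le
  have hloa : P.lo < a' := by
    rw [← Real.rpow_rpow_inv hlo.le hθ.ne', P.lo_rpow]
    exact Real.rpow_lt_rpow (by positivity) (by linarith) (inv_pos.2 hθ)
  have hbhi : b' < P.hi := by
    rw [← Real.rpow_rpow_inv P.hi_pos.le hθ.ne', P.hi_rpow]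
    exact Real.rpow_lt_rpow (by positivity) (by linarith) (inv_pos.2 hθ)
  have hs : ∀ x ∈ S.G, S.s x t ∈ Icc a' b' := fun x hx => by
    have hs0 := (hB.pos hlo hx ⟨ht0, le_rfl⟩).le
    have := himp x hx t ⟨ht0, le_rfl⟩
    rw [← Real.rpow_rpow_inv hs0 hθ.ne']
    exact ⟨Real.rpow_le_rpow (by positivity) (by linarith) (inv_nonneg.2 hθ.le),
      Real.rpow_le_rpow (by positivity) (by linarith) (inv_nonneg.2 hθ.le)⟩
  obtain ⟨δ, hδ0, hext⟩ := hB.extend ht0 (r := min (a' - P.lo) (P.hi - b'))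
    (lt_min (by linarith) (by linarith)) fun x hx =>
      ⟨by linarith [min_le_left (a' - P.lo) (P.hi - b'), (hs x hx).1],
        by linarith [min_le_right (a' - P.lo) (P.hi - b'), (hs x hx).2]⟩
  have hyt : 0 < y - t := sub_pos.2 hy
  refine ⟨t + min δ (y - t), hext _ ⟨by positivity, min_le_left _ _⟩, ?_, ?_⟩
  · have : 0 < min δ (y - t) := by positivity
    linarith
  · linarith [min_le_right δ (y - t)]

/-! ### Decay of the energy -/

variable (S) in
/-- The solution stays between the fixed multiples `lo` and `hi` of the stationary profile, with
initial energy at most `1`. -/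
def Global : Prop := (∀ T, S.Bdd P.lo P.hi T) ∧ S.E 0 ≤ 1

theorem Global.mem (h : S.Global) {x t : ℝ} (hx : x ∈ S.G) (ht : 0 ≤ t) :
    S.s x t ∈ Icc P.lo P.hi := h.1 t x hx t ⟨ht, le_rfl⟩

theorem Global.pos (h : S.Global) {x t : ℝ} (hx : x ∈ S.G) (ht : 0 ≤ t) : 0 < S.s x t :=
  P.lo_pos.trans_le (h.mem hx ht).1

theorem Global.D_cont (h : S.Global) (T : ℝ) : ContinuousOn S.D (Icc 0 T) :=
  (h.1 T).D_cont P.lo_pos P.lo_le_hi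

theorem Global.E_cont (h : S.Global) (T : ℝ) : ContinuousOn S.E (Icc 0 T) :=
  (h.1 T).E_cont P.lo_pos P.lo_le_one P.one_le_hi

theorem Global.E_slopeLE (h : S.Global) {t : ℝ} (ht : 0 < t) : SlopeLE S.E t (-S.D t) :=
  (h.1 (t + 1)).E_slopeLE P.lo_pos P.lo_le_one P.one_le_hi ⟨ht, by linarith⟩

theorem Global.energy_le (h : S.Global) (hT : 0 ≤ T) :
    S.E T + ∫ t in (0 : ℝ)..T, S.D t ≤ 1 :=
  ((h.1 T).energy_le P.lo_pos P.lo_le_one P.one_le_hi hT).trans h.2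

theorem Global.E_nonneg (h : S.Global) (hT : 0 ≤ T) : 0 ≤ S.E T :=
  (h.1 T).E_nonneg P.lo_pos (right_mem_Icc.2 hT)

theorem Global.integral_D_le (h : S.Global) (hT : 0 ≤ T) : ∫ t in (0 : ℝ)..T, S.D t ≤ 1 := by
  linarith [h.energy_le hT, h.E_nonneg hT]

theorem Global.E_le (h : S.Global) (hT : 0 ≤ T) : S.E T ≤ 1 := by
  linarith [h.energy_le hT, (h.1 T).integral_D_nonneg hT]

theorem Global.norm_U_sq_le (h : S.Global) (hT : 0 ≤ T) : ‖S.U T‖ ^ 2 ≤ 2 * S.E T :=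
  (h.1 T).norm_U_sq_le P.lo_pos (right_mem_Icc.2 hT)

theorem Global.U_sq_le (h : S.Global) {t : ℝ} (ht : 0 < t) :
    ∀ᵐ x ∂muI, (S.U t : ℝ → ℝ) x ^ 2 ≤ P.kU P.lo * S.D t :=
  (h.1 t).U_sq_le P.lo_pos P.lo_le_hi ⟨ht, le_rfl⟩

instance : IsProbabilityMeasure muI := ⟨by simp⟩

theorem norm_le_of_ae_abs_le {k : L2I} {C : ℝ} (hC : 0 ≤ C)
    (h : ∀ᵐ x ∂muI, |(k : ℝ → ℝ) x| ≤ C) : ‖k‖ ≤ C := by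
  have := Lp.norm_le_of_ae_bound (p := 2) (μ := muI) (f := k) hC h
  have h1 : measureUnivNNReal muI = 1 := by simp [measureUnivNNReal]
  simpa [h1] using this

theorem Global.norm_U_sq_le_D (h : S.Global) {t : ℝ} (ht : 0 < t) :
    ‖S.U t‖ ^ 2 ≤ P.kU P.lo * S.D t := by
  have h0 : 0 ≤ P.kU P.lo * S.D t := mul_nonneg (P.kU_nonneg P.lo_pos) (D_nonneg ht.le)
  have h1 : ‖S.U t‖ ≤ √(P.kU P.lo * S.D t) := norm_le_of_ae_abs_le (Real.sqrt_nonneg _)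
    ((h.U_sq_le ht).mono fun x hx => Real.abs_le_sqrt hx)
  calc _ ≤ √(P.kU P.lo * S.D t) ^ 2 := by gcongr
    _ = _ := Real.sq_sqrt h0

theorem Global.norm_H_le (h : S.Global) {t : ℝ} (ht : 0 < t) :
    ‖S.H t‖ ≤ P.k * P.kU P.lo * S.D t :=
  norm_le_of_ae_abs_le (mul_nonneg (mul_nonneg P.k_nonneg (P.kU_nonneg P.lo_pos)) (D_nonneg ht.le))
    ((h.1 t).H_le_D P.lo_pos P.lo_le_hi ⟨ht, le_rfl⟩)

theorem Global.abs_prim_H_le (h : S.Global) {t : ℝ} (ht : 0 < t) {x : ℝ} (hx : x ∈ S.G) :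
    |prim (S.H t) x| ≤ P.k * P.kU P.lo * S.D t * x :=
  (h.1 t).abs_prim_H_le P.lo_pos P.lo_le_hi ⟨ht, le_rfl⟩ hx

variable (S) in
/-- The renormalized deviation from equilibrium. -/
def z (x t : ℝ) : ℝ := S.s x t ^ P.θ + S.W x t - 1

theorem Global.z_hasDerivWithinAt (h : S.Global) {x t : ℝ} (hx : x ∈ S.G) (ht : 0 ≤ t) :
    HasDerivWithinAt (S.z x)
      (-(P.ρ * P.θ * P.ℓ x ^ (-P.θ) * (S.pr x t + prim (S.H t) x))) (Ici 0) t :=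
  (rpow_s_add_W_hasDerivWithinAt hx ht (h.pos hx ht)).sub_const 1

theorem Global.norm_U_le (h : S.Global) {t : ℝ} (ht : 0 ≤ t) : ‖S.U t‖ ≤ 2 := by
  have h1 := h.norm_U_sq_le ht
  have h2 := h.E_le ht
  nlinarith [norm_nonneg (S.U t)]

theorem Global.abs_W_le_const (h : S.Global) {x t : ℝ} (hx : x ∈ S.G) (ht : 0 ≤ t) :
    |S.W x t| ≤ P.ρ * P.θ * P.cθ * 2 := by
  have := P.ρ_pos
  have := P.θ_pos
  have := P.cθ_pos
  exact (abs_W_le hx t).trans (by gcongr; exact h.norm_U_le ht)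

theorem Global.abs_z_le (h : S.Global) {x t : ℝ} (hx : x ∈ S.G) (ht : 0 ≤ t) :
    |S.z x t| ≤ P.hi ^ P.θ + P.ρ * P.θ * P.cθ * 2 + 1 := by
  have h1 := abs_le.1 (h.abs_W_le_const hx ht)
  have h2 := h.mem hx ht
  have h3 : S.s x t ^ P.θ ≤ P.hi ^ P.θ := Real.rpow_le_rpow (h.pos hx ht).le h2.2 P.θ_pos.le
  have h4 := Real.rpow_nonneg (h.pos hx ht).le P.θ
  unfold z
  rw [abs_le]
  constructor <;> linarith [h1.1, h1.2]

variable (S) in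
/-- The weighted square of the renormalized deviation; its time derivative absorbs the energy. -/
def zz (t : ℝ) : ℝ := ∫ x, P.ℓ x ^ (2 * P.θ) * (S.z x t ^ 2 / 2) ∂S.τ

theorem aemeas_W (t : ℝ) : AEMeasurable (fun x => S.W x t) S.τ := by
  have h1 := measurable_prim (S.U t)
  have h2 := P.measurable_ℓ
  unfold W
  fun_prop

theorem aemeas_z {t : ℝ} (ht : 0 ≤ t) : AEMeasurable (fun x => S.z x t) S.τ := by
  have h1 := aemeas_W (S := S) t
  have h2 := S.aemeas_s ht
  unfold z
  fun_prop

/-- The pointwise inequality behind the decay of the energy: relaxation beats the velocity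
potential `w` by Young's inequality. -/
theorem exists_relaxation_bound (P : Params) : ∃ k K : ℝ, 0 < k ∧ 0 < K ∧
    ∀ s ∈ Icc P.lo P.hi, ∀ w : ℝ,
      -((s ^ P.γ - 1) * (s ^ P.θ + w - 1)) ≤ -k * phi P.γ s + K * w ^ 2 := by
  obtain ⟨_, K₂, _, hK₂, hφ⟩ := exists_phi_bounds P.one_lt_γ P.lo_pos P.lo_le_one P.one_le_hi
  obtain ⟨K₁, hK₁, h1⟩ := exists_abs_rpow_sub_one_le P.γ P.lo_pos P.lo_le_one P.one_le_hi
  obtain ⟨K₃, hK₃, h3⟩ := exists_abs_sub_one_le_rpow P.θ_pos P.lo_pos P.lo_le_one P.one_le_hi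
  refine ⟨1 / (2 * K₃ ^ 2 * K₂), K₁ ^ 2 * K₃ ^ 2 / 2, by positivity, by positivity,
    fun s hs w => ?_⟩
  have hs0 := P.lo_pos.trans_le hs.1
  have e1 := sq_le_rpow_sub_one_mul P.θ_pos P.θ_lt_γ.le hs0
  have e2 := h1 s hs
  have e3 := h3 s hs
  have e4 := (hφ s hs).2
  set y := s ^ P.γ - 1
  set r := s ^ P.θ - 1
  have e5 : (s - 1) ^ 2 ≤ K₃ ^ 2 * r ^ 2 := by
    rw [← sq_abs, ← sq_abs r, ← mul_pow]
    gcongr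
  have e6 : 1 / (2 * K₃ ^ 2 * K₂) * phi P.γ s ≤ r ^ 2 / 2 := by
    rw [div_mul_eq_mul_div, one_mul, div_le_iff₀ (by positivity)]
    nlinarith
  have e7 : -(y * w) ≤ r ^ 2 / 2 + K₁ ^ 2 * K₃ ^ 2 / 2 * w ^ 2 := by
    have : |y| ≤ K₁ * (K₃ * |r|) := e2.trans (by gcongr)
    have h5 : -(y * w) ≤ |y| * |w| := by rw [← abs_mul]; exact neg_le_abs _
    have h6 : |y| * |w| ≤ K₁ * (K₃ * |r|) * |w| := by gcongr
    have h7 : K₁ ^ 2 * K₃ ^ 2 * |w| ^ 2 = K₁ ^ 2 * K₃ ^ 2 * w ^ 2 := by rw [sq_abs]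
    nlinarith [sq_nonneg (|r| - K₁ * K₃ * |w|), sq_abs r]
  have e8 : s ^ P.θ + w - 1 = r + w := by simp only [r]; ring
  rw [e8]
  nlinarith

/-- The differential inequality `zz' ≤ -k E + K D`: relaxation produces minus the potential energy,
and the kinetic energy, the velocity potential and the friction are bounded by the dissipation. -/
theorem exists_zz_slopeLE (P : Params) : ∃ k K : ℝ, 0 < k ∧ 0 < K ∧ ∀ S : Sol P, S.Global →
    ∀ t, 0 < t → SlopeLE S.zz t (-k * S.E t + K * S.D t) := by
  obtain ⟨k, K, hk, hK, hrel⟩ := exists_relaxation_bound P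
  have hρ := P.ρ_pos
  have hθ := P.θ_pos
  have hg := P.g_pos
  have hcθ := P.cθ_pos
  have hkU := P.kU_nonneg P.lo_pos
  have hkk := P.k_nonneg
  have hγ := P.γ_pos
  have hhi := P.hi_pos
  set Cz := P.hi ^ P.θ + P.ρ * P.θ * P.cθ * 2 + 1 with hCz
  have hCz0 : 0 < Cz := by positivity
  set L₁ := P.g ^ ((P.γ + P.θ) / P.γ) with hL₁
  have hL₁0 : 0 < L₁ := Real.rpow_pos_of_pos hg _
  set L₂ := P.g ^ (P.θ / P.γ) with hL₂
  have hL₂0 : 0 < L₂ := Real.rpow_pos_of_pos hg _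
  -- The velocity potential and the friction contribute at most `K' * D` at each `x`.
  set K' := P.ρ * P.θ * (L₁ * (K * ((P.ρ * P.θ * P.cθ) ^ 2 * P.kU P.lo)) +
    L₂ * (P.k * P.kU P.lo * Cz)) with hK'
  have hK'0 : 0 ≤ K' := by positivity
  refine ⟨P.ρ * (P.ρ * P.θ * k), P.mass * K' + P.ρ * (P.ρ * P.θ * k) * P.kU P.lo + 1, by positivity,
    by have := P.mass_nonneg; positivity, fun S h t ht => ?_⟩
  have hT := h.1 (t + 1)
  have htI : t ∈ Ioo 0 (t + 1) := ⟨ht, by linarith⟩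
  obtain ⟨M, hM⟩ := isCompact_Icc.exists_bound_of_continuousOn
    (S.H_cont.mono (Icc_subset_Ici_self : Icc 0 (t + 1) ⊆ Ici 0))
  have hM0 : 0 ≤ M := (norm_nonneg _).trans (hM t (Ioo_subset_Icc_self htI))
  have hℓ2 : ∀ x ∈ S.G, P.ℓ x ^ (2 * P.θ) * P.ℓ x ^ (-P.θ) = P.ℓ x ^ P.θ := fun x hx => by
    rw [← Real.rpow_add (P.ℓ_pos (S.pos_of_mem hx))]; ring_nf
  have hℓ3 : ∀ x ∈ S.G, P.ℓ x ^ P.θ * (P.g * x) = P.ℓ x ^ (P.γ + P.θ) := fun x hx => by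
    rw [← P.ℓ_rpow_γ (S.pos_of_mem hx), ← Real.rpow_add (P.ℓ_pos (S.pos_of_mem hx))]
    ring_nf
  set f' : ℝ → ℝ → ℝ := fun x t =>
    -(P.ρ * P.θ * P.ℓ x ^ P.θ * (S.pr x t + prim (S.H t) x) * S.z x t) with hf'
  have hd : ∀ x ∈ S.G, ∀ r ∈ Ioo 0 (t + 1),
      HasDerivAt (fun r => P.ℓ x ^ (2 * P.θ) * (S.z x r ^ 2 / 2)) (f' x r) r := fun x hx r hr => by
    have h1 := (h.z_hasDerivWithinAt hx hr.1.le).hasDerivAt (Ici_mem_nhds hr.1)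
    refine (((h1.pow 2).div_const 2).const_mul (P.ℓ x ^ (2 * P.θ))).congr_deriv ?_
    rw [hf']
    simp only [← hℓ2 x hx]
    push_cast
    ring
  have hm : ∀ r ∈ Icc 0 (t + 1),
      AEMeasurable (fun x => P.ℓ x ^ (2 * P.θ) * (S.z x r ^ 2 / 2)) S.τ := fun r hr =>
    (P.measurable_ℓ.pow_const _).aemeasurable.mul (((aemeas_z hr.1).pow_const 2).div_const 2)
  have hpr : ∀ x ∈ S.G, ∀ r ∈ Icc 0 (t + 1), |S.pr x r| ≤ P.g * (P.hi ^ P.γ + 1) :=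
    fun x hx r hr => by
      refine (abs_pr_le hx P.lo_pos.le (h.mem hx hr.1)).trans ?_
      have : P.g * x ≤ P.g := by nlinarith [(S.G_sub hx).2]
      gcongr
  have hf'm : AEMeasurable (fun x => f' x t) S.τ := by
    have h1 := aemeas_pr (S := S) ht.le
    have h2 := aemeas_z (S := S) ht.le
    have h3 := measurable_prim (S.H t)
    have h4 := P.measurable_ℓ
    simp only [hf']
    fun_prop
  have hf'b : ∀ x ∈ S.G, ∀ r ∈ Ioo 0 (t + 1), |f' x r| ≤
      P.ρ * P.θ * L₂ * (P.g * (P.hi ^ P.γ + 1) + M) * Cz := fun x hx r hr => by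
    have hr' := Ioo_subset_Icc_self hr
    have h1 := hpr x hx r hr'
    have h2 := (abs_prim_le_norm (S.H r) hx).trans (hM r hr')
    have h3 := h.abs_z_le hx hr.1.le
    have h4 := P.ℓ_rpow_le (S.G_sub hx) hθ.le
    have h5 := Real.rpow_pos_of_pos (P.ℓ_pos (S.pos_of_mem hx)) P.θ
    simp only [hf']
    rw [abs_neg, abs_mul, abs_mul, abs_of_pos (by positivity)]
    gcongr
    exact (abs_add_le _ _).trans (add_le_add h1 h2)
  have hzi : ∀ r ∈ Icc 0 (t + 1),
      Integrable (fun x => P.ℓ x ^ (2 * P.θ) * (S.z x r ^ 2 / 2)) S.τ := fun r hr => by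
    refine S.integrable_of_bdd (C := P.g ^ (2 * P.θ / P.γ) * (Cz ^ 2 / 2)) (hm r hr) fun x hx => ?_
    have h5 := Real.rpow_pos_of_pos (P.ℓ_pos (S.pos_of_mem hx)) (2 * P.θ)
    rw [abs_of_nonneg (by positivity), ← sq_abs]
    have h6 := P.ℓ_rpow_le (S.G_sub hx) (p := 2 * P.θ) (by positivity)
    have h7 := h.abs_z_le hx hr.1
    gcongr
  have hder := S.hasDerivAt_integral (f' := f') htI (fun r hr => hm r (Ioo_subset_Icc_self hr))
    (hzi t (Ioo_subset_Icc_self htI)) hf'm (integrable_const _) hd hf'b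
  refine HasDerivAt.slopeLE hder ?_
  have hD := D_nonneg (S := S) ht.le
  -- Pointwise bound of the derivative.
  have hpt : ∀ x ∈ S.G, f' x t ≤
      -(P.ρ * P.θ * k) * (P.ℓ x ^ (P.γ + P.θ) * phi P.γ (S.s x t)) + K' * S.D t := fun x hx => by
    have hx' := S.G_sub hx
    have h1 := hrel _ (h.mem hx ht.le) (S.W x t)
    have h2 : S.W x t ^ 2 ≤ (P.ρ * P.θ * P.cθ) ^ 2 * P.kU P.lo * S.D t := by
      rw [← sq_abs, mul_assoc]
      calc |S.W x t| ^ 2 ≤ (P.ρ * P.θ * P.cθ * ‖S.U t‖) ^ 2 := by gcongr; exact abs_W_le hx t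
        _ = (P.ρ * P.θ * P.cθ) ^ 2 * ‖S.U t‖ ^ 2 := by ring
        _ ≤ _ := by gcongr; exact h.norm_U_sq_le_D ht
    have h3 : -(prim (S.H t) x * S.z x t) ≤ P.k * P.kU P.lo * S.D t * Cz := by
      refine (neg_le_abs _).trans ?_
      rw [abs_mul]
      have h4 := h.abs_prim_H_le ht hx
      have h5 : P.k * P.kU P.lo * S.D t * x ≤ P.k * P.kU P.lo * S.D t :=
        mul_le_of_le_one_right (by positivity) hx'.2.le
      exact mul_le_mul (h4.trans h5) (h.abs_z_le hx ht.le) (abs_nonneg _) (by positivity)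
    have h6 := P.ℓ_rpow_le hx' (p := P.γ + P.θ) (by linarith)
    have h7 := P.ℓ_rpow_le hx' hθ.le
    have h8 := Real.rpow_pos_of_pos (P.ℓ_pos hx'.1) (P.γ + P.θ)
    have h9 := Real.rpow_pos_of_pos (P.ℓ_pos hx'.1) P.θ
    have e1 : f' x t = P.ρ * P.θ * (P.ℓ x ^ (P.γ + P.θ) *
        -((S.s x t ^ P.γ - 1) * (S.s x t ^ P.θ + S.W x t - 1)) +
          P.ℓ x ^ P.θ * -(prim (S.H t) x * S.z x t)) := by
      simp only [hf', ← hℓ3 x hx, pr, z]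
      ring
    rw [e1]
    calc _ ≤ P.ρ * P.θ * (P.ℓ x ^ (P.γ + P.θ) * (-k * phi P.γ (S.s x t) +
            K * ((P.ρ * P.θ * P.cθ) ^ 2 * P.kU P.lo * S.D t)) +
          P.ℓ x ^ P.θ * (P.k * P.kU P.lo * S.D t * Cz)) := by
          gcongr
          exact h1.trans (by gcongr)
      _ = -(P.ρ * P.θ * k) * (P.ℓ x ^ (P.γ + P.θ) * phi P.γ (S.s x t)) +
          P.ρ * P.θ * (P.ℓ x ^ (P.γ + P.θ) * (K * ((P.ρ * P.θ * P.cθ) ^ 2 * P.kU P.lo)) +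
          P.ℓ x ^ P.θ * (P.k * P.kU P.lo * Cz)) * S.D t := by ring
      _ ≤ _ := by rw [hK']; gcongr
  obtain ⟨C, hC⟩ := hT.exists_phi_le P.lo_pos P.lo_le_one P.one_le_hi
  have hφi : Integrable (fun x => P.ℓ x ^ (P.γ + P.θ) * phi P.γ (S.s x t)) S.τ :=
    S.integrable_of_bdd ((P.measurable_ℓ.pow_const _).aemeasurable.mul (aemeas_phi ht.le))
      fun x hx => hC x hx t (Ioo_subset_Icc_self htI)
  have hI : ∫ x, f' x t ∂S.τ ≤
      -(P.ρ * P.θ * k) * (∫ x, P.ℓ x ^ (P.γ + P.θ) * phi P.γ (S.s x t) ∂S.τ) +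
        S.τ.real univ * (K' * S.D t) := by
    have := integral_mono_ae (S.integrable_of_bdd hf'm fun x hx => hf'b x hx t htI)
      ((hφi.const_mul (-(P.ρ * P.θ * k))).add (integrable_const (K' * S.D t)))
      (S.ae_τ.mono fun x hx => hpt x hx)
    simp only [Pi.add_apply] at this
    rw [integral_add (hφi.const_mul _) (integrable_const _), integral_const_mul, integral_const,
      smul_eq_mul] at this
    exact this
  refine hI.trans ?_
  have hτ : S.τ.real univ * (K' * S.D t) ≤ P.mass * (K' * S.D t) := by
    gcongr
    exact S.τ_real_le
  have hU := h.norm_U_sq_le_D ht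
  have hEφ : P.ρ * S.E t = P.ρ * (‖S.U t‖ ^ 2 / 2) +
      ∫ x, P.ℓ x ^ (P.γ + P.θ) * phi P.γ (S.s x t) ∂S.τ := by
    unfold E
    field_simp
  have hc : 0 < P.ρ * (P.ρ * P.θ * k) := by positivity
  have hUU : P.ρ * (P.ρ * P.θ * k) * (‖S.U t‖ ^ 2 / 2) ≤
      P.ρ * (P.ρ * P.θ * k) * (P.kU P.lo * S.D t) := by
    gcongr
    linarith [sq_nonneg ‖S.U t‖]
  nlinarith

theorem Global.zz_cont (h : S.Global) (T : ℝ) : ContinuousOn S.zz (Icc 0 T) := by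
  refine S.continuousOn_integral
    (w := fun _ => P.g ^ (2 * P.θ / P.γ) * ((P.hi ^ P.θ + P.ρ * P.θ * P.cθ * 2 + 1) ^ 2 / 2))
    (fun r hr => (P.measurable_ℓ.pow_const _).aemeasurable.mul
      (((aemeas_z hr.1).pow_const 2).div_const 2))
    (fun x hx => continuousOn_const.mul ((ContinuousOn.pow (fun t ht =>
      (h.z_hasDerivWithinAt hx ht.1).continuousWithinAt.mono Icc_subset_Ici_self) 2).div_const 2))
    (integrable_const _) fun x hx t ht => ?_
  have h5 := Real.rpow_pos_of_pos (P.ℓ_pos (S.pos_of_mem hx)) (2 * P.θ)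
  have := P.θ_pos
  rw [abs_of_nonneg (by positivity), ← sq_abs]
  have h6 := P.ℓ_rpow_le (S.G_sub hx) (p := 2 * P.θ) (by positivity)
  have h7 := h.abs_z_le hx ht.1
  have := Real.rpow_nonneg P.g_pos.le (2 * P.θ / P.γ)
  gcongr

theorem Global.zz_nonneg (_h : S.Global) (t : ℝ) : 0 ≤ S.zz t := by
  refine integral_nonneg_of_ae (S.ae_τ.mono fun x hx => ?_)
  have h5 := Real.rpow_pos_of_pos (P.ℓ_pos (S.pos_of_mem hx)) (2 * P.θ)
  simp only [Pi.zero_apply]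
  positivity

theorem exists_zz_zero_le (P : Params) : ∃ K : ℝ, ∀ S : Sol P, S.Global → S.zz 0 ≤ K := by
  set C := P.g ^ (2 * P.θ / P.γ) * ((P.hi ^ P.θ + P.ρ * P.θ * P.cθ * 2 + 1) ^ 2 / 2)
  have hC0 : 0 ≤ C := by
    have := Real.rpow_nonneg P.g_pos.le (2 * P.θ / P.γ)
    positivity
  refine ⟨C * P.mass, fun S h => ?_⟩
  have h1 := norm_integral_le_of_norm_le_const (μ := S.τ) (C := C)
    (f := fun x => P.ℓ x ^ (2 * P.θ) * (S.z x 0 ^ 2 / 2)) (S.ae_τ.mono fun x hx => by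
      have h5 := Real.rpow_pos_of_pos (P.ℓ_pos (S.pos_of_mem hx)) (2 * P.θ)
      have := P.θ_pos
      rw [Real.norm_eq_abs, abs_of_nonneg (by positivity), ← sq_abs]
      have h6 := P.ℓ_rpow_le (S.G_sub hx) (p := 2 * P.θ) (by positivity)
      have h7 := h.abs_z_le hx le_rfl
      have := Real.rpow_nonneg P.g_pos.le (2 * P.θ / P.γ)
      simp only [C]
      gcongr)
  calc S.zz 0 ≤ ‖S.zz 0‖ := le_abs_self _
    _ ≤ C * S.τ.real univ := h1
    _ ≤ _ := by gcongr; exact S.τ_real_le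

/-- The energy is integrable in time, and therefore decays like `1 / (1 + t)`; moreover the
dissipation is integrable with weight `1 + t`. -/
theorem exists_energy_decay (P : Params) : ∃ K : ℝ, 0 < K ∧ ∀ S : Sol P, S.Global → ∀ T, 0 ≤ T →
    ∫ t in (0 : ℝ)..T, S.E t ≤ K ∧ ∫ t in (0 : ℝ)..T, (1 + t) * S.D t ≤ K := by
  obtain ⟨k, K, hk, hK, hsl⟩ := exists_zz_slopeLE P
  obtain ⟨K₀, hK₀⟩ := exists_zz_zero_le P
  have key : ∀ S : Sol P, S.Global → ∀ T, 0 ≤ T → ∫ t in (0 : ℝ)..T, S.E t ≤ (|K₀| + K) / k := by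
    intro S h T hT
    have hE := h.E_cont T
    have hD := h.D_cont T
    have h1 := le_add_integral_of_slopeLE hT (h.zz_cont T)
      ((continuousOn_const (c := -k)).mul hE |>.add ((continuousOn_const (c := K)).mul hD))
      fun t ht => hsl S h t ht.1
    have hiE : IntervalIntegrable S.E volume 0 T :=
      ContinuousOn.intervalIntegrable (by rwa [uIcc_of_le hT])
    have hiD : IntervalIntegrable S.D volume 0 T :=
      ContinuousOn.intervalIntegrable (by rwa [uIcc_of_le hT])
    simp only [Pi.add_apply, Pi.mul_apply] at h1
    rw [intervalIntegral.integral_add (hiE.const_mul _) (hiD.const_mul _),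
      intervalIntegral.integral_const_mul, intervalIntegral.integral_const_mul] at h1
    have h2 := h.zz_nonneg T
    have h3 := (hK₀ S h).trans (le_abs_self K₀)
    have h4 := h.integral_D_le hT
    rw [le_div_iff₀ hk]
    nlinarith
  refine ⟨(|K₀| + K) / k + 1, by positivity, fun S h T hT =>
    ⟨(key S h T hT).trans (by linarith), ?_⟩⟩
  have hE := h.E_cont T
  have hD := h.D_cont T
  have hDw : ContinuousOn (fun t => (1 + t) * S.D t) (Icc 0 T) := ContinuousOn.mul (by fun_prop) hD
  have h1 := le_add_integral_of_slopeLE (f := fun t => (1 + t) * S.E t)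
    (k := fun t => S.E t - (1 + t) * S.D t) hT (ContinuousOn.mul (by fun_prop) hE)
    (hE.sub hDw) fun t ht => by
      have := (h.E_slopeLE ht.1).weight_mul (w := fun t => 1 + t) (w' := 1)
        ((hasDerivAt_id t).const_add 1)
        (eventually_nhdsWithin_of_forall fun z hz => by
          have h1 : t < z := hz
          linarith [ht.1]) (by linarith [ht.1])
      exact this.mono (by linarith)
  have hiE : IntervalIntegrable S.E volume 0 T :=
    ContinuousOn.intervalIntegrable (by rwa [uIcc_of_le hT])
  have hiD : IntervalIntegrable (fun t => (1 + t) * S.D t) volume 0 T :=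
    ContinuousOn.intervalIntegrable (by rwa [uIcc_of_le hT])
  rw [intervalIntegral.integral_sub hiE hiD] at h1
  have h2 := key S h T hT
  have h3 : 0 ≤ (1 + T) * S.E T := mul_nonneg (by linarith) (h.E_nonneg hT)
  have h4 := h.2
  simp only [add_zero, one_mul] at h1
  linarith

end Sol

namespace Sol

variable {P : Params} {S : Sol P} {a b T : ℝ}

/-! ### Decay of the dissipation -/

variable (S) in
/-- The dissipation with the work of the pressure excess subtracted: the quantity whose growth is
controlled by testing the momentum equation with time increments of the velocity. -/
def Y (t : ℝ) : ℝ := ∫ x, (S.grad x t * S.F x t / 2 - S.pr x t * S.grad x t) ∂S.τ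

theorem hasDerivWithinAt_inner_increment {U K : ℝ → L2I} {V : L2I} {t : ℝ}
    (hU : HasDerivWithinAt U V (Ici t) t) (hK : ContinuousWithinAt K (Ici t) t) :
    HasDerivWithinAt (fun r => inner ℝ (U r - U t) (K r)) (inner ℝ V (K t)) (Ici t) t := by
  rw [hasDerivWithinAt_iff_tendsto_slope] at hU ⊢
  have h1 : Tendsto K (𝓝[Ici t \ {t}] t) (𝓝 (K t)) := hK.mono_left (nhdsWithin_mono _ sdiff_subset)
  refine (hU.inner h1).congr fun r => ?_
  simp [slope, inner_smul_left]

theorem Global.pr_bound (h : S.Global) {x t : ℝ} (hx : x ∈ S.G) (ht : 0 ≤ t) :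
    |S.pr x t| ≤ P.g * (P.hi ^ P.γ + 1) := by
  refine (abs_pr_le hx P.lo_pos.le (h.mem hx ht)).trans ?_
  have := P.g_pos
  have := P.hi_pos
  have : P.g * x ≤ P.g := by nlinarith [(S.G_sub hx).2]
  gcongr

variable (S) in
/-- The part of the upper support function of `Y` at `t₀` that comes from freezing the velocity
gradient at time `t₀`. -/
def frozen (t₀ x t : ℝ) : ℝ :=
  S.s x t ^ (1 + P.θ) * S.grad x t₀ ^ 2 / 2 - S.pr x t * S.grad x t₀

theorem Global.frozen_hasDerivAt (h : S.Global) {t₀ x t : ℝ} (hx : x ∈ S.G) (ht : 0 < t) :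
    HasDerivAt (S.frozen t₀ x)
      (-(P.ρ * (1 + P.θ) / 2) * (P.ℓ x ^ (-P.θ) * S.F x t) * (S.s x t * S.grad x t₀ ^ 2) +
        P.ρ * P.γ * (P.ℓ x ^ (-P.θ) * (P.g * x)) * S.s x t ^ (P.γ - P.θ) *
          (S.F x t * S.grad x t₀)) t := by
  have hs := h.pos hx ht.le
  have h0 := S.s_hasDerivAt hx ht
  have h1 := h0.rpow_const (p := 1 + P.θ) (Or.inl hs.ne')
  have h2 := h0.rpow_const (p := P.γ) (Or.inl hs.ne')
  refine (((h1.mul_const (S.grad x t₀ ^ 2)).div_const 2).sub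
    (((h2.sub_const 1).const_mul (P.g * x)).mul_const (S.grad x t₀))).congr_deriv ?_
  have e1 : S.s x t ^ (1 - P.θ) * S.s x t ^ (1 + P.θ - 1) = S.s x t := by
    rw [← Real.rpow_add hs]; ring_nf; exact Real.rpow_one _
  have e2 : S.s x t ^ (1 - P.θ) * S.s x t ^ (P.γ - 1) = S.s x t ^ (P.γ - P.θ) := by
    rw [← Real.rpow_add hs]; ring_nf
  linear_combination
    (-(P.ρ * (1 + P.θ) / 2) * P.ℓ x ^ (-P.θ) * S.F x t * S.grad x t₀ ^ 2) * e1 +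
      (P.ρ * P.γ * P.ℓ x ^ (-P.θ) * (P.g * x) * S.F x t * S.grad x t₀) * e2

theorem aemeas_frozen {t₀ t : ℝ} (ht₀ : 0 ≤ t₀) (ht : 0 ≤ t) :
    AEMeasurable (fun x => S.frozen t₀ x t) S.τ := by
  have h1 := aemeas_grad (S := S) ht₀
  have h2 := S.aemeas_s ht
  have h3 := aemeas_pr (S := S) ht
  unfold frozen
  fun_prop

/-- Convexity: `Y` lies below its support function, the defect being
`s ^ (1 + θ) (grad x t - grad x t₀) ^ 2 / 2`. -/
theorem Global.Y_le_support (h : S.Global) {t₀ t : ℝ} (ht₀ : 0 < t₀) (ht : t₀ ≤ t) :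
    S.Y t ≤ -inner ℝ (S.U t - S.U t₀) (S.V t + S.H t) + ∫ x, S.frozen t₀ x t ∂S.τ := by
  have ht0 : 0 < t := ht₀.trans_le ht
  have hT := h.1 t
  have I1 : t₀ ∈ Icc 0 t := ⟨ht₀.le, ht⟩
  have I2 : t ∈ Icc 0 t := ⟨ht0.le, le_rfl⟩
  obtain ⟨M, hM0, hM⟩ := hT.exists_grad_bound P.lo_pos P.lo_le_hi
  obtain ⟨M', hM0', hM'⟩ := hT.exists_F_bound P.lo_pos P.lo_le_hi
  have hlo := P.lo_pos
  have i1 := hT.integrable_grad_mul hlo P.lo_le_hi I1 (measurable_prim (S.V t + S.H t)).aemeasurable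
    fun x hx => abs_prim_le_norm _ hx
  have i2 := hT.integrable_grad_mul hlo P.lo_le_hi I2 (measurable_prim (S.V t + S.H t)).aemeasurable
    fun x hx => abs_prim_le_norm _ hx
  have i3 : Integrable (fun x => S.frozen t₀ x t) S.τ := by
    refine S.integrable_of_bdd
      (C := (P.lo ^ (1 + P.θ) + P.hi ^ (1 + P.θ)) * M ^ 2 / 2 + P.g * (P.hi ^ P.γ + 1) * M)
      (aemeas_frozen ht₀.le ht0.le) fun x hx => ?_
    refine (abs_sub _ _).trans (add_le_add ?_ ?_)
    · have hs := Real.rpow_pos_of_pos (h.pos hx ht0.le) (1 + P.θ)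
      have := rpow_le_add hlo (h.mem hx ht0.le) (1 + P.θ)
      have h2 := hM x hx _ I1
      rw [abs_of_nonneg (by positivity), ← sq_abs]
      have := hs.le.trans this
      gcongr
    · rw [abs_mul]
      have := P.g_pos
      have := P.hi_pos
      exact mul_le_mul (h.pr_bound hx ht0.le) (hM x hx _ I1) (abs_nonneg _) (by positivity)
  have i4 : Integrable (fun x => S.grad x t * S.F x t / 2) S.τ :=
    (hT.integrable_grad_mul hlo P.lo_le_hi I2 (S.aemeas_F ht0.le)
      fun x hx => hM' x hx t I2).div_const 2
  have i5 : Integrable (fun x => S.pr x t * S.grad x t) S.τ := by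
    simp only [mul_comm (S.pr _ t)]
    exact hT.integrable_grad_mul hlo P.lo_le_hi I2 (aemeas_pr ht0.le) fun x hx =>
      h.pr_bound hx ht0.le
  rw [inner_sub_left, hT.inner_U hlo P.lo_le_hi ht0 I2, hT.inner_U hlo P.lo_le_hi ht0 I1, Y]
  have e : -(-(∫ x, S.grad x t * prim (S.V t + S.H t) x ∂S.τ) -
      -∫ x, S.grad x t₀ * prim (S.V t + S.H t) x ∂S.τ) + ∫ x, S.frozen t₀ x t ∂S.τ =
      ∫ x, (S.grad x t * prim (S.V t + S.H t) x - S.grad x t₀ * prim (S.V t + S.H t) x +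
        S.frozen t₀ x t) ∂S.τ := by
    have i6 : Integrable (fun x => S.grad x t * prim (S.V t + S.H t) x -
      S.grad x t₀ * prim (S.V t + S.H t) x) S.τ := i2.sub i1
    rw [integral_add i6 i3, integral_sub i2 i1]
    ring
  rw [e]
  refine integral_mono_ae (i4.sub i5) ((i2.sub i1).add i3) (S.ae_τ.mono fun x hx => ?_)
  have hs := h.pos hx ht0.le
  have hF : S.F x t = S.s x t ^ (1 + P.θ) * S.grad x t := by
    rw [grad, ← mul_assoc, ← Real.rpow_add hs]; simp
  have hprim : prim (S.V t + S.H t) x = S.F x t - S.pr x t := by rw [F_eq]; ring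
  have hs' := Real.rpow_pos_of_pos hs (1 + P.θ)
  simp only [frozen, hprim]
  rw [hF]
  nlinarith [mul_nonneg hs'.le (sq_nonneg (S.grad x t - S.grad x t₀))]

theorem Global.Y_eq_frozen (h : S.Global) {t : ℝ} (ht : 0 ≤ t) :
    ∫ x, S.frozen t x t ∂S.τ = S.Y t := by
  refine integral_congr_ae (S.ae_τ.mono fun x hx => ?_)
  have hs := h.pos hx ht
  have hF : S.F x t = S.s x t ^ (1 + P.θ) * S.grad x t := by
    rw [grad, ← mul_assoc, ← Real.rpow_add hs]; simp
  simp only [frozen]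
  rw [hF]
  ring

/-- The differential inequality `Y' ≤ K (D + D ^ 2)`, in terms of support functions, since the
viscous flux is not known to be differentiable in time. -/
theorem exists_Y_slopeLE (P : Params) : ∃ K : ℝ, 0 < K ∧ ∀ S : Sol P, S.Global →
    ∀ t, 0 < t → SlopeLE S.Y t (K * S.D t + K * S.D t ^ 2) := by
  have hρ := P.ρ_pos
  have hθ := P.θ_pos
  have hg := P.g_pos
  have hcθ := P.cθ_pos
  have hkU := P.kU_nonneg P.lo_pos
  have hkk := P.k_nonneg
  have hγ := P.γ_pos
  have hhi := P.hi_pos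
  have hlo := P.lo_pos
  have hlθ := Real.rpow_pos_of_pos hlo (-P.θ)
  have hL₀0 := Real.rpow_pos_of_pos hg ((P.γ - P.θ) / P.γ)
  set A := P.ρ * (1 + P.θ) / 2 * (P.cθ * P.lo ^ (-P.θ)) with hA
  have hA0 : 0 < A := by positivity
  set c₁ := P.g * (P.hi ^ P.γ + 1) with hc₁
  have hc₁0 : 0 < c₁ := by positivity
  set B := P.ρ * P.γ * (P.g ^ ((P.γ - P.θ) / P.γ) * P.hi ^ (P.γ - P.θ)) with hB
  have hB0 : 0 < B := by positivity
  set η := P.k * P.kU P.lo with hη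
  have hη0 : 0 ≤ η := by positivity
  -- The acceleration `V` enters through `-‖V‖ ^ 2` and the cross terms `(η + A) * ‖V‖ * D`; Young's
  -- inequality leaves `(η + A) ^ 2 / 4 * D ^ 2`. The other terms come from the frozen gradient.
  refine ⟨A * c₁ + B + (η + A) ^ 2 / 4 + A * η, by positivity, fun S h t ht => ?_⟩
  have htI : t ∈ Ioo 0 (t + 1) := ⟨ht, by linarith⟩
  have hT := h.1 (t + 1)
  have htI' := Ioo_subset_Icc_self htI
  obtain ⟨M, hM0, hM⟩ := hT.exists_grad_bound P.lo_pos P.lo_le_hi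
  obtain ⟨M', hM0', hM'⟩ := hT.exists_F_bound P.lo_pos P.lo_le_hi
  obtain ⟨N, hN⟩ := S.exists_VH_bound (t + 1)
  have hN0 : 0 ≤ N := (norm_nonneg _).trans (hN t htI')
  set f' : ℝ → ℝ → ℝ := fun x r =>
    -(P.ρ * (1 + P.θ) / 2) * (P.ℓ x ^ (-P.θ) * S.F x r) * (S.s x r * S.grad x t ^ 2) +
        P.ρ * P.γ * (P.ℓ x ^ (-P.θ) * (P.g * x)) * S.s x r ^ (P.γ - P.θ) *
          (S.F x r * S.grad x t) with hf'
  have hℓγ : ∀ x ∈ S.G, P.ℓ x ^ (-P.θ) * (P.g * x) ≤ P.g ^ ((P.γ - P.θ) / P.γ) ∧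
      0 ≤ P.ℓ x ^ (-P.θ) * (P.g * x) := fun x hx => by
    rw [P.ℓ_neg_mul_gx (S.pos_of_mem hx)]
    exact ⟨P.ℓ_rpow_le (S.G_sub hx) (by linarith [P.θ_lt_γ]),
      Real.rpow_nonneg (P.ℓ_pos (S.pos_of_mem hx)).le _⟩
  have hsγ : ∀ x ∈ S.G, ∀ r, 0 ≤ r → S.s x r ^ (P.γ - P.θ) ≤ P.hi ^ (P.γ - P.θ) :=
    fun x hx r hr => Real.rpow_le_rpow (h.pos hx hr).le (h.mem hx hr).2 (by linarith [P.θ_lt_γ])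
  have hf'b : ∀ x ∈ S.G, ∀ r ∈ Ioo 0 (t + 1), |f' x r| ≤
      P.ρ * (1 + P.θ) / 2 * (P.cθ * (c₁ + N)) * (P.hi * M ^ 2) +
        P.ρ * P.γ * P.g ^ ((P.γ - P.θ) / P.γ) * P.hi ^ (P.γ - P.θ) * (M' * M) :=
    fun x hx r hr => by
      have hr' := Ioo_subset_Icc_self hr
      have hs := h.pos hx hr.1.le
      have hℓ := Real.rpow_pos_of_pos (P.ℓ_pos (S.pos_of_mem hx)) (-P.θ)
      have h1 : P.ℓ x ^ (-P.θ) * |S.F x r| ≤ P.cθ * (c₁ + N) :=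
        (ℓ_mul_abs_F_le hx hlo.le (h.mem hx hr.1.le)).trans (by gcongr; exact hN r hr')
      have h2 := hM x hx t htI'
      have h3 := hM' x hx r hr'
      have h4 := (h.mem hx hr.1.le).2
      have h5 := hsγ x hx r hr.1.le
      have h6 := Real.rpow_pos_of_pos hs (P.γ - P.θ)
      obtain ⟨h7, h8⟩ := hℓγ x hx
      refine (abs_add_le _ _).trans (add_le_add ?_ ?_)
      · rw [abs_mul, abs_mul, abs_neg, abs_of_pos (show 0 < P.ρ * (1 + P.θ) / 2 by positivity),
          abs_mul (P.ℓ x ^ (-P.θ)), abs_of_pos hℓ,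
          abs_of_nonneg (show 0 ≤ S.s x r * S.grad x t ^ 2 by positivity), ← sq_abs (S.grad x t)]
        refine mul_le_mul (mul_le_mul_of_nonneg_left h1 (by positivity)) ?_ (by positivity)
          (by positivity)
        gcongr
      · rw [abs_mul, abs_mul (S.F x r),
          abs_of_nonneg (show 0 ≤ P.ρ * P.γ * (P.ℓ x ^ (-P.θ) * (P.g * x)) *
            S.s x r ^ (P.γ - P.θ) from mul_nonneg (mul_nonneg (by positivity) h8) h6.le)]
        refine mul_le_mul ?_ (mul_le_mul h3 h2 (abs_nonneg _) hM0') (by positivity) (by positivity)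
        exact mul_le_mul (mul_le_mul_of_nonneg_left h7 (by positivity)) h5 h6.le (by positivity)
  have hf'm : AEMeasurable (fun x => f' x t) S.τ := by
    have h1 := S.aemeas_F ht.le
    have h2 := aemeas_grad (S := S) ht.le
    have h3 := S.aemeas_s ht.le
    have h4 := P.measurable_ℓ
    simp only [hf']
    fun_prop
  have hfi : Integrable (fun x => S.frozen t x t) S.τ := by
    have i4 : Integrable (fun x => S.grad x t * S.F x t / 2) S.τ :=
      (hT.integrable_grad_mul hlo P.lo_le_hi htI' (S.aemeas_F ht.le)
        fun x hx => hM' x hx t htI').div_const 2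
    have i5 : Integrable (fun x => S.grad x t * S.pr x t) S.τ :=
      hT.integrable_grad_mul hlo P.lo_le_hi htI' (aemeas_pr ht.le) fun x hx => h.pr_bound hx ht.le
    refine (i4.sub i5).congr (S.ae_τ.mono fun x hx => ?_)
    have hs := h.pos hx ht.le
    have hF : S.F x t = S.s x t ^ (1 + P.θ) * S.grad x t := by
      rw [grad, ← mul_assoc, ← Real.rpow_add hs]; simp
    simp only [frozen, Pi.sub_apply]
    rw [hF]
    ring
  have hder := S.hasDerivAt_integral (f := S.frozen t) (f' := f') htI
    (fun r hr => aemeas_frozen ht.le hr.1.le) hfi hf'm (integrable_const _)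
    (fun x hx r hr => h.frozen_hasDerivAt hx hr.1) hf'b
  have hVH : ContinuousWithinAt (fun r => S.V r + S.H r) (Ici t) t :=
    (S.VH_cont t ht.le).mono (Ici_subset_Ici.2 ht.le)
  have hin := hasDerivWithinAt_inner_increment
    ((S.U_deriv t ht.le).mono (Ici_subset_Ici.2 ht.le)) hVH
  refine ⟨_, _, hin.neg.add hder.hasDerivWithinAt, ?_, ?_, ?_⟩
  · simp [h.Y_eq_frozen ht.le]
  · exact eventually_nhdsWithin_of_forall fun z hz => h.Y_le_support ht (le_of_lt hz)
  have hD := D_nonneg (S := S) ht.le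
  set v := ‖S.V t‖ with hv
  have hv0 : 0 ≤ v := norm_nonneg _
  have hHn : ‖S.H t‖ ≤ η * S.D t := h.norm_H_le ht
  have hVHn : ‖S.V t + S.H t‖ ≤ v + η * S.D t := (norm_add_le _ _).trans (by linarith)
  have hinner : -inner ℝ (S.V t) (S.V t + S.H t) ≤ -v ^ 2 + v * (η * S.D t) := by
    rw [inner_add_right, real_inner_self_eq_norm_sq]
    have h1 : |inner ℝ (S.V t) (S.H t)| ≤ v * ‖S.H t‖ := abs_real_inner_le_norm _ _
    have h2 := neg_le_of_abs_le h1
    have h3 : v * ‖S.H t‖ ≤ v * (η * S.D t) := by gcongr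
    linarith
  have hpt : ∀ x ∈ S.G, f' x t ≤
      (A * (c₁ + (v + η * S.D t)) + B) * (S.grad x t * S.F x t) := fun x hx => by
    have hs := h.pos hx ht.le
    have hgF := grad_mul_F_nonneg (S := S) hs.le
    have hℓ := Real.rpow_pos_of_pos (P.ℓ_pos (S.pos_of_mem hx)) (-P.θ)
    obtain ⟨h7, h8⟩ := hℓγ x hx
    have h6 := Real.rpow_pos_of_pos hs (P.γ - P.θ)
    have hsq : S.s x t * S.grad x t ^ 2 = S.s x t ^ (-P.θ) * (S.grad x t * S.F x t) := by
      have e : S.s x t ^ (-P.θ) = S.s x t * S.s x t ^ (-(1 + P.θ)) := by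
        nth_rewrite 2 [← Real.rpow_one (S.s x t)]
        rw [← Real.rpow_add hs]
        ring_nf
      rw [e, sq]
      nth_rewrite 2 [grad]
      ring
    have h1 : -(P.ℓ x ^ (-P.θ) * S.F x t) ≤ P.cθ * (c₁ + (v + η * S.D t)) := by
      refine (neg_le_abs _).trans ?_
      rw [abs_mul, abs_of_pos hℓ]
      exact (ℓ_mul_abs_F_le hx hlo.le (h.mem hx ht.le)).trans (by gcongr)
    have h2 : S.s x t ^ (-P.θ) ≤ P.lo ^ (-P.θ) :=
      Real.rpow_le_rpow_of_nonpos hlo (h.mem hx ht.le).1 (by linarith)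
    have hs2 := Real.rpow_pos_of_pos hs (-P.θ)
    have e1 : f' x t = P.ρ * (1 + P.θ) / 2 * (-(P.ℓ x ^ (-P.θ) * S.F x t) * S.s x t ^ (-P.θ)) *
        (S.grad x t * S.F x t) + P.ρ * P.γ * ((P.ℓ x ^ (-P.θ) * (P.g * x)) *
          S.s x t ^ (P.γ - P.θ)) * (S.grad x t * S.F x t) := by
      simp only [hf', hsq]
      ring
    have h9 : -(P.ℓ x ^ (-P.θ) * S.F x t) * S.s x t ^ (-P.θ) ≤
        P.cθ * (c₁ + (v + η * S.D t)) * P.lo ^ (-P.θ) :=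
      (mul_le_mul_of_nonneg_right h1 hs2.le).trans
        (mul_le_mul_of_nonneg_left h2 (by positivity))
    have h10 : P.ℓ x ^ (-P.θ) * (P.g * x) * S.s x t ^ (P.γ - P.θ) ≤
        P.g ^ ((P.γ - P.θ) / P.γ) * P.hi ^ (P.γ - P.θ) :=
      mul_le_mul h7 (hsγ x hx t ht.le) h6.le hL₀0.le
    rw [e1]
    calc _ ≤ P.ρ * (1 + P.θ) / 2 * (P.cθ * (c₁ + (v + η * S.D t)) * P.lo ^ (-P.θ)) *
          (S.grad x t * S.F x t) + P.ρ * P.γ * (P.g ^ ((P.γ - P.θ) / P.γ) * P.hi ^ (P.γ - P.θ)) *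
            (S.grad x t * S.F x t) := by gcongr
      _ = _ := by rw [hA, hB]; ring
  have hi := hT.integrable_grad_mul hlo P.lo_le_hi htI' (S.aemeas_F ht.le)
    fun x hx => hM' x hx t htI'
  have hI : ∫ x, f' x t ∂S.τ ≤ (A * (c₁ + (v + η * S.D t)) + B) * S.D t := by
    rw [D, ← integral_const_mul]
    exact integral_mono_ae (S.integrable_of_bdd hf'm fun x hx => hf'b x hx t htI)
      (hi.const_mul _) (S.ae_τ.mono fun x hx => hpt x hx)
  nlinarith [sq_nonneg (v - (η + A) * S.D t / 2), mul_nonneg (mul_nonneg hA0.le hη0) hD,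
    sq_nonneg ((η + A)), mul_nonneg (sq_nonneg (η + A)) hD,
    mul_nonneg (show 0 ≤ A * c₁ + B by positivity) (sq_nonneg (S.D t))]

end Sol

namespace Sol

variable {P : Params} {S : Sol P}

/-- Up to a multiple of the energy, `Y` is comparable to the dissipation, so that `Y + K E` can
serve as a Lyapunov functional. -/
theorem exists_Y_bounds (P : Params) : ∃ K : ℝ, 0 < K ∧ ∀ S : Sol P, S.Global → ∀ t, 0 ≤ t →
    |S.Y t - S.D t / 2| ≤ S.D t / 4 + K * S.E t := by
  obtain ⟨k, _, hk, _, hφ⟩ := exists_phi_bounds P.one_lt_γ P.lo_pos P.lo_le_one P.one_le_hi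
  obtain ⟨K₁, hK₁, h1⟩ := exists_abs_rpow_sub_one_le P.γ P.lo_pos P.lo_le_one P.one_le_hi
  have hg := P.g_pos
  have hlo := P.lo_pos
  have hL := Real.rpow_pos_of_pos hg ((P.γ - P.θ) / P.γ)
  have hle := Real.rpow_pos_of_pos hlo (-(1 + P.θ))
  have hρ := P.ρ_pos
  set K := P.lo ^ (-(1 + P.θ)) * (P.g ^ ((P.γ - P.θ) / P.γ) * (K₁ ^ 2 / k)) with hK
  have hK0 : 0 < K := by positivity
  refine ⟨K * P.ρ, by positivity, fun S h t ht => ?_⟩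
  have hT := h.1 t
  have htI : t ∈ Icc 0 t := ⟨ht, le_rfl⟩
  obtain ⟨M, hM0, hM⟩ := hT.exists_F_bound hlo P.lo_le_hi
  have i1 : Integrable (fun x => S.grad x t * S.F x t) S.τ :=
    hT.integrable_grad_mul hlo P.lo_le_hi htI (S.aemeas_F ht) fun x hx => hM x hx t htI
  have i2 : Integrable (fun x => S.grad x t * S.pr x t) S.τ :=
    hT.integrable_grad_mul hlo P.lo_le_hi htI (aemeas_pr ht) fun x hx => h.pr_bound hx ht
  obtain ⟨C, hC⟩ := hT.exists_phi_le hlo P.lo_le_one P.one_le_hi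
  have i3 : Integrable (fun x => P.ℓ x ^ (P.γ + P.θ) * phi P.γ (S.s x t)) S.τ :=
    S.integrable_of_bdd ((P.measurable_ℓ.pow_const _).aemeasurable.mul (aemeas_phi ht))
      fun x hx => hC x hx t htI
  have e1 : S.Y t - S.D t / 2 = -∫ x, S.grad x t * S.pr x t ∂S.τ := by
    have : S.Y t = (∫ x, S.grad x t * S.F x t / 2 ∂S.τ) - ∫ x, S.grad x t * S.pr x t ∂S.τ := by
      rw [← integral_sub (i1.div_const 2) i2, Y]
      congr 1; funext x; ring
    rw [this, integral_div, D]
    ring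
  have hpt : ∀ x ∈ S.G, |S.grad x t * S.pr x t| ≤
      S.grad x t * S.F x t / 4 + K * (P.ℓ x ^ (P.γ + P.θ) * phi P.γ (S.s x t)) := fun x hx => by
    have hs := h.pos hx ht
    have hm := h.mem hx ht
    have hx' := S.G_sub hx
    have hℓ := P.ℓ_pos hx'.1
    have hse := Real.rpow_pos_of_pos hs (-(1 + P.θ))
    have h2 : S.s x t ^ (-(1 + P.θ)) ≤ P.lo ^ (-(1 + P.θ)) :=
      Real.rpow_le_rpow_of_nonpos hlo hm.1 (by linarith [P.θ_pos])
    have h3 : (S.s x t ^ P.γ - 1) ^ 2 ≤ K₁ ^ 2 / k * phi P.γ (S.s x t) := by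
      have h4 : (S.s x t ^ P.γ - 1) ^ 2 ≤ K₁ ^ 2 * (S.s x t - 1) ^ 2 := by
        rw [← sq_abs, ← sq_abs (S.s x t - 1), ← mul_pow]
        gcongr
        exact h1 _ hm
      have h5 := (hφ _ hm).1
      rw [div_mul_eq_mul_div, le_div_iff₀ hk]
      nlinarith [sq_nonneg K₁]
    have h6 : (P.g * x) ^ 2 = P.ℓ x ^ (P.γ + P.θ) * P.ℓ x ^ (P.γ - P.θ) := by
      rw [← P.ℓ_rpow_γ hx'.1, ← Real.rpow_add hℓ, ← Real.rpow_natCast, ← Real.rpow_mul hℓ.le]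
      push_cast
      ring_nf
    have h7 : P.ℓ x ^ (P.γ - P.θ) ≤ P.g ^ ((P.γ - P.θ) / P.γ) :=
      P.ℓ_rpow_le hx' (by linarith [P.θ_lt_γ])
    have h8 := Real.rpow_pos_of_pos hℓ (P.γ + P.θ)
    have h9 := Real.rpow_pos_of_pos hℓ (P.γ - P.θ)
    have h10 : S.s x t ^ (-(1 + P.θ)) * S.pr x t ^ 2 ≤
        K * (P.ℓ x ^ (P.γ + P.θ) * phi P.γ (S.s x t)) := by
      calc S.s x t ^ (-(1 + P.θ)) * S.pr x t ^ 2
          = S.s x t ^ (-(1 + P.θ)) * (P.ℓ x ^ (P.γ + P.θ) * P.ℓ x ^ (P.γ - P.θ) *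
              (S.s x t ^ P.γ - 1) ^ 2) := by rw [pr, mul_pow, h6]
        _ ≤ P.lo ^ (-(1 + P.θ)) * (P.ℓ x ^ (P.γ + P.θ) * P.g ^ ((P.γ - P.θ) / P.γ) *
              (K₁ ^ 2 / k * phi P.γ (S.s x t))) := by gcongr
        _ = _ := by rw [hK]; ring
    have h11 : |S.grad x t * S.pr x t| ≤
        S.s x t ^ (-(1 + P.θ)) * (S.F x t ^ 2 / 4 + S.pr x t ^ 2) := by
      rw [grad, mul_assoc, abs_mul, abs_of_pos hse]
      gcongr
      rw [abs_le]
      constructor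
      · nlinarith [sq_nonneg (S.F x t / 2 + S.pr x t)]
      · nlinarith [sq_nonneg (S.F x t / 2 - S.pr x t)]
    refine h11.trans ?_
    rw [mul_add]
    refine add_le_add (le_of_eq ?_) h10
    rw [grad]; ring
  rw [e1, abs_neg]
  have h2 : |∫ x, S.grad x t * S.pr x t ∂S.τ| ≤ ∫ x, |S.grad x t * S.pr x t| ∂S.τ :=
    abs_integral_le_integral_abs
  have h3 : ∫ x, |S.grad x t * S.pr x t| ∂S.τ ≤
      S.D t / 4 + K * ∫ x, P.ℓ x ^ (P.γ + P.θ) * phi P.γ (S.s x t) ∂S.τ := by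
    rw [D, ← integral_div, ← integral_const_mul, ← integral_add (i1.div_const 4) (i3.const_mul K)]
    exact integral_mono_ae i2.abs ((i1.div_const 4).add (i3.const_mul K))
      (S.ae_τ.mono fun x hx => hpt x hx)
  have h4 : ∫ x, P.ℓ x ^ (P.γ + P.θ) * phi P.γ (S.s x t) ∂S.τ ≤ P.ρ * S.E t := by
    have : P.ρ * S.E t = P.ρ * (‖S.U t‖ ^ 2 / 2) +
      ∫ x, P.ℓ x ^ (P.γ + P.θ) * phi P.γ (S.s x t) ∂S.τ := by
      unfold E
      field_simp
    have : 0 ≤ P.ρ * (‖S.U t‖ ^ 2 / 2) := by positivity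
    linarith
  refine h2.trans (h3.trans ?_)
  have h5 := mul_le_mul_of_nonneg_left h4 hK0.le
  linarith

theorem Global.Y_cont (h : S.Global) (T : ℝ) : ContinuousOn S.Y (Icc 0 T) := by
  have hT := h.1 T
  obtain ⟨M, hM0, hM⟩ := hT.exists_grad_bound P.lo_pos P.lo_le_hi
  obtain ⟨M', hM0', hM'⟩ := hT.exists_F_bound P.lo_pos P.lo_le_hi
  refine S.continuousOn_integral
    (f := fun x t => S.grad x t * S.F x t / 2 - S.pr x t * S.grad x t)
    (w := fun _ => M * M' / 2 + P.g * (P.hi ^ P.γ + 1) * M)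
    (fun t ht => ((((aemeas_grad ht.1).mul (S.aemeas_F ht.1)).div_const 2).sub
      ((aemeas_pr ht.1).mul (aemeas_grad ht.1))))
    (fun x hx => ?_) (integrable_const _) fun x hx t ht => ?_
  · have h1 := hT.grad_cont P.lo_pos hx
    have h2 := (S.F_cont hx).mono (Icc_subset_Ici_self : Icc 0 T ⊆ Ici 0)
    have h3 : ContinuousOn (S.pr x) (Icc 0 T) :=
      continuousOn_const.mul ((hT.rpow_cont P.lo_pos hx P.γ).sub continuousOn_const)
    exact ((h1.mul h2).div_const 2).sub (h3.mul h1)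
  · refine (abs_sub _ _).trans (add_le_add ?_ ?_)
    · rw [abs_div, abs_mul, abs_of_pos (two_pos (α := ℝ))]
      have h1 := hM x hx t ht
      have h2 := hM' x hx t ht
      gcongr
    · rw [abs_mul]
      have := P.g_pos
      have := P.hi_pos
      exact mul_le_mul (h.pr_bound hx ht.1) (hM x hx t ht) (abs_nonneg _) (by positivity)

/-- The dissipation decays like `1 / (1 + t)`. First a Grönwall argument based on the
integrability of the dissipation bounds it; then the weight `1 + t` is inserted. -/
theorem exists_D_decay (P : Params) (D₀ : ℝ) : ∃ C : ℝ, 0 < C ∧ ∀ S : Sol P, S.Global →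
    S.D 0 ≤ D₀ → ∀ t, 0 ≤ t → (1 + t) * S.D t ≤ C := by
  obtain ⟨K, hK, hY⟩ := exists_Y_slopeLE P
  obtain ⟨K₀, hK₀, hYb⟩ := exists_Y_bounds P
  obtain ⟨K₁, hK₁, hdec⟩ := exists_energy_decay P
  set X₀ := |D₀| + 2 * K₀ with hX₀
  have hX₀0 : 0 ≤ X₀ := by positivity
  set Q := (1 + X₀) * Real.exp (4 * K) with hQ
  have hQ0 : 0 < Q := by positivity
  refine ⟨4 * (X₀ + (1 + 2 * K₀ * K₁ + (K + 4 * K * Q) * K₁)), by positivity,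
    fun S h hD0 t ht => ?_⟩
  set X : ℝ → ℝ := fun t => S.Y t + K₀ * S.E t with hX
  have hXl : ∀ t, 0 ≤ t → S.D t / 4 ≤ X t := fun t ht => by
    have := (abs_le.1 (hYb S h t ht)).1
    simp only [hX]
    linarith
  have hXu : ∀ t, 0 ≤ t → X t ≤ S.D t + 2 * K₀ * S.E t := fun t ht => by
    have := (abs_le.1 (hYb S h t ht)).2
    have := D_nonneg (S := S) ht
    simp only [hX]
    linarith
  have hXc : ∀ T, ContinuousOn X (Icc 0 T) := fun T =>
    (h.Y_cont T).add (continuousOn_const.mul (h.E_cont T))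
  have hXs : ∀ t, 0 < t → SlopeLE X t (K * S.D t + K * S.D t ^ 2) := fun t ht => by
    have hD := D_nonneg (S := S) ht.le
    exact ((hY S h t ht).add ((h.E_slopeLE ht).const_mul hK₀.le)).mono (by nlinarith)
  have hX0 : X 0 ≤ X₀ := by
    have h1 := hXu 0 le_rfl
    have h2 := h.2
    have h3 := le_abs_self D₀
    have h4 : 2 * K₀ * S.E 0 ≤ 2 * K₀ := by nlinarith
    linarith
  have hDi : ∀ T, 0 ≤ T → IntervalIntegrable S.D volume 0 T := fun T hT =>
    ContinuousOn.intervalIntegrable (by rw [uIcc_of_le hT]; exact h.D_cont T)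
  have hEi : ∀ T, 0 ≤ T → IntervalIntegrable S.E volume 0 T := fun T hT =>
    ContinuousOn.intervalIntegrable (by rw [uIcc_of_le hT]; exact h.E_cont T)
  have hDQ : ∀ t, 0 ≤ t → S.D t ≤ 4 * Q := fun t ht => by
    have h1 := gronwall_of_slopeLE (f := fun t => 1 + X t) (k := fun t => 4 * K * S.D t) ht
      (continuousOn_const.add (hXc t)) (continuousOn_const.mul (h.D_cont t)) fun r hr => by
        have hD := D_nonneg (S := S) hr.1.le
        have h2 := hXl r hr.1.le
        refine ((HasDerivAt.slopeLE (hasDerivAt_const r (1 : ℝ)) le_rfl).add (hXs r hr.1)).mono ?_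
        nlinarith [mul_nonneg hK.le hD]
    rw [intervalIntegral.integral_const_mul] at h1
    have h2 := h.integral_D_le ht
    have h3 : Real.exp (4 * K * ∫ r in (0 : ℝ)..t, S.D r) ≤ Real.exp (4 * K) :=
      Real.exp_le_exp.2 (by nlinarith)
    have h4 : 1 + X t ≤ Q := h1.trans (by rw [hQ]; gcongr)
    linarith [hXl t ht]
  have hDwc : ContinuousOn (fun t => (1 + t) * S.D t) (Icc 0 t) :=
    ContinuousOn.mul (by fun_prop) (h.D_cont t)
  have hDwi : IntervalIntegrable (fun t => (1 + t) * S.D t) volume 0 t :=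
    ContinuousOn.intervalIntegrable (by rwa [uIcc_of_le ht])
  have h1 := le_add_integral_of_slopeLE (f := fun t => (1 + t) * X t)
    (k := fun t => S.D t + 2 * K₀ * S.E t + (K + 4 * K * Q) * ((1 + t) * S.D t)) ht
    (ContinuousOn.mul (by fun_prop) (hXc t))
    (((h.D_cont t).add (continuousOn_const.mul (h.E_cont t))).add (continuousOn_const.mul hDwc))
    fun r hr => by
      have h2 := (hXs r hr.1).weight_mul (w := fun t => 1 + t) (w' := 1)
        ((hasDerivAt_id r).const_add 1)
        (eventually_nhdsWithin_of_forall fun z hz => by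
          have h1 : r < z := hz
          linarith [hr.1]) (by linarith [hr.1])
      refine h2.mono ?_
      have hD := D_nonneg (S := S) hr.1.le
      have h3 := hXu r hr.1.le
      have h4 := hDQ r hr.1.le
      have h5 : S.D r ^ 2 ≤ 4 * Q * S.D r := by nlinarith
      have h6 : (1 + r) * (K * S.D r + K * S.D r ^ 2) ≤
          (1 + r) * (K * S.D r + K * (4 * Q * S.D r)) := by
        have := hr.1
        gcongr
      linarith
  obtain ⟨h2, h3⟩ := hdec S h t ht
  have h4 := h.integral_D_le ht
  have i12 : IntervalIntegrable (fun t => S.D t + 2 * K₀ * S.E t) volume 0 t :=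
    (hDi t ht).add ((hEi t ht).const_mul _)
  rw [intervalIntegral.integral_add i12 (hDwi.const_mul _),
    intervalIntegral.integral_add (hDi t ht) ((hEi t ht).const_mul _),
    intervalIntegral.integral_const_mul, intervalIntegral.integral_const_mul] at h1
  have h5 := mul_le_mul_of_nonneg_left (hXl t ht) (show 0 ≤ 1 + t by linarith)
  have h6 : 2 * K₀ * ∫ t in (0 : ℝ)..t, S.E t ≤ 2 * K₀ * K₁ := by gcongr
  have h7 : (K + 4 * K * Q) * ∫ t in (0 : ℝ)..t, (1 + t) * S.D t ≤ (K + 4 * K * Q) * K₁ := by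
    gcongr
  simp only [add_zero, one_mul] at h1
  linarith

/-! ### Decay in the uniform norm -/

theorem exists_U_decay (P : Params) (D₀ : ℝ) : ∃ C : ℝ, 0 < C ∧ ∀ S : Sol P, S.Global →
    S.D 0 ≤ D₀ → ∀ t, 0 ≤ t →
      ∀ᵐ x ∂muI, |(S.U t : ℝ → ℝ) x| ≤ C * (1 + t) ^ (-(1 / 2 : ℝ)) := by
  obtain ⟨C, hC, hD⟩ := exists_D_decay P D₀
  have hkU := P.kU_nonneg P.lo_pos
  refine ⟨√(P.kU P.lo * C) + 1, by positivity, fun S h hD0 => ?_⟩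
  have hpos : ∀ t, 0 < t →
      ∀ᵐ x ∂muI, |(S.U t : ℝ → ℝ) x| ≤ (√(P.kU P.lo * C) + 1) * (1 + t) ^ (-(1 / 2 : ℝ)) := by
    intro t ht
    filter_upwards [h.U_sq_le ht] with x hx
    have h1 : 0 < 1 + t := by linarith
    have h2 : S.D t ≤ C * (1 + t)⁻¹ := by
      rw [← div_eq_mul_inv, le_div_iff₀ h1]
      linarith [hD S h hD0 t ht.le]
    have h3 : (S.U t : ℝ → ℝ) x ^ 2 ≤ P.kU P.lo * C * (1 + t)⁻¹ :=
      hx.trans (by rw [mul_assoc]; gcongr)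
    refine (Real.abs_le_sqrt h3).trans ?_
    rw [Real.sqrt_mul (by positivity), Real.rpow_neg h1.le, ← Real.sqrt_eq_rpow, Real.sqrt_inv]
    gcongr
    linarith
  intro t ht
  rcases ht.eq_or_lt with rfl | ht
  swap
  · exact hpos t ht
  -- At the initial time the bound follows by continuity in `L²`.
  have h1 : Tendsto S.U (𝓝[>] 0) (𝓝 (S.U 0)) :=
    (S.U_cont 0 self_mem_Ici).mono_left (nhdsWithin_mono _ Ioi_subset_Ici_self)
  have h2 := (isClosed_ae_abs_le (√(P.kU P.lo * C) + 1)).mem_of_tendsto h1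
    (eventually_nhdsWithin_of_forall fun t ht => by
      have ht0 : 0 < t := ht
      filter_upwards [hpos t ht0] with x hx
      refine hx.trans (mul_le_of_le_one_right (by positivity) ?_)
      exact Real.rpow_le_one_of_one_le_of_nonpos (by linarith) (by norm_num))
  simpa using h2

/-- A one-sided barrier: where the relaxation towards `0` beats the forcing, `f` stays below a
slowly decaying power. The two applications are to `z` and `-z`. -/
theorem le_barrier {f f' : ℝ → ℝ} {μ ν q L : ℝ} (hμ : 0 < μ) (hν0 : 0 ≤ ν)
    (hqν : q * ν ≤ μ / 4) (hL : 0 < L)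
    (hf : ∀ t, 0 ≤ t → HasDerivWithinAt f (f' t) (Ici 0) t) (h0 : f 0 ≤ L)
    (h : ∀ t, 0 ≤ t → f t = L * (1 + ν * t) ^ (-q) →
      f' t ≤ -(μ / 2) * (L * (1 + ν * t) ^ (-q))) :
    ∀ t, 0 ≤ t → f t ≤ L * (1 + ν * t) ^ (-q) := by
  intro T hT
  have hpos : ∀ t, 0 ≤ t → 0 < 1 + ν * t := fun t ht => by positivity
  have hB : ∀ t, 0 ≤ t → HasDerivAt (fun t => L * (1 + ν * t) ^ (-q))
      (L * (ν * -q * (1 + ν * t) ^ (-q - 1))) t := fun t ht => by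
    have h1 : HasDerivAt (fun t => 1 + ν * t) ν t := by
      simpa using ((hasDerivAt_id t).const_mul ν).const_add 1
    exact (h1.rpow_const (p := -q) (Or.inl (hpos t ht).ne')).const_mul L
  refine image_le_of_deriv_right_lt_deriv_boundary' (a := 0) (b := T)
    (f := f) (f' := f')
    (B := fun t => L * (1 + ν * t) ^ (-q))
    (B' := fun t => L * (ν * -q * (1 + ν * t) ^ (-q - 1)))
    (fun t ht => (hf t ht.1).continuousWithinAt.mono Icc_subset_Ici_self)
    (fun t ht => (hf t ht.1).mono (Ici_subset_Ici.2 ht.1)) (by simpa using h0)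
    (fun t ht => (hB t ht.1).continuousAt.continuousWithinAt)
    (fun t ht => (hB t ht.1).hasDerivWithinAt) (fun t ht he => ?_) (right_mem_Icc.2 hT)
  have h1 := h t ht.1 he
  have h2 := Real.rpow_pos_of_pos (hpos t ht.1) (-q)
  have h3 : (1 + ν * t) ^ (-q - 1) ≤ (1 + ν * t) ^ (-q) :=
    Real.rpow_le_rpow_of_exponent_le (by nlinarith [mul_nonneg hν0 ht.1]) (by linarith)
  have h4 : q * ν * (1 + ν * t) ^ (-q - 1) ≤ μ / 4 * (1 + ν * t) ^ (-q) :=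
    mul_le_mul hqν h3 (Real.rpow_pos_of_pos (hpos t ht.1) _).le (by positivity)
  have h5 := mul_le_mul_of_nonneg_left h4 hL.le
  have h6 : 0 < μ * (L * (1 + ν * t) ^ (-q)) := by positivity
  linarith

/-- Decay of the profile, from the barrier applied at each `x` to `± z`. The relaxation rate
`μ = ρ θ ℓ ^ (γ - θ)` degenerates at the vacuum point, and `(1 + η μ t) ^ (-q)` is only of size
`μ ^ (-q) (1 + t) ^ (-q)` for large `t`; the weight `ℓ ^ θ` compensates for this because
`q (γ - θ) ≤ θ`. The condition `q ≤ 1 / 2` makes the velocity decay faster than the barrier. -/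
theorem exists_s_decay (P : Params) {q : ℝ} (hq0 : 0 < q) (hq : q ≤ 1 / 2)
    (hqθ : q * (P.γ - P.θ) ≤ P.θ) {CU : ℝ} (hCU : 0 < CU) : ∃ C : ℝ, 0 < C ∧ ∀ S : Sol P, S.Global →
      (∀ t, 0 ≤ t → ∀ᵐ x ∂muI, |(S.U t : ℝ → ℝ) x| ≤ CU * (1 + t) ^ (-(1 / 2 : ℝ))) →
      ∀ t, 0 ≤ t → ∀ x ∈ S.G, |P.ℓ x ^ P.θ * (S.s x t ^ P.θ - 1)| ≤ C * (1 + t) ^ (-q) := by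
  have hρ := P.ρ_pos
  have hθ := P.θ_pos
  have hg := P.g_pos
  have hcθ := P.cθ_pos
  have hk := P.k_nonneg
  have hγ := P.γ_pos
  have hhi := P.hi_pos
  have hγθ : 0 < P.γ - P.θ := by linarith [P.θ_lt_γ]
  set CW := P.ρ * P.θ * P.cθ * CU with hCW
  have hCW0 : 0 < CW := by positivity
  set CH := P.k * CU ^ 2 / P.g with hCH
  have hCH0 : 0 ≤ CH := by positivity
  set L := P.hi ^ P.θ + 1 + 4 * CW + 4 * CH with hL
  have hL0 : 0 < L := by positivity
  set m := P.ρ * P.θ * P.g ^ ((P.γ - P.θ) / P.γ) with hm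
  have hm0 : 0 < m := by have := Real.rpow_pos_of_pos hg ((P.γ - P.θ) / P.γ); positivity
  -- `ν = η μ` is the rate in the barrier, where `μ = ρ θ ℓ ^ (γ - θ)` is the relaxation rate.
  set η := (2 + m)⁻¹ with hη
  have hη0 : 0 < η := by positivity
  have hηρ : 0 < η * (P.ρ * P.θ) := by positivity
  refine ⟨2 * L * ((η * (P.ρ * P.θ)) ^ (-q) * P.g ^ ((P.θ - q * (P.γ - P.θ)) / P.γ)), ?_,
    fun S h hU t ht x hx => ?_⟩
  · have := Real.rpow_pos_of_pos hg ((P.θ - q * (P.γ - P.θ)) / P.γ)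
    have := Real.rpow_pos_of_pos hηρ (-q)
    positivity
  have hx' := S.G_sub hx
  have hℓ := P.ℓ_pos hx'.1
  have hℓθ := Real.rpow_pos_of_pos hℓ (-P.θ)
  set μ := P.ρ * P.θ * P.ℓ x ^ (P.γ - P.θ) with hμ
  have hℓγθ := Real.rpow_pos_of_pos hℓ (P.γ - P.θ)
  have hμ0 : 0 < μ := by positivity
  have hμm : μ ≤ m := by
    rw [hμ, hm]
    have := P.ℓ_rpow_le hx' hγθ.le
    gcongr
  set ν := η * μ with hν
  have hν0 : 0 < ν := by positivity
  have hν1 : ν ≤ 1 := by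
    rw [hν, hη, inv_mul_le_iff₀ (by positivity)]; linarith
  have hν2 : ν ≤ μ / 2 := by
    rw [hν, hη, inv_mul_le_iff₀ (by positivity)]; nlinarith
  have hνpos : ∀ t, 0 ≤ t → 0 < 1 + ν * t := fun t ht => by positivity
  have hqν : q * ν ≤ μ / 4 := by nlinarith
  -- the barrier dominates both the velocity potential and the friction
  have hcmp : ∀ t, 0 ≤ t → (1 + t) ^ (-(1 / 2 : ℝ)) ≤ (1 + ν * t) ^ (-q) := fun t ht => by
    refine (Real.rpow_le_rpow_of_exponent_le (by linarith) (neg_le_neg hq)).trans ?_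
    exact Real.rpow_le_rpow_of_nonpos (hνpos t ht) (by nlinarith) (by linarith)
  have hcmp1 : ∀ t, 0 ≤ t → (1 + t)⁻¹ ≤ (1 + ν * t) ^ (-q) := fun t ht => by
    refine le_trans ?_ (hcmp t ht)
    rw [← Real.rpow_neg_one]
    exact Real.rpow_le_rpow_of_exponent_le (by linarith) (by norm_num)
  have hW : ∀ t, 0 ≤ t → |S.W x t| ≤ CW * (1 + ν * t) ^ (-q) := fun t ht => by
    have h1 := abs_prim_le_of_ae (hU t ht) hx'
    rw [W, abs_mul, abs_of_pos (by positivity)]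
    have h2 := Real.rpow_pos_of_pos (show 0 < 1 + t by linarith) (-(1 / 2 : ℝ))
    calc _ ≤ P.ρ * P.θ * P.ℓ x ^ (-P.θ) * (CU * (1 + t) ^ (-(1 / 2 : ℝ)) * x) := by gcongr
      _ = P.ρ * P.θ * (P.ℓ x ^ (-P.θ) * x) * CU * (1 + t) ^ (-(1 / 2 : ℝ)) := by ring
      _ ≤ P.ρ * P.θ * P.cθ * CU * (1 + ν * t) ^ (-q) := by
        gcongr
        · exact P.ℓ_neg_mul_le hx'
        · exact hcmp t ht
  have hH : ∀ t, 0 ≤ t → |prim (S.H t) x| ≤ CH * (1 + ν * t) ^ (-q) * (P.g * x) := fun t ht => by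
    have h3 : 0 < 1 + t := by linarith
    have h1 : ∀ᵐ y ∂muI, |(S.H t : ℝ → ℝ) y| ≤ P.k * (CU ^ 2 * (1 + t)⁻¹) := by
      filter_upwards [S.H_le t ht, hU t ht] with y h1 h2
      refine h1.trans (mul_le_mul_of_nonneg_left ?_ hk)
      have h4 : ((1 + t) ^ (-(1 / 2 : ℝ))) ^ 2 = (1 + t)⁻¹ := by
        rw [← Real.rpow_natCast, ← Real.rpow_mul h3.le, ← Real.rpow_neg_one]
        norm_num
      rw [← sq_abs, ← h4, ← mul_pow]
      gcongr
    refine (abs_prim_le_of_ae h1 hx').trans ?_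
    calc P.k * (CU ^ 2 * (1 + t)⁻¹) * x = CH * (1 + t)⁻¹ * (P.g * x) := by
          rw [hCH]; field_simp
      _ ≤ _ := by
        have := hcmp1 t ht
        have := hx'.1
        gcongr
  have hz0 : |S.z x 0| ≤ L := by
    have h1 := abs_le.1 (hW 0 le_rfl)
    simp only [mul_zero, add_zero, Real.one_rpow, mul_one] at h1
    have h2 := h.mem hx le_rfl
    have h3 : S.s x 0 ^ P.θ ≤ P.hi ^ P.θ := Real.rpow_le_rpow (h.pos hx le_rfl).le h2.2 hθ.le
    have h4 := Real.rpow_nonneg (h.pos hx le_rfl).le P.θ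
    unfold z
    rw [abs_le]
    constructor <;> linarith [h1.1, h1.2]
  have hzd : ∀ t, 0 ≤ t → HasDerivWithinAt (S.z x) (-(μ * ((S.s x t ^ P.γ - 1) +
      prim (S.H t) x / (P.g * x)))) (Ici 0) t := fun t ht => by
    refine (h.z_hasDerivWithinAt hx ht).congr_deriv ?_
    have hx0 := hx'.1.ne'
    have hg0 := hg.ne'
    rw [hμ, ← P.ℓ_neg_mul_gx hx'.1, pr]
    field_simp
  have hH' : ∀ t, 0 ≤ t → |prim (S.H t) x / (P.g * x)| ≤ CH * (1 + ν * t) ^ (-q) := fun t ht => by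
    have hgx := mul_pos hg hx'.1
    rw [abs_div, abs_of_pos hgx, div_le_iff₀ hgx]
    exact hH t ht
  have hgrow : ∀ t, 0 ≤ t → (1 ≤ S.s x t ^ P.θ → S.s x t ^ P.θ ≤ S.s x t ^ P.γ) ∧
      (S.s x t ^ P.θ ≤ 1 → S.s x t ^ P.γ ≤ S.s x t ^ P.θ) := fun t ht => by
    have hs := h.pos hx ht
    constructor
    · intro h1
      refine Real.rpow_le_rpow_of_exponent_le ?_ P.θ_lt_γ.le
      by_contra hc
      exact absurd (Real.rpow_lt_one hs.le (not_le.1 hc) hθ) (not_lt.2 h1)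
    · intro h1
      refine Real.rpow_le_rpow_of_exponent_ge hs ?_ P.θ_lt_γ.le
      by_contra hc
      exact absurd (Real.one_lt_rpow (not_le.1 hc) hθ) (not_lt.2 h1)
  have hquarter : ∀ r, 0 ≤ r → |S.W x r| ≤ L * (1 + ν * r) ^ (-q) / 4 ∧
      |prim (S.H r) x / (P.g * x)| ≤ L * (1 + ν * r) ^ (-q) / 4 := fun r hr => by
    have hp := Real.rpow_pos_of_pos (hνpos r hr) (-q)
    have h0 := Real.rpow_nonneg hhi.le P.θ
    have h1 : 4 * CW * (1 + ν * r) ^ (-q) ≤ L * (1 + ν * r) ^ (-q) :=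
      mul_le_mul_of_nonneg_right (by rw [hL]; linarith) hp.le
    have h2 : 4 * CH * (1 + ν * r) ^ (-q) ≤ L * (1 + ν * r) ^ (-q) :=
      mul_le_mul_of_nonneg_right (by rw [hL]; linarith) hp.le
    exact ⟨(hW r hr).trans (by linarith), (hH' r hr).trans (by linarith)⟩
  have hsz : ∀ r, S.s x r ^ P.θ = S.z x r - S.W x r + 1 := fun r => by unfold z; ring
  have hup : S.z x t ≤ L * (1 + ν * t) ^ (-q) := by
    refine le_barrier hμ0 hν0.le hqν hL0 hzd ((le_abs_self _).trans hz0)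
      (fun r hr he => ?_) t ht
    have hB : 0 < L * (1 + ν * r) ^ (-q) := mul_pos hL0 (Real.rpow_pos_of_pos (hνpos r hr) (-q))
    have h1 := abs_le.1 (hquarter r hr).1
    have h2 := abs_le.1 (hquarter r hr).2
    have h3 := hsz r
    have h5 := (hgrow r hr).1 (by linarith)
    have h6 : L * (1 + ν * r) ^ (-q) / 2 ≤ S.s x r ^ P.γ - 1 + prim (S.H r) x / (P.g * x) := by
      linarith
    have h7 := mul_le_mul_of_nonneg_left h6 hμ0.le
    linarith
  have hdn : -S.z x t ≤ L * (1 + ν * t) ^ (-q) := by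
    refine le_barrier (f := fun t => -S.z x t) hμ0 hν0.le hqν hL0 (fun r hr => (hzd r hr).neg)
      ((neg_le_abs _).trans hz0) (fun r hr he => ?_) t ht
    have hB : 0 < L * (1 + ν * r) ^ (-q) := mul_pos hL0 (Real.rpow_pos_of_pos (hνpos r hr) (-q))
    have h1 := abs_le.1 (hquarter r hr).1
    have h2 := abs_le.1 (hquarter r hr).2
    have h3 := hsz r
    have h5 := (hgrow r hr).2 (by linarith)
    have h6 : L * (1 + ν * r) ^ (-q) / 2 ≤
        -(S.s x r ^ P.γ - 1 + prim (S.H r) x / (P.g * x)) := by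
      linarith
    have h7 := mul_le_mul_of_nonneg_left h6 hμ0.le
    linarith
  have hp := Real.rpow_pos_of_pos (hνpos t ht) (-q)
  have hr : |S.s x t ^ P.θ - 1| ≤ 2 * L * (1 + ν * t) ^ (-q) := by
    have h1 := abs_le.1 (hquarter t ht).1
    have h2 := hsz t
    have h3 : 0 < L * (1 + ν * t) ^ (-q) := mul_pos hL0 hp
    rw [abs_le]
    constructor <;> linarith [h1.1, h1.2]
  have hℓθ' := Real.rpow_pos_of_pos hℓ P.θ
  have h1t : 0 < 1 + t := by linarith
  rw [abs_mul, abs_of_pos hℓθ']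
  have hfin : P.ℓ x ^ P.θ * (1 + ν * t) ^ (-q) ≤
      (η * (P.ρ * P.θ)) ^ (-q) * P.g ^ ((P.θ - q * (P.γ - P.θ)) / P.γ) * (1 + t) ^ (-q) := by
    have h1 : (1 + ν * t) ^ (-q) ≤ (ν * (1 + t)) ^ (-q) :=
      Real.rpow_le_rpow_of_nonpos (by positivity) (by linarith) (by linarith)
    have h2 : ν = η * (P.ρ * P.θ) * P.ℓ x ^ (P.γ - P.θ) := by rw [hν, hμ]; ring
    have h3 : P.ℓ x ^ P.θ * (P.ℓ x ^ (P.γ - P.θ)) ^ (-q) = P.ℓ x ^ (P.θ - q * (P.γ - P.θ)) := by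
      rw [← Real.rpow_mul hℓ.le, ← Real.rpow_add hℓ]; ring_nf
    have h4 := P.ℓ_rpow_le hx' (p := P.θ - q * (P.γ - P.θ)) (by linarith)
    have h5 := Real.rpow_pos_of_pos hηρ (-q)
    have h6 := Real.rpow_pos_of_pos h1t (-q)
    calc _ ≤ P.ℓ x ^ P.θ * (ν * (1 + t)) ^ (-q) := by gcongr
      _ = (η * (P.ρ * P.θ)) ^ (-q) * P.ℓ x ^ (P.θ - q * (P.γ - P.θ)) * (1 + t) ^ (-q) := by
        rw [Real.mul_rpow hν0.le h1t.le, h2, Real.mul_rpow hηρ.le hℓγθ.le, ← h3]; ring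
      _ ≤ _ := by gcongr
  calc _ ≤ P.ℓ x ^ P.θ * (2 * L * (1 + ν * t) ^ (-q)) := by gcongr
    _ = 2 * L * (P.ℓ x ^ P.θ * (1 + ν * t) ^ (-q)) := by ring
    _ ≤ 2 * L * ((η * (P.ρ * P.θ)) ^ (-q) * P.g ^ ((P.θ - q * (P.γ - P.θ)) / P.γ) *
          (1 + t) ^ (-q)) := by gcongr
    _ = _ := by ring

/-- The decay theorem for solutions in relaxation form. -/
theorem exists_decay (P : Params) {q : ℝ} (hq0 : 0 < q) (hq : q ≤ 1 / 2)
    (hqθ : q * (P.γ - P.θ) ≤ P.θ) : ∃ ε : ℝ, 0 < ε ∧ ∀ D₀ : ℝ, ∃ C : ℝ, 0 < C ∧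
      ∀ S : Sol P, S.E 0 ≤ ε → S.D 0 ≤ D₀ → ∀ t, 0 ≤ t →
        (∀ x ∈ S.G, |P.ℓ x ^ P.θ * (S.s x t ^ P.θ - 1)| ≤ C * (1 + t) ^ (-q)) ∧
          ∀ᵐ x ∂muI, |(S.U t : ℝ → ℝ) x| ≤ C * (1 + t) ^ (-(1 / 2 : ℝ)) := by
  obtain ⟨ε, hε, hε1, hB⟩ := exists_energy_threshold P
  refine ⟨ε, hε, fun D₀ => ?_⟩
  obtain ⟨C₁, hC₁, h1⟩ := exists_U_decay P D₀
  obtain ⟨C₂, hC₂, h2⟩ := exists_s_decay P hq0 hq hqθ hC₁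
  refine ⟨max C₁ C₂, lt_max_of_lt_left hC₁, fun S hE hD t ht => ?_⟩
  have hG : S.Global := ⟨hB S hE, hE.trans hε1⟩
  have hp := fun p : ℝ => (Real.rpow_pos_of_pos (show 0 < 1 + t by linarith) p).le
  refine ⟨fun x hx => (h2 S hG (h1 S hG hD) t ht x hx).trans
    (mul_le_mul_of_nonneg_right (le_max_right _ _) (hp _)), ?_⟩
  filter_upwards [h1 S hG hD t ht] with x hx
  exact hx.trans (mul_le_mul_of_nonneg_right (le_max_left _ _) (hp _))

end Sol

/-! ### Weak derivatives on the unit interval -/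

/-- A smooth function with compact support in `(0,1)` and mean zero is the derivative of such a
function. -/
theorem exists_deriv_eq {ζ : ℝ → ℝ} (h1 : ContDiff ℝ ∞ ζ) (h2 : HasCompactSupport ζ)
    (h3 : tsupport ζ ⊆ Ioo 0 1) (h4 : ∫ x, ζ x = 0) :
    ∃ φ : ℝ → ℝ, ContDiff ℝ ∞ φ ∧ HasCompactSupport φ ∧ tsupport φ ⊆ Ioo 0 1 ∧ deriv φ = ζ := by
  obtain ⟨a, b, ha, hb, hab⟩ : ∃ a b : ℝ, 0 < a ∧ b < 1 ∧ tsupport ζ ⊆ Icc a b := by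
    rcases (tsupport ζ).eq_empty_or_nonempty with he | hne
    · exact ⟨1, 0, by norm_num, by norm_num, by simp [he]⟩
    · obtain ⟨a, ha⟩ := h2.exists_isLeast hne
      obtain ⟨b, hb⟩ := h2.exists_isGreatest hne
      exact ⟨a, b, (h3 ha.1).1, (h3 hb.1).2, fun x hx => ⟨ha.2 hx, hb.2 hx⟩⟩
  have hz : ∀ x ∉ Icc a b, ζ x = 0 := fun x hx =>
    image_eq_zero_of_notMem_tsupport fun h => hx (hab h)
  have hder : deriv (fun x => ∫ y in (0 : ℝ)..x, ζ y) = ζ := by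
    funext x; exact Continuous.deriv_integral ζ h1.continuous 0 x
  have hsub : Function.support (fun x => ∫ y in (0 : ℝ)..x, ζ y) ⊆ Icc a b := by
    intro x hx
    by_contra hxab
    refine hx ?_
    beta_reduce
    rw [mem_Icc, not_and_or, not_le, not_le] at hxab
    rcases hxab with hxa | hxb
    · rw [intervalIntegral.integral_congr (g := fun _ => (0 : ℝ)), intervalIntegral.integral_zero]
      intro y hy
      refine hz y fun hy' => ?_
      rw [mem_uIcc] at hy
      rcases hy with h | h <;> linarith [hy'.1, h.1, h.2]
    · rw [intervalIntegral.integral_eq_integral_of_support_subset, h4]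
      intro y hy
      have := by_contra fun h => hy (hz y h)
      exact ⟨ha.trans_le this.1, this.2.trans hxb.le⟩
  refine ⟨fun x => ∫ y in (0 : ℝ)..x, ζ y, ?_, ?_, ?_, hder⟩
  · rw [contDiff_infty_iff_deriv, hder]
    refine ⟨fun x => ?_, h1⟩
    exact (intervalIntegral.integral_hasDerivAt_right (h1.continuous.intervalIntegrable _ _)
      (h1.continuous.stronglyMeasurableAtFilter _ _) h1.continuous.continuousAt).differentiableAt
  · exact HasCompactSupport.of_support_subset_isCompact isCompact_Icc hsub
  · exact (closure_minimal hsub isClosed_Icc).trans fun x hx => ⟨ha.trans_le hx.1, hx.2.trans_lt hb⟩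

theorem integral_muI_eq {f : ℝ → ℝ} (h : tsupport f ⊆ Ioo 0 1) : ∫ x, f x ∂muI = ∫ x, f x :=
  setIntegral_eq_integral_of_forall_compl_eq_zero fun _ hx =>
    image_eq_zero_of_notMem_tsupport fun h' => hx (h h')

/-- The lemma of du Bois-Reymond. -/
theorem exists_ae_eq_const {f : ℝ → ℝ} (hf : Integrable f muI)
    (h : ∀ φ : ℝ → ℝ, ContDiff ℝ ∞ φ → HasCompactSupport φ → tsupport φ ⊆ Ioo 0 1 →
      ∫ x, f x * deriv φ x ∂muI = 0) : ∃ C, ∀ᵐ x ∂muI, f x = C := by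
  obtain ⟨η, e1, e2, e3, e4⟩ : ∃ η : ℝ → ℝ, ContDiff ℝ ∞ η ∧ HasCompactSupport η ∧
      tsupport η ⊆ Ioo 0 1 ∧ ∫ x, η x = 1 := by
    let η : ContDiffBump (1 / 2 : ℝ) := ⟨1 / 8, 1 / 4, by norm_num, by norm_num⟩
    refine ⟨η.normed volume, η.contDiff_normed, η.hasCompactSupport_normed, ?_, η.integral_normed⟩
    rw [η.tsupport_normed_eq, Real.closedBall_eq_Icc]
    intro x hx
    have h1 : (1 / 2 - 1 / 4 : ℝ) ≤ x := hx.1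
    have h2 : x ≤ (1 / 2 + 1 / 4 : ℝ) := hx.2
    constructor <;> linarith
  have hint : ∀ ξ : ℝ → ℝ, ContDiff ℝ ∞ ξ → HasCompactSupport ξ →
      Integrable (fun x => f x * ξ x) muI := fun ξ h1 h2 => by
    obtain ⟨M, hM⟩ := h1.continuous.bounded_above_of_compact_support h2
    exact hf.mul_bdd h1.continuous.aestronglyMeasurable (Eventually.of_forall hM)
  set C := ∫ x, f x * η x ∂muI with hC
  refine ⟨C, ?_⟩
  have key : ∀ᵐ x ∂(volume : Measure ℝ), x ∈ Ioo (0 : ℝ) 1 → f x - C = 0 := by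
    refine isOpen_Ioo.ae_eq_zero_of_integral_contDiff_smul_eq_zero
      (IntegrableOn.locallyIntegrableOn (hf.sub (integrable_const C))) fun ξ x1 x2 x3 => ?_
    have hts : tsupport (fun x => ξ x - (∫ y, ξ y) * η x) ⊆ tsupport ξ ∪ tsupport η := by
      refine closure_minimal (fun x hx => ?_) ((isClosed_tsupport _).union (isClosed_tsupport _))
      by_contra hx'
      rw [mem_union, not_or] at hx'
      refine hx ?_
      simp [image_eq_zero_of_notMem_tsupport hx'.1, image_eq_zero_of_notMem_tsupport hx'.2]
    have x4 : Integrable ξ := x1.continuous.integrable_of_hasCompactSupport x2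
    have e5 : Integrable η := e1.continuous.integrable_of_hasCompactSupport e2
    obtain ⟨φ, p1, p2, p3, p4⟩ := exists_deriv_eq (ζ := fun x => ξ x - (∫ y, ξ y) * η x)
      (x1.sub (contDiff_const.mul e1))
      (HasCompactSupport.of_support_subset_isCompact (x2.isCompact.union e2.isCompact)
        ((subset_tsupport _).trans hts)) (hts.trans (union_subset x3 e3))
      (by rw [integral_sub x4 (e5.const_mul _), integral_const_mul, e4, mul_one, sub_self])
    have h0 := h φ p1 p2 p3
    rw [p4] at h0
    have h5 : ∀ x, f x * (ξ x - (∫ y, ξ y) * η x) = f x * ξ x - (∫ y, ξ y) * (f x * η x) :=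
      fun x => by ring
    simp only [h5] at h0
    rw [integral_sub (hint ξ x1 x2) ((hint η e1 e2).const_mul _), integral_const_mul] at h0
    rw [← setIntegral_eq_integral_of_forall_compl_eq_zero (s := Ioo (0 : ℝ) 1) (fun x hx => by
      simp [image_eq_zero_of_notMem_tsupport fun h' => hx (x3 h')])]
    have : ∀ x, ξ x • (f x - C) = f x * ξ x - C * ξ x := fun x => by simp only [smul_eq_mul]; ring
    simp only [this]
    rw [integral_sub (hint ξ x1 x2) (x4.restrict.const_mul _), integral_const_mul,
      integral_muI_eq x3]
    rw [← hC] at h0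
    linarith
  rw [ae_restrict_iff' measurableSet_Ioo]
  filter_upwards [key] with x hx hx' using by linarith [hx hx']

/-- If the test functions are free at `0`, then the constant in the lemma of du Bois-Reymond is
zero. -/
theorem ae_eq_zero_of_integral_deriv {f : ℝ → ℝ} (hf : Integrable f muI)
    (h : ∀ φ : ℝ → ℝ, ContDiff ℝ ∞ φ → HasCompactSupport φ → tsupport φ ⊆ Iio 1 →
      ∫ x, f x * deriv φ x ∂muI = 0) : ∀ᵐ x ∂muI, f x = 0 := by
  obtain ⟨C, hC⟩ := exists_ae_eq_const hf fun φ h1 h2 h3 => h φ h1 h2 (h3.trans Ioo_subset_Iio_self)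
  let η : ContDiffBump (0 : ℝ) := ⟨1 / 4, 1 / 2, by norm_num, by norm_num⟩
  have hη : tsupport η ⊆ Iio 1 := by
    rw [η.tsupport_eq, Real.closedBall_eq_Icc]
    intro x hx
    have h2 : x ≤ (0 + 1 / 2 : ℝ) := hx.2
    rw [mem_Iio]; linarith
  have h1 : ContDiff ℝ ∞ (η : ℝ → ℝ) := η.contDiff
  have h0 := h η h1 η.hasCompactSupport hη
  have e0 : η 0 = 1 := η.one_of_mem_closedBall (by simp [η.rIn_pos.le])
  have e1 : η 1 = 0 := image_eq_zero_of_notMem_tsupport fun h => lt_irrefl (1 : ℝ) (hη h)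
  rw [integral_congr_ae (g := fun x => C * deriv η x) (by filter_upwards [hC] with x hx; rw [hx]),
    integral_const_mul, ← integral_Ioc_eq_integral_Ioo,
    ← intervalIntegral.integral_of_le zero_le_one, intervalIntegral.integral_deriv_eq_sub, e0,
    e1] at h0
  · have : C = 0 := by linarith
    filter_upwards [hC] with x hx using hx.trans this
  · exact fun x _ => (h1.differentiable (by simp)).differentiableAt
  · exact (h1.continuous_deriv (by simp)).intervalIntegrable _ _

/-! ### Curves in `L²(0,1)` and functions of two variables -/

theorem norm_sq_eq_integral (k : L2I) : ‖k‖ ^ 2 = ∫ x, (k : ℝ → ℝ) x ^ 2 ∂muI := by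
  rw [← real_inner_self_eq_norm_sq (F := L2I), L2.inner_def]
  simp [sq]

/-- Uniformly bounded superposition operators preserve continuity of curves in `L²(0,1)`. -/
theorem continuousOn_superposition {R U Z : ℝ → L2I} {s : Set ℝ} (hR : ContinuousOn R s)
    (hU : ContinuousOn U s) {N : ℝ → ℝ → ℝ → ℝ} {M : ℝ}
    (hN : ∀ᵐ x ∂muI, Continuous fun p : ℝ × ℝ => N x p.1 p.2)
    (hZ : ∀ t ∈ s, ∀ᵐ x ∂muI, (Z t : ℝ → ℝ) x = N x ((R t : ℝ → ℝ) x) ((U t : ℝ → ℝ) x))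
    (hM : ∀ t ∈ s, ∀ᵐ x ∂muI, |(Z t : ℝ → ℝ) x| ≤ M) : ContinuousOn Z s := by
  intro t ht
  refine tendsto_of_subseq_tendsto fun ns hns => ?_
  obtain ⟨a, ha, ha'⟩ := (tendstoInMeasure_of_tendsto_Lp
    ((hR t ht).tendsto.comp hns)).exists_seq_tendsto_ae
  obtain ⟨b, hb, hb'⟩ := (tendstoInMeasure_of_tendsto_Lp
    ((hU t ht).tendsto.comp (hns.comp ha.tendsto_atTop))).exists_seq_tendsto_ae
  refine ⟨a ∘ b, ?_⟩
  have hlim : Tendsto (fun n => ns (a (b n))) atTop (𝓝[s] t) :=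
    hns.comp (ha.tendsto_atTop.comp hb.tendsto_atTop)
  have hmem : ∀ᶠ n in atTop, ns (a (b n)) ∈ s := hlim.eventually self_mem_nhdsWithin
  obtain ⟨n₀, hn₀⟩ := eventually_atTop.1 hmem
  have hmem' : ∀ n, ns (a (b (n + n₀))) ∈ s := fun n => hn₀ _ (Nat.le_add_left _ _)
  have hZ1 := ae_all_iff.2 fun n => hZ _ (hmem' n)
  have hM1 := ae_all_iff.2 fun n => hM _ (hmem' n)
  have hsub := ae_all_iff.2 fun n => Lp.coeFn_sub (Z (ns (a (b (n + n₀))))) (Z t)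
  have hae : ∀ᵐ x ∂muI, Tendsto (fun n => (Z (ns (a (b (n + n₀)))) : ℝ → ℝ) x) atTop
      (𝓝 ((Z t : ℝ → ℝ) x)) := by
    filter_upwards [ha', hb', hN, hZ t ht, hZ1] with x h1 h2 h3 h4 h5
    rw [h4]
    simp only [h5]
    have h1' := (h1.comp hb.tendsto_atTop).comp (tendsto_add_atTop_nat n₀)
    have h2' := h2.comp (tendsto_add_atTop_nat n₀)
    exact (h3.tendsto (_, _)).comp (h1'.prodMk_nhds h2')
  have hint : Tendsto (fun n => ‖Z (ns (a (b (n + n₀)))) - Z t‖ ^ 2) atTop (𝓝 0) := by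
    simp only [norm_sq_eq_integral]
    rw [show (0 : ℝ) = ∫ x, (0 : ℝ) ∂muI by simp]
    refine tendsto_integral_of_dominated_convergence (fun _ => (2 * M) ^ 2)
      (fun n => (Lp.aestronglyMeasurable _).pow 2) (integrable_const _) (fun n => ?_) ?_
    · filter_upwards [hM t ht, hM1, hsub] with x h1 h2 h3
      rw [h3 n, Pi.sub_apply, norm_pow, Real.norm_eq_abs]
      have := abs_sub ((Z (ns (a (b (n + n₀)))) : ℝ → ℝ) x) ((Z t : ℝ → ℝ) x)
      gcongr
      linarith [h2 n]
    · filter_upwards [hae, hsub] with x h1 h3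
      simp only [h3, Pi.sub_apply]
      have := (h1.sub_const ((Z t : ℝ → ℝ) x)).pow 2
      simpa using this
  refine (tendsto_add_atTop_iff_nat n₀).1 ?_
  rw [tendsto_iff_norm_sub_tendsto_zero]
  have := hint.sqrt
  simpa [Real.sqrt_sq] using this

theorem ae_ae_of_ae_restrict_prod {p : ℝ × ℝ → Prop}
    (h : ∀ᵐ z ∂(volume.restrict (Icc (0 : ℝ) 1 ×ˢ Ici (0 : ℝ))), p z) :
    ∀ᵐ t ∂(volume.restrict (Ici (0 : ℝ))), ∀ᵐ x ∂muI, p (x, t) := by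
  rw [Measure.volume_eq_prod, ← Measure.prod_restrict] at h
  have h2 : ∀ᵐ z ∂(muI.prod (volume.restrict (Ici (0 : ℝ)))), p z := by
    refine ae_mono (Measure.prod_mono ?_ le_rfl) h
    exact Measure.restrict_mono Ioo_subset_Icc_self le_rfl
  rw [← Measure.prod_swap] at h2
  exact Measure.ae_ae_of_ae_prod (ae_of_ae_map measurable_swap.aemeasurable h2)

/-- An essentially bounded function given by a continuous curve in `L²(0,1)` is bounded at every
time. -/
theorem MemLinfty.exists_bound {v : ℝ → ℝ → ℝ} (hv : MemLinfty v) {W : ℝ → L2I}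
    (hW : IsCurveOf W v) (hc : ContinuousOn W (Ici 0)) :
    ∃ M, 0 ≤ M ∧ ∀ t, 0 ≤ t → ∀ᵐ x ∂muI, |v x t| ≤ M := by
  set M := (eLpNorm (Function.uncurry v) ⊤
    (volume.restrict (Icc (0 : ℝ) 1 ×ˢ Ici (0 : ℝ)))).toReal with hM
  have h2 : ∀ᵐ t ∂(volume.restrict (Ici (0 : ℝ))), ∀ᵐ x ∂muI, |v x t| ≤ M := by
    have h0 : ∀ᵐ p ∂(volume.restrict (Icc (0 : ℝ) 1 ×ˢ Ici (0 : ℝ))),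
        |Function.uncurry v p| ≤ M := by
      filter_upwards [ae_le_eLpNormEssSup (f := Function.uncurry v)
        (μ := volume.restrict (Icc (0 : ℝ) 1 ×ˢ Ici (0 : ℝ)))] with p hp
      rw [← Real.norm_eq_abs, hM, eLpNorm_exponent_top, ← toReal_enorm]
      refine ENNReal.toReal_mono ?_ hp
      rw [← eLpNorm_exponent_top]
      exact hv.2.ne
    exact ae_ae_of_ae_restrict_prod h0
  refine ⟨M, ENNReal.toReal_nonneg, fun t ht => ?_⟩
  have h3 : W t ∈ {k : L2I | ∀ᵐ x ∂muI, |(k : ℝ → ℝ) x| ≤ M} := by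
    refine (isClosed_ae_abs_le M).mem_of_frequently_of_tendsto (b := 𝓝[>] t) ?_
      ((hc t ht).mono_left (nhdsWithin_mono _ (Ioi_subset_Ici ht)))
    have h4 : ∀ᵐ r ∂(volume.restrict (Ioi t)), ∀ᵐ x ∂muI, |v x r| ≤ M :=
      ae_mono (Measure.restrict_mono (Ioi_subset_Ici ht) le_rfl) h2
    rw [frequently_nhdsWithin_iff]
    intro hcon
    obtain ⟨δ, hδ, hball⟩ := Metric.eventually_nhds_iff_ball.1 hcon
    rw [ae_restrict_iff' measurableSet_Ioi] at h4
    have h5 : volume (Ioo t (t + δ)) = 0 := by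
      refine measure_mono_null (fun r hr => ?_) (ae_iff.1 h4)
      intro hcc
      have hr' : r ∈ Metric.ball t δ := by
        rw [Metric.mem_ball, Real.dist_eq, abs_lt]; constructor <;> linarith [hr.1, hr.2]
      refine hball r hr' ⟨?_, hr.1⟩
      filter_upwards [hcc hr.1, hW r (ht.trans hr.1.le)] with x hx hx'
      rwa [hx']
    simp at h5
    linarith
  filter_upwards [h3, hW t ht] with x hx hx'
  rwa [← hx']

/-! ### The momentum equation at each time -/

/-- A continuously differentiable function whose weak derivative on `(0,∞)` is a continuous `b` has
derivative `b`, up to and including time `0`. -/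
theorem eqOn_deriv_of_integral_test {a a' b : ℝ → ℝ} (ha : ∀ t, 0 < t → HasDerivAt a (a' t) t)
    (ha' : ContinuousOn a' (Ici 0)) (hb : ContinuousOn b (Ici 0))
    (h : ∀ ψ : ℝ → ℝ, ContDiff ℝ ∞ ψ → HasCompactSupport ψ → tsupport ψ ⊆ Ioi 0 →
      ∫ t in Ioi (0 : ℝ), (a t * deriv ψ t + b t * ψ t) = 0) : EqOn a' b (Ici 0) := by
  have hIoi : ∀ f : ℝ → ℝ, ContinuousOn f (Ioi 0) → ∀ ψ : ℝ → ℝ, Continuous ψ →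
      HasCompactSupport ψ → tsupport ψ ⊆ Ioi 0 → Integrable (fun t => f t * ψ t) := by
    intro f hf ψ h1 h2 h3
    have h4 : tsupport (fun t => f t * ψ t) ⊆ Ioi 0 := (tsupport_mul_subset_right (f := f)).trans h3
    exact ((hf.mul h1.continuousOn).continuous_of_tsupport_subset isOpen_Ioi h4)
      |>.integrable_of_hasCompactSupport (h2.mul_left (f := f))
  have hac : ContinuousOn a (Ioi 0) := fun t ht => (ha t ht).continuousAt.continuousWithinAt
  have ha'c := ha'.mono Ioi_subset_Ici_self
  have hbc := hb.mono Ioi_subset_Ici_self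
  have hpos : EqOn a' b (Ioi 0) := by
    have key : ∀ᵐ t ∂(volume : Measure ℝ), t ∈ Ioi (0 : ℝ) → b t - a' t = 0 := by
      refine isOpen_Ioi.ae_eq_zero_of_integral_contDiff_smul_eq_zero
        ((hbc.sub ha'c).locallyIntegrableOn measurableSet_Ioi) fun ψ h1 h2 h3 => ?_
      have hd1 : Differentiable ℝ ψ := h1.differentiable (by simp)
      have hd2 : Continuous (deriv ψ) := h1.continuous_deriv (by simp)
      have hd3 : tsupport (deriv ψ) ⊆ Ioi 0 := (tsupport_deriv_subset).trans h3
      have i1 := hIoi a hac _ hd2 h2.deriv hd3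
      have i2 := hIoi a' ha'c ψ h1.continuous h2 h3
      have i3 := hIoi b hbc ψ h1.continuous h2 h3
      have e0 : ψ =ᶠ[𝓝 0] 0 :=
        notMem_tsupport_iff_eventuallyEq.1 fun h => lt_irrefl (0 : ℝ) (h3 h)
      have e1 : ∫ t in Ioi (0 : ℝ), (a t * deriv ψ t + a' t * ψ t) = 0 - a 0 * ψ 0 := by
        refine integral_Ioi_of_hasDerivAt_of_tendsto (f := fun t => a t * ψ t) ?_ ?_
          (i1.add i2).integrableOn ?_
        · refine ContinuousAt.continuousWithinAt ?_
          refine (continuousAt_const (y := (0 : ℝ))).congr ?_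
          filter_upwards [e0] with t ht
          simp [ht]
        · intro t ht
          exact ((ha t ht).mul (hd1 t).hasDerivAt).congr_deriv (by ring)
        · refine tendsto_const_nhds.congr' ?_
          obtain ⟨B, hB⟩ := h2.isCompact.bddAbove
          filter_upwards [eventually_gt_atTop B] with t ht
          rw [image_eq_zero_of_notMem_tsupport fun h => (hB h).not_gt ht, mul_zero]
      have e2 : ψ 0 = 0 := e0.self_of_nhds
      rw [e2, mul_zero, sub_zero, integral_add i1.integrableOn i2.integrableOn] at e1
      have e3 := h ψ h1 h2 h3
      rw [integral_add i1.integrableOn i3.integrableOn] at e3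
      rw [← setIntegral_eq_integral_of_forall_compl_eq_zero (s := Ioi (0 : ℝ)) fun t ht => by
        simp [image_eq_zero_of_notMem_tsupport fun h => ht (h3 h)]]
      have : ∀ t, ψ t • (b t - a' t) = b t * ψ t - a' t * ψ t := fun t => by
        simp only [smul_eq_mul]; ring
      simp only [this]
      rw [integral_sub i3.integrableOn i2.integrableOn]
      linarith
    refine Measure.eqOn_open_of_ae_eq (μ := volume) ?_ isOpen_Ioi ha'c hbc
    rw [EventuallyEq, ae_restrict_iff' measurableSet_Ioi]
    filter_upwards [key] with t ht ht0
    linarith [ht ht0]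
  exact hpos.of_subset_closure ha' hb Ioi_subset_Ici_self (by rw [closure_Ioi])

/-- Integrating the momentum balance from the stress-free end `x = 0`. -/
theorem ae_eq_of_momentum_balance {W K : L2I} {g : ℝ}
    (h : ∀ χ : ℝ → ℝ, ContDiff ℝ ∞ χ → HasCompactSupport χ → tsupport χ ⊆ Iio 1 →
      ∫ x, (K : ℝ → ℝ) x * χ x ∂muI
        = (∫ x, (W : ℝ → ℝ) x * deriv χ x ∂muI) + g * ∫ x, χ x ∂muI) :
    ∀ᵐ x ∂muI, (W : ℝ → ℝ) x = g * x - prim K x := by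
  have hK := integrable_coe K
  have hp : Integrable (fun x => g * x - prim K x) muI := by
    refine Integrable.of_bound (by have := measurable_prim K; fun_prop) (|g| + ‖K‖) ?_
    filter_upwards [ae_restrict_mem measurableSet_Ioo] with x hx
    have h1 := abs_prim_le K hx
    have h2 : √x ≤ 1 := Real.sqrt_le_one.2 hx.2.le
    refine (norm_sub_le _ _).trans (add_le_add ?_ ?_)
    · rw [norm_mul, Real.norm_eq_abs, Real.norm_eq_abs, abs_of_pos hx.1]
      nlinarith [abs_nonneg g, hx.2]
    · rw [Real.norm_eq_abs]
      nlinarith [norm_nonneg K]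
  have hW := integrable_coe W
  have key := ae_eq_zero_of_integral_deriv (hW.sub hp) fun χ h1 h2 h3 => by
    have hd : Continuous (deriv χ) := h1.continuous_deriv (by simp)
    obtain ⟨M, hM⟩ := hd.bounded_above_of_compact_support h2.deriv
    obtain ⟨M', hM'⟩ := h1.continuous.bounded_above_of_compact_support h2
    have b1 : ∀ f : ℝ → ℝ, Integrable f muI → Integrable (fun x => f x * deriv χ x) muI :=
      fun f hf => hf.mul_bdd hd.aestronglyMeasurable (Eventually.of_forall hM)
    have b2 : ∀ f : ℝ → ℝ, Integrable f muI → Integrable (fun x => f x * χ x) muI :=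
      fun f hf => hf.mul_bdd h1.continuous.aestronglyMeasurable (Eventually.of_forall hM')
    have hχ1 : χ 1 = 0 := image_eq_zero_of_notMem_tsupport fun h => lt_irrefl (1 : ℝ) (h3 h)
    have htail : ∀ x ∈ Ioo (0 : ℝ) 1, ∫ y in Ioi x, deriv χ y ∂muI = -χ x := by
      intro x hx
      have : Ioi x ∩ Ioo 0 1 = Ioo x 1 := by
        ext y
        simp only [mem_inter_iff, mem_Ioi, mem_Ioo]
        constructor
        · rintro ⟨h1, h2, h3⟩; exact ⟨h1, h3⟩
        · rintro ⟨h1, h2⟩; exact ⟨h1, hx.1.trans h1, h2⟩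
      rw [Measure.restrict_restrict measurableSet_Ioi, this, ← integral_Ioc_eq_integral_Ioo,
        ← intervalIntegral.integral_of_le hx.2.le, intervalIntegral.integral_deriv_eq_sub, hχ1,
        zero_sub]
      · exact fun x _ => (h1.differentiable (by simp)).differentiableAt
      · exact hd.intervalIntegrable _ _
    have hid : Integrable (deriv χ) muI :=
      (hd.integrable_of_hasCompactSupport h2.deriv).restrict
    have hgK : Integrable (fun x => g - (K : ℝ → ℝ) x) muI := (integrable_const g).sub hK
    have hswap := integral_tail_mul hid hgK
    have e1 : ∫ x, (∫ y in Ioi x, deriv χ y ∂muI) * (g - (K : ℝ → ℝ) x) ∂muI =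
        ∫ x, ((K : ℝ → ℝ) x * χ x - g * χ x) ∂muI := by
      refine integral_congr_ae ?_
      filter_upwards [ae_restrict_mem measurableSet_Ioo] with x hx
      rw [htail x hx]
      ring
    have e2 : ∫ y, deriv χ y * ∫ x in Iio y, (g - (K : ℝ → ℝ) x) ∂muI ∂muI =
        ∫ x, (g * x - prim K x) * deriv χ x ∂muI := by
      refine integral_congr_ae ?_
      filter_upwards [ae_restrict_mem measurableSet_Ioo] with x hx
      rw [integral_sub (integrable_const _) hK.restrict, setIntegral_const, measureReal_Iio hx,
        prim, smul_eq_mul]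
      ring
    have e3 := h χ h1 h2 h3
    rw [e1, e2, integral_sub (b2 _ hK) ((b2 (fun _ => 1) (integrable_const _)).const_mul g |>.congr
      (by simp)), integral_const_mul] at hswap
    calc ∫ x, ((W : ℝ → ℝ) - fun x => g * x - prim K x) x * deriv χ x ∂muI
        = ∫ x, ((W : ℝ → ℝ) x * deriv χ x - (g * x - prim K x) * deriv χ x) ∂muI := by
          simp only [Pi.sub_apply, sub_mul]
      _ = 0 := by
          rw [integral_sub (b1 _ hW) (b1 _ hp)]
          linarith
  filter_upwards [key] with x hx
  simp only [Pi.sub_apply] at hx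
  linarith

/-- The integrated momentum equation, at every time. Testing with products `χ(x) ψ(t)` localizes the
weak equation in time; the test functions `χ` need not vanish at `0`, which expresses that this end
is free of stress. -/
theorem ae_eq_of_weak_momentum {g : ℝ} {U V W H : ℝ → L2I} {u₀ : ℝ → ℝ}
    (hU : ∀ t, 0 ≤ t → HasDerivWithinAt U (V t) (Ici 0) t) (hV : ContinuousOn V (Ici 0))
    (hW : ContinuousOn W (Ici 0)) (hH : ContinuousOn H (Ici 0))
    (h : ∀ φ : ℝ × ℝ → ℝ, ContDiff ℝ ∞ φ → HasCompactSupport φ →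
      tsupport φ ⊆ {p : ℝ × ℝ | p.1 < 1} →
      (∫ t in Ioi (0 : ℝ), ∫ x in Ioo (0 : ℝ) 1,
        ((U t : ℝ → ℝ) x * deriv (fun s => φ (x, s)) t
          + (W t : ℝ → ℝ) x * deriv (fun y => φ (y, t)) x
          + g * φ (x, t) - (H t : ℝ → ℝ) x * φ (x, t)))
        + ∫ x in Ioo (0 : ℝ) 1, u₀ x * φ (x, 0) = 0) :
    ∀ t, 0 ≤ t → ∀ᵐ x ∂muI, (W t : ℝ → ℝ) x = g * x - prim (V t + H t) x := by
  intro t ht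
  refine ae_eq_of_momentum_balance fun χ c1 c2 c3 => ?_
  have hd : Continuous (deriv χ) := c1.continuous_deriv (by simp)
  obtain ⟨M, hM⟩ := hd.bounded_above_of_compact_support c2.deriv
  obtain ⟨M', hM'⟩ := c1.continuous.bounded_above_of_compact_support c2
  have m1 : MemLp χ 2 muI :=
    MemLp.of_bound c1.continuous.aestronglyMeasurable M' (Eventually.of_forall hM')
  have m2 : MemLp (deriv χ) 2 muI :=
    MemLp.of_bound hd.aestronglyMeasurable M (Eventually.of_forall hM)
  have in1 : ∀ k : L2I, inner ℝ k (m1.toLp χ) = ∫ x, (k : ℝ → ℝ) x * χ x ∂muI := fun k => by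
    rw [L2.inner_def]
    refine integral_congr_ae ?_
    filter_upwards [m1.coeFn_toLp] with x hx
    simp only [RCLike.inner_apply, conj_trivial, hx, mul_comm]
  have in2 : ∀ k : L2I, inner ℝ k (m2.toLp (deriv χ)) = ∫ x, (k : ℝ → ℝ) x * deriv χ x ∂muI :=
    fun k => by
    rw [L2.inner_def]
    refine integral_congr_ae ?_
    filter_upwards [m2.coeFn_toLp] with x hx
    simp only [RCLike.inner_apply, conj_trivial, hx, mul_comm]
  have ii1 : ∀ k : L2I, Integrable (fun x => (k : ℝ → ℝ) x * χ x) muI := fun k =>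
    (integrable_coe k).mul_bdd c1.continuous.aestronglyMeasurable (Eventually.of_forall hM')
  have ii2 : ∀ k : L2I, Integrable (fun x => (k : ℝ → ℝ) x * deriv χ x) muI := fun k =>
    (integrable_coe k).mul_bdd hd.aestronglyMeasurable (Eventually.of_forall hM)
  have hχi : Integrable χ muI := (c1.continuous.integrable_of_hasCompactSupport c2).restrict
  have key := eqOn_deriv_of_integral_test (a := fun t => inner ℝ (U t) (m1.toLp χ))
    (a' := fun t => inner ℝ (V t) (m1.toLp χ))
    (b := fun t => inner ℝ (W t) (m2.toLp (deriv χ)) + g * (∫ x, χ x ∂muI)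
      - inner ℝ (H t) (m1.toLp χ))
    (fun t ht => by
      have h0 := (hU t ht.le).hasDerivAt (Ici_mem_nhds ht)
      simpa using h0.inner ℝ (hasDerivAt_const t (m1.toLp χ)))
    (hV.inner continuousOn_const)
    (((hW.inner continuousOn_const).add continuousOn_const).sub (hH.inner continuousOn_const))
    fun ψ p1 p2 p3 => by
      have hts : tsupport (fun p : ℝ × ℝ => χ p.1 * ψ p.2) ⊆ tsupport χ ×ˢ tsupport ψ := by
        refine closure_minimal (fun p hp => ?_) ((isClosed_tsupport _).prod (isClosed_tsupport _))
        have hp' : χ p.1 * ψ p.2 ≠ 0 := hp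
        exact ⟨subset_tsupport _ (left_ne_zero_of_mul hp'),
          subset_tsupport _ (right_ne_zero_of_mul hp')⟩
      have := h (fun p => χ p.1 * ψ p.2) ((c1.comp contDiff_fst).mul (p1.comp contDiff_snd))
        (HasCompactSupport.of_support_subset_isCompact (c2.isCompact.prod p2.isCompact)
          ((subset_tsupport _).trans hts)) fun p hp => c3 (hts hp).1
      have hψ0 : ψ 0 = 0 := image_eq_zero_of_notMem_tsupport fun h => lt_irrefl (0 : ℝ) (p3 h)
      simp only [hψ0, mul_zero, integral_zero, add_zero] at this
      refine Eq.trans ?_ this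
      refine integral_congr_ae (Eventually.of_forall fun t => ?_)
      simp only [in1, in2]
      have d1 : ∀ x, deriv (fun s => χ x * ψ s) t = χ x * deriv ψ t := fun x =>
        deriv_const_mul_field (χ x)
      have d2 : ∀ x, deriv (fun y => χ y * ψ t) x = deriv χ x * ψ t := fun x =>
        deriv_mul_const_field (ψ t)
      simp only [d1, d2]
      have : ∀ x, (U t : ℝ → ℝ) x * (χ x * deriv ψ t) + (W t : ℝ → ℝ) x * (deriv χ x * ψ t)
          + g * (χ x * ψ t) - (H t : ℝ → ℝ) x * (χ x * ψ t)
          = deriv ψ t * ((U t : ℝ → ℝ) x * χ x) + ψ t * ((W t : ℝ → ℝ) x * deriv χ x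
            + g * χ x - (H t : ℝ → ℝ) x * χ x) := fun x => by ring
      simp only [this]
      have i3 : Integrable (fun x => (W t : ℝ → ℝ) x * deriv χ x + g * χ x) muI :=
        (ii2 _).add (hχi.const_mul g)
      have i4 : Integrable (fun x => (W t : ℝ → ℝ) x * deriv χ x + g * χ x
        - (H t : ℝ → ℝ) x * χ x) muI := i3.sub (ii1 _)
      rw [integral_add ((ii1 _).const_mul _) (i4.const_mul _), integral_const_mul,
        integral_const_mul, integral_sub i3 (ii1 _), integral_add (ii2 _) (hχi.const_mul g),
        integral_const_mul]
      ring
  have h1 := key (show t ∈ Ici 0 from ht)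
  simp only [in2] at h1
  rw [← in1, inner_add_left, h1]
  ring

/-! ### From curves in `L²(0,1)` to ordinary differential equations at almost every point -/

/-- The fundamental theorem of calculus for a curve in `L²(0,1)`, pointwise almost everywhere in
`x`: both sides have the same integral over each measurable set, by Fubini's theorem. -/
theorem ae_eq_add_integral {R R' : ℝ → L2I}
    (hR : ∀ t, 0 ≤ t → HasDerivWithinAt R (R' t) (Ici 0) t) (hR' : ContinuousOn R' (Ici 0))
    {q : ℝ → ℝ → ℝ} (hq : Measurable (Function.uncurry q))
    (h : ∀ᵐ t ∂(volume.restrict (Ici (0 : ℝ))), ∀ᵐ x ∂muI, (R' t : ℝ → ℝ) x = q x t)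
    {T B : ℝ} (hT : 0 ≤ T) (hB : ∀ x ∈ Ioo (0 : ℝ) 1, ∀ t ∈ Ioc 0 T, |q x t| ≤ B) :
    ∀ᵐ x ∂muI, (R T : ℝ → ℝ) x = (R 0 : ℝ → ℝ) x + ∫ t in Ioc 0 T, q x t := by
  have hI : Integrable (Function.uncurry q) (muI.prod (volume.restrict (Ioc 0 T))) := by
    refine Integrable.of_bound hq.aestronglyMeasurable B ?_
    rw [Measure.prod_restrict]
    filter_upwards [ae_restrict_mem (measurableSet_Ioo.prod measurableSet_Ioc)] with p hp
    exact hB p.1 hp.1 p.2 hp.2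
  have hi : Integrable (fun x => ∫ t in Ioc 0 T, q x t) muI := hI.integral_prod_left
  refine Integrable.ae_eq_of_forall_setIntegral_eq (R T : ℝ → ℝ)
    (fun x => (R 0 : ℝ → ℝ) x + ∫ t in Ioc 0 T, q x t) (integrable_coe _)
    ((integrable_coe _).add hi) fun E hE _ => ?_
  have hI' : Integrable (Function.uncurry q)
      ((muI.restrict E).prod (volume.restrict (Ioc 0 T))) :=
    hI.mono_measure (Measure.prod_mono Measure.restrict_le_self le_rfl)
  rw [integral_add (integrable_coe _).restrict hi.restrict, integral_integral_swap hI']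
  have hin := fun k : L2I => L2.inner_indicatorConstLp_one (𝕜 := ℝ) hE (measure_ne_top muI E) k
  have hd : ∀ t, 0 ≤ t → HasDerivWithinAt
      (fun t => inner ℝ (indicatorConstLp 2 hE (measure_ne_top muI E) (1 : ℝ)) (R t))
      (inner ℝ (indicatorConstLp 2 hE (measure_ne_top muI E) (1 : ℝ)) (R' t)) (Ici 0) t :=
    fun t ht => by simpa using (hasDerivWithinAt_const t (Ici 0) _).inner ℝ (hR t ht)
  have hftc := intervalIntegral.integral_eq_sub_of_hasDerivAt_of_le hT
    (fun t ht => ((hd t ht.1).mono Icc_subset_Ici_self).continuousWithinAt)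
    (fun t ht => (hd t ht.1.le).hasDerivAt (Ici_mem_nhds ht.1))
    (ContinuousOn.intervalIntegrable (by
      rw [uIcc_of_le hT]
      exact continuousOn_const.inner (hR'.mono Icc_subset_Ici_self)))
  rw [intervalIntegral.integral_of_le hT] at hftc
  simp only [hin] at hftc
  have hq' : ∫ t in Ioc 0 T, (∫ x in E, (R' t : ℝ → ℝ) x ∂muI) =
      ∫ t in Ioc 0 T, ∫ x in E, q x t ∂muI := by
    refine integral_congr_ae ?_
    filter_upwards [ae_mono (Measure.restrict_mono
      (Ioc_subset_Icc_self.trans Icc_subset_Ici_self) le_rfl) h] with t ht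
    exact integral_congr_ae (ae_restrict_of_ae ht)
  rw [hq'] at hftc
  linarith

/-- A curve in `L²(0,1)` that solves a continuous differential equation, whose forcing is the
primitive of a continuous curve, solves this equation pointwise for almost every `x`, after a
modification on null sets. -/
theorem exists_pointwise_solution {Φ : ℝ × ℝ × ℝ → ℝ} (hΦ : Continuous Φ) {R R' K : ℝ → L2I}
    (hR : ∀ t, 0 ≤ t → HasDerivWithinAt R (R' t) (Ici 0) t) (hR' : ContinuousOn R' (Ici 0))
    (hK : ContinuousOn K (Ici 0)) {n : ℝ → ℝ → ℝ} (hn : AEStronglyMeasurable (Function.uncurry n)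
      (volume.restrict (Icc (0 : ℝ) 1 ×ˢ Ici (0 : ℝ)))) (hRn : IsCurveOf R n) {M : ℝ} (hM : 0 ≤ M)
    (hb : ∀ t, 0 ≤ t → ∀ᵐ x ∂muI, n x t ∈ Icc 0 M)
    (h : ∀ᵐ t ∂(volume.restrict (Ici (0 : ℝ))), ∀ᵐ x ∂muI,
      (R' t : ℝ → ℝ) x = Φ (x, n x t, prim (K t) x)) :
    ∃ m : ℝ → ℝ → ℝ, (∀ t, Measurable fun x => m x t) ∧
      (∀ t, 0 ≤ t → ∀ᵐ x ∂muI, n x t = m x t) ∧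
      ∀ᵐ x ∂muI, ∀ t, 0 ≤ t → m x t ∈ Icc 0 M ∧
        HasDerivWithinAt (m x) (Φ (x, m x t, prim (K t) x)) (Ici 0) t := by
  -- a jointly measurable version of `n` with values in `[0, M]`
  obtain ⟨w, hwm, hwM, hwn⟩ : ∃ w : ℝ × ℝ → ℝ, Measurable w ∧ (∀ p, w p ∈ Icc 0 M) ∧
      ∀ᵐ t ∂(volume.restrict (Ici (0 : ℝ))), ∀ᵐ x ∂muI, n x t = w (x, t) := by
    refine ⟨fun p => max 0 (min (hn.mk _ p) M),
      measurable_const.max (hn.stronglyMeasurable_mk.measurable.min measurable_const),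
      fun p => ⟨le_max_left _ _, max_le hM (min_le_right _ _)⟩, ?_⟩
    filter_upwards [ae_ae_of_ae_restrict_prod hn.ae_eq_mk, ae_restrict_mem measurableSet_Ici]
      with t ht ht0
    filter_upwards [ht, hb t ht0] with x hx hx'
    have hx2 : hn.mk _ (x, t) = n x t := hx.symm
    rw [hx2, min_eq_left hx'.2, max_eq_right hx'.1]
  set A : ℝ → ℝ → ℝ := fun t x => prim (K (max t 0)) x with hA
  have hAc : ∀ x, Continuous fun t => A t x := fun x =>
    (continuousOn_prim hK x).comp_continuous (by fun_prop) fun t => le_max_right t 0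
  have hAm : Measurable (Function.uncurry A) :=
    measurable_uncurry_of_continuous_of_measurable hAc fun t => measurable_prim _
  set q : ℝ → ℝ → ℝ := fun x t => Φ (x, w (x, t), A t x) with hq
  have hqm : Measurable (Function.uncurry q) := hΦ.measurable.comp
    (measurable_fst.prodMk (hwm.prodMk (hAm.comp measurable_swap)))
  have hbound : ∀ T, ∃ B, ∀ x ∈ Ioo (0 : ℝ) 1, ∀ t ∈ Ioc 0 T, |q x t| ≤ B := fun T => by
    obtain ⟨N, hN⟩ := (isCompact_Icc (a := 0) (b := T)).exists_bound_of_continuousOn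
      (hK.mono Icc_subset_Ici_self)
    obtain ⟨B, hB⟩ := (isCompact_Icc (a := (0 : ℝ)) (b := 1)).prod
      ((isCompact_Icc (a := 0) (b := M)).prod (isCompact_Icc (a := -N) (b := N)))
      |>.exists_bound_of_continuousOn hΦ.continuousOn
    refine ⟨B, fun x hx t ht => hB _ ⟨Ioo_subset_Icc_self hx, hwM _, ?_⟩⟩
    rw [mem_Icc, ← abs_le]
    have := hN t (Ioc_subset_Icc_self ht)
    simp only [hA, max_eq_left ht.1.le]
    have h2 : √x ≤ 1 := Real.sqrt_le_one.2 hx.2.le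
    exact (abs_prim_le _ hx).trans (by nlinarith [norm_nonneg (K t)])
  have hR'q : ∀ᵐ t ∂(volume.restrict (Ici (0 : ℝ))), ∀ᵐ x ∂muI, (R' t : ℝ → ℝ) x = q x t := by
    filter_upwards [h, hwn, ae_restrict_mem measurableSet_Ici] with t h1 h2 h3
    filter_upwards [h1, h2] with x h4 h5
    simp only [hq, hA, max_eq_left (show (0 : ℝ) ≤ t from h3), h4, h5]
  set m : ℝ → ℝ → ℝ := fun x t => (R 0 : ℝ → ℝ) x + ∫ r in Ioc 0 t, q x r with hm
  have hmm : Measurable (Function.uncurry m) := by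
    have h1 : MeasurableSet {p : (ℝ × ℝ) × ℝ | p.2 ∈ Ioc 0 p.1.2} :=
      (measurableSet_lt measurable_const measurable_snd).inter
        (measurableSet_le measurable_snd (measurable_snd.comp measurable_fst))
    have h2 : StronglyMeasurable fun p : (ℝ × ℝ) × ℝ =>
        {p : (ℝ × ℝ) × ℝ | p.2 ∈ Ioc 0 p.1.2}.indicator (fun p => q p.1.1 p.2) p :=
      (Measurable.indicator (hqm.comp ((measurable_fst.comp measurable_fst).prodMk measurable_snd))
        h1).stronglyMeasurable
    have h3 := (h2.integral_prod_right' (ν := (volume : Measure ℝ))).measurable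
    have h4 : Function.uncurry m = fun p : ℝ × ℝ => (R 0 : ℝ → ℝ) p.1 + ∫ r,
        {p : (ℝ × ℝ) × ℝ | p.2 ∈ Ioc 0 p.1.2}.indicator (fun p => q p.1.1 p.2) (p, r) := by
      funext p
      simp only [hm, Function.uncurry]
      rw [← integral_indicator measurableSet_Ioc]
      rfl
    rw [h4]
    exact ((Lp.stronglyMeasurable (R 0)).measurable.comp measurable_fst).add h3
  have hnm : ∀ t, 0 ≤ t → ∀ᵐ x ∂muI, n x t = m x t := fun t ht => by
    obtain ⟨B, hB⟩ := hbound t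
    filter_upwards [hRn t ht, ae_eq_add_integral hR hR' hqm hR'q ht hB] with x h1 h2
    rw [← h1, h2]
  refine ⟨m, fun t => hmm.comp (measurable_id.prodMk measurable_const), hnm, ?_⟩
  have hmw : ∀ᵐ x ∂muI, ∀ᵐ t ∂(volume.restrict (Ici (0 : ℝ))), m x t = w (x, t) := by
    refine (Measure.ae_ae_comm (p := fun x t => m x t = w (x, t))
      (measurableSet_eq_fun hmm hwm)).2 ?_
    filter_upwards [hwn, ae_restrict_mem measurableSet_Ici] with t h1 h2
    filter_upwards [h1, hnm t h2] with x h3 h4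
    exact h4.symm.trans h3
  filter_upwards [hmw, ae_restrict_mem measurableSet_Ioo] with x hx hx01
  have hqx : Measurable (q x) := hqm.comp (measurable_const.prodMk measurable_id)
  have hqi : ∀ T, IntegrableOn (q x) (Icc 0 T) := fun T => by
    obtain ⟨B, hB⟩ := hbound T
    rw [integrableOn_Icc_iff_integrableOn_Ioc]
    refine Integrable.of_bound hqx.aestronglyMeasurable B ?_
    filter_upwards [ae_restrict_mem measurableSet_Ioc] with t ht using hB x hx01 t ht
  have hmc : ContinuousOn (m x) (Ici 0) := fun t ht => by
    have h1 := (intervalIntegral.continuousOn_primitive (hqi (t + 1))).const_add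
      ((R 0 : ℝ → ℝ) x)
    refine (h1 t ⟨ht, by linarith⟩).mono_of_mem_nhdsWithin ?_
    exact mem_nhdsWithin.2 ⟨Iio (t + 1), isOpen_Iio, by simp, fun r hr => ⟨hr.2, hr.1.le⟩⟩
  have hmem : ∀ t ∈ Ici (0 : ℝ), m x t ∈ Icc 0 M := by
    -- truncation leaves the continuous function `m x` unchanged almost everywhere
    have hcl : ContinuousOn (fun t => max 0 (min (m x t) M)) (Ici 0) :=
      continuousOn_const.sup (hmc.inf continuousOn_const)
    have h1 : EqOn (fun t => max 0 (min (m x t) M)) (m x) (Ioi 0) := by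
      refine Measure.eqOn_open_of_ae_eq (μ := volume) ?_ isOpen_Ioi (hcl.mono Ioi_subset_Ici_self)
        (hmc.mono Ioi_subset_Ici_self)
      filter_upwards [ae_mono (Measure.restrict_mono Ioi_subset_Ici_self le_rfl) hx] with t ht
      rw [ht, min_eq_left (hwM _).2, max_eq_right (hwM _).1]
    have h2 := h1.of_subset_closure hcl hmc Ioi_subset_Ici_self (by rw [closure_Ioi])
    intro t ht
    rw [← h2 ht]
    exact ⟨le_max_left _ _, max_le hM (min_le_right _ _)⟩
  set p : ℝ → ℝ := fun t => Φ (x, m x (max t 0), A t x) with hp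
  have hpc : Continuous p := by
    have h1 : Continuous fun t => m x (max t 0) :=
      hmc.comp_continuous (by fun_prop) fun t => le_max_right t 0
    exact hΦ.comp (continuous_const.prodMk (h1.prodMk (hAc x)))
  have hmp : ∀ t, 0 ≤ t → m x t = (R 0 : ℝ → ℝ) x + ∫ r in (0 : ℝ)..t, p r := fun t ht => by
    rw [intervalIntegral.integral_of_le ht]
    refine congrArg ((R 0 : ℝ → ℝ) x + ·) ?_
    refine integral_congr_ae ?_
    filter_upwards [ae_mono (Measure.restrict_mono
      (Ioc_subset_Icc_self.trans Icc_subset_Ici_self) le_rfl) hx,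
      ae_restrict_mem measurableSet_Ioc] with r h1 h2
    simp only [hq, hp, max_eq_left h2.1.le, h1]
  intro t ht
  refine ⟨hmem t ht, ?_⟩
  have hd := (intervalIntegral.integral_hasDerivAt_right (hpc.intervalIntegrable 0 t)
    (hpc.stronglyMeasurableAtFilter _ _) hpc.continuousAt).const_add ((R 0 : ℝ → ℝ) x)
  have e : p t = Φ (x, m x t, prim (K t) x) := by simp only [hp, hA, max_eq_left ht]
  rw [← e]
  exact hd.hasDerivWithinAt.congr (fun r hr => hmp r hr) (hmp t ht)

/-! ### From weak solutions to solutions in relaxation form -/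

theorem HasWeakDeriv.ae_eq {v v' w w' : ℝ → ℝ} (h : HasWeakDeriv v w) (h' : HasWeakDeriv v' w')
    (hv : v =ᵐ[muI] v') : w =ᵐ[muI] w' := by
  have key : ∀ᵐ x ∂(volume : Measure ℝ), x ∈ Ioo (0 : ℝ) 1 → (w - w') x = 0 := by
    refine isOpen_Ioo.ae_eq_zero_of_integral_contDiff_smul_eq_zero (h.2.1.sub h'.2.1)
      fun φ h1 h2 h3 => ?_
    have hi : ∀ f : ℝ → ℝ, LocallyIntegrableOn f (Ioo 0 1) →
        Integrable (fun x => f x * φ x) muI := fun f hf => by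
      obtain ⟨M, hM⟩ := h1.continuous.bounded_above_of_compact_support h2
      have h4 : IntegrableOn (fun x => f x * φ x) (tsupport φ) :=
        Integrable.mul_bdd (hf.integrableOn_compact_subset h3 h2.isCompact)
          h1.continuous.aestronglyMeasurable (Eventually.of_forall hM)
      refine Integrable.restrict
        ((integrableOn_iff_integrable_of_support_subset fun x hx => ?_).1 h4)
      exact subset_tsupport _ (right_ne_zero_of_mul hx)
    rw [← setIntegral_eq_integral_of_forall_compl_eq_zero (s := Ioo (0 : ℝ) 1) fun x hx => by
      simp [image_eq_zero_of_notMem_tsupport fun h' => hx (h3 h')]]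
    have e1 := h.2.2 φ h1 h2 h3
    have e2 := h'.2.2 φ h1 h2 h3
    have e3 : ∫ x in Ioo (0 : ℝ) 1, v x * deriv φ x = ∫ x in Ioo (0 : ℝ) 1, v' x * deriv φ x :=
      integral_congr_ae (by filter_upwards [hv] with x hx; rw [hx])
    have : ∀ x, φ x • (w - w') x = w x * φ x - w' x * φ x := fun x => by
      simp only [smul_eq_mul, Pi.sub_apply]; ring
    simp only [this]
    rw [integral_sub (hi w h.2.1) (hi w' h'.2.1)]
    linarith
  rw [EventuallyEq, ae_restrict_iff' measurableSet_Ioo]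
  filter_upwards [key] with x hx hx'
  exact sub_eq_zero.1 (hx hx')

theorem neBot_nhdsLT_inf_ae (x : ℝ) : (𝓝[<] x ⊓ ae (volume : Measure ℝ)).NeBot := by
  rw [inf_neBot_iff]
  intro s hs t ht
  obtain ⟨y, hy, hys⟩ := mem_nhdsLT_iff_exists_Ioo_subset.1 hs
  by_contra hne
  rw [not_nonempty_iff_eq_empty] at hne
  have : volume (Ioo y x) = 0 := by
    refine measure_mono_null ?_ (mem_ae_iff.1 ht)
    intro z hz hzt
    exact (hne ▸ (⟨hys hz, hzt⟩ : z ∈ s ∩ t) : z ∈ (∅ : Set ℝ))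
  simp at this
  exact absurd hy (not_lt.2 this)

/-- A function that vanishes at the wall `x = 1` is the tail integral of its weak derivative. -/
theorem ae_eq_neg_tail {v w q : ℝ → ℝ} (hv : Integrable v muI) (hq : Integrable q muI)
    (h : HasWeakDeriv v w) (hwq : w =ᵐ[muI] q)
    (hlim : Tendsto v (𝓝[<] 1 ⊓ ae volume) (𝓝 0)) :
    ∀ᵐ x ∂muI, v x = -∫ y in Ioi x, q y ∂muI := by
  have htail : ∀ x ∈ Icc (0 : ℝ) 1, ∫ y in Ioi x, q y ∂muI = (∫ y, q y ∂muI) -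
      ∫ y in Ioc 0 x, q y := by
    intro x hx
    have h1 := integral_add_compl (measurableSet_Iic (a := x)) hq
    have h2 : ∫ y in Iic x ∩ Ioo 0 1, q y = ∫ y in Ioc 0 x, q y := by
      rcases hx.2.lt_or_eq with hx1 | rfl
      · congr 2
        ext y
        simp only [mem_inter_iff, mem_Iic, mem_Ioo, mem_Ioc]
        constructor
        · rintro ⟨h1, h2, h3⟩; exact ⟨h2, h1⟩
        · rintro ⟨h1, h2⟩; exact ⟨h2, h1, h2.trans_lt hx1⟩
      · rw [integral_Ioc_eq_integral_Ioo, inter_eq_right.2 fun y hy => hy.2.le]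
    rw [compl_Iic, Measure.restrict_restrict measurableSet_Iic, h2] at h1
    linarith
  have hqI : IntegrableOn q (Icc 0 1) := by
    rw [integrableOn_Icc_iff_integrableOn_Ioo]; exact hq
  have hc : ContinuousOn (fun x => ∫ y in Ioi x, q y ∂muI) (Icc 0 1) :=
    (continuousOn_const.sub (intervalIntegral.continuousOn_primitive hqI)).congr htail
  have h1 : ∫ y in Ioi (1 : ℝ), q y ∂muI = 0 := by
    rw [Measure.restrict_restrict measurableSet_Ioi]
    have : Ioi (1 : ℝ) ∩ Ioo 0 1 = ∅ := by
      ext y; simp only [mem_inter_iff, mem_Ioi, mem_Ioo, mem_empty_iff_false, iff_false]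
      rintro ⟨h1, h2, h3⟩; linarith
    simp [this]
  have hti : Integrable (fun x => ∫ y in Ioi x, q y ∂muI) muI :=
    (hc.integrableOn_Icc (μ := volume)).mono_set Ioo_subset_Icc_self
  obtain ⟨C, hC⟩ := exists_ae_eq_const (hv.add hti) fun φ h1 h2 h3 => by
    have hd : Continuous (deriv φ) := h1.continuous_deriv (by simp)
    obtain ⟨M, hM⟩ := hd.bounded_above_of_compact_support h2.deriv
    have hid : Integrable (deriv φ) muI :=
      (hd.integrable_of_hasCompactSupport h2.deriv).restrict
    have hφ0 : φ 0 = 0 := image_eq_zero_of_notMem_tsupport fun h => lt_irrefl (0 : ℝ) (h3 h).1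
    have e1 := h.2.2 φ h1 h2 h3
    have e2 := integral_tail_mul hq hid
    have e3 : ∫ y, q y * ∫ x in Iio y, deriv φ x ∂muI ∂muI = ∫ y, w y * φ y ∂muI := by
      refine integral_congr_ae ?_
      filter_upwards [ae_restrict_mem measurableSet_Ioo, hwq] with y hy hy'
      have : Iio y ∩ Ioo 0 1 = Ioo 0 y := by
        ext z
        simp only [mem_inter_iff, mem_Iio, mem_Ioo]
        constructor
        · rintro ⟨h1, h2, h3⟩; exact ⟨h2, h1⟩
        · rintro ⟨h1, h2⟩; exact ⟨h2, h1, h2.trans hy.2⟩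
      rw [Measure.restrict_restrict measurableSet_Iio, this, ← integral_Ioc_eq_integral_Ioo,
        ← intervalIntegral.integral_of_le hy.1.le, intervalIntegral.integral_deriv_eq_sub, hφ0,
        sub_zero, hy']
      · exact fun x _ => (h1.differentiable (by simp)).differentiableAt
      · exact hd.intervalIntegrable _ _
    simp only [Pi.add_apply, add_mul]
    rw [integral_add (hv.mul_bdd hd.aestronglyMeasurable (Eventually.of_forall hM))
      (hti.mul_bdd hd.aestronglyMeasurable (Eventually.of_forall hM)), e1, e2, e3]
    exact neg_add_cancel _
  have hC0 : C = 0 := by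
    have := neBot_nhdsLT_inf_ae 1
    have h2 : Tendsto (fun x => v x + ∫ y in Ioi x, q y ∂muI) (𝓝[<] 1 ⊓ ae volume) (𝓝 (0 + 0)) := by
      refine hlim.add (Tendsto.mono_left ?_ inf_le_left)
      have h3 := (hc 1 ⟨zero_le_one, le_rfl⟩).tendsto
      rw [h1] at h3
      refine h3.mono_left ?_
      rw [← nhdsWithin_Ioo_eq_nhdsLT (zero_lt_one (α := ℝ))]
      exact nhdsWithin_mono _ Ioo_subset_Icc_self
    rw [add_zero] at h2
    have h4 : ∀ᶠ x in 𝓝[<] (1 : ℝ) ⊓ ae volume, v x + ∫ y in Ioi x, q y ∂muI = C := by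
      rw [ae_restrict_iff' measurableSet_Ioo] at hC
      have h5 : Ioo (0 : ℝ) 1 ∈ 𝓝[<] (1 : ℝ) := Ioo_mem_nhdsLT zero_lt_one
      filter_upwards [mem_inf_of_left h5, mem_inf_of_right hC] with x hx hx' using hx' hx
    exact tendsto_nhds_unique (tendsto_const_nhds.congr' (h4.mono fun x hx => hx.symm)) h2
  filter_upwards [hC] with x hx
  simp only [Pi.add_apply, hC0] at hx
  linarith

theorem friction_nonneg {f ρ q : ℝ} (hf : 0 ≤ f) : 0 ≤ friction f ρ q := by
  unfold friction; positivity

theorem friction_le {f ρ q : ℝ} (hf : 0 ≤ f) (hq : 0 ≤ q) : friction f ρ q ≤ f * ρ ^ 2 := by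
  unfold friction
  refine mul_le_of_le_one_right (by positivity) ?_
  rw [div_le_one (by positivity)]
  gcongr
  linarith

theorem continuous_friction_comp (f ρ c : ℝ) (hc : 0 ≤ c) :
    Continuous fun p : ℝ × ℝ => friction f ρ (|p.1| / c) * p.2 * |p.2| := by
  unfold friction
  have : ∀ p : ℝ × ℝ, (1 + |p.1| / c) ^ 2 ≠ 0 := fun p => by positivity
  fun_prop (disch := assumption)

/-- The relation between the viscous flux and `Q² u_x`; it persists in vacuum. -/
theorem rpow_mul_viscousFlux {θ c q : ℝ} (hθ : 0 < θ) (hc : 0 < c) (hq : 0 ≤ q) (v : ℝ) :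
    (c * q) ^ (1 - θ) * viscousFlux θ c q v = c * q ^ 2 * v := by
  unfold viscousFlux
  rcases hq.eq_or_lt with rfl | hq
  · rw [Real.zero_rpow (by positivity)]; ring
  · rw [Real.mul_rpow hc.le hq.le, ← Real.rpow_two]
    have h1 : c ^ (1 - θ) * c ^ θ = c := by
      rw [← Real.rpow_add hc]; simp
    have h2 : q ^ (1 - θ) * q ^ (1 + θ) = q ^ (2 : ℝ) := by
      rw [← Real.rpow_add hq]; ring_nf
    calc _ = (c ^ (1 - θ) * c ^ θ) * (q ^ (1 - θ) * q ^ (1 + θ)) * v := by ring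
      _ = _ := by rw [h1, h2]

theorem viscousFlux_eq {θ c q : ℝ} (hc : 0 < c) (hq : 0 ≤ q) (v : ℝ) :
    viscousFlux θ c q v = (c * q) ^ (1 + θ) / c * v := by
  unfold viscousFlux
  rw [Real.mul_rpow hc.le hq, Real.rpow_add hc, Real.rpow_one]
  field_simp

theorem InitialBounds.c_pos {γ α C₁ C₂ C₃ C₄ : ℝ} {c₀ Q₀ : ℝ → ℝ}
    (h : InitialBounds γ α C₁ C₂ C₃ C₄ c₀ Q₀) (hC₃ : 0 < C₃) {x : ℝ} (hx : x ∈ Ioc (0 : ℝ) 1) :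
    0 < c₀ x :=
  (mul_pos hC₃ (Real.rpow_pos_of_pos hx.1 _)).trans_le (h x hx).2.2.1

theorem InitialBounds.c_le {γ α C₁ C₂ C₃ C₄ : ℝ} {c₀ Q₀ : ℝ → ℝ}
    (h : InitialBounds γ α C₁ C₂ C₃ C₄ c₀ Q₀) (hα : 0 ≤ α) (hC₄ : 0 < C₄) {x : ℝ}
    (hx : x ∈ Ioc (0 : ℝ) 1) : c₀ x ≤ C₄ := by
  have h1 := (h x hx).2.2.2
  have h2 : x ^ α ≤ 1 := Real.rpow_le_one hx.1.le hx.2 hα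
  nlinarith

/-- The curve of friction forces in `L²(0,1)`. -/
theorem exists_friction_curve {f ρ M : ℝ} (hf : 0 ≤ f) {c₀ : ℝ → ℝ}
    (hc : AEMeasurable c₀ muI) (hc0 : ∀ᵐ x ∂muI, 0 < c₀ x) {R U : ℝ → L2I}
    (hR : ContinuousOn R (Ici 0)) (hU : ContinuousOn U (Ici 0))
    (hUM : ∀ t, 0 ≤ t → ∀ᵐ x ∂muI, |(U t : ℝ → ℝ) x| ≤ M) :
    ∃ H : ℝ → L2I, ContinuousOn H (Ici 0) ∧ ∀ t, 0 ≤ t → ∀ᵐ x ∂muI, (H t : ℝ → ℝ) x =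
      friction f ρ (|(R t : ℝ → ℝ) x| / c₀ x) * (U t : ℝ → ℝ) x * |(U t : ℝ → ℝ) x| := by
  have hex : ∀ t, ∃ k : L2I, 0 ≤ t → (∀ᵐ x ∂muI, (k : ℝ → ℝ) x =
      friction f ρ (|(R t : ℝ → ℝ) x| / c₀ x) * (U t : ℝ → ℝ) x * |(U t : ℝ → ℝ) x|) ∧
      ∀ᵐ x ∂muI, |(k : ℝ → ℝ) x| ≤ f * ρ ^ 2 * M ^ 2 := by
    intro t
    by_cases ht : 0 ≤ t
    swap
    · exact ⟨0, fun h => absurd h ht⟩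
    have hb : ∀ᵐ x ∂muI, |(friction f ρ (|(R t : ℝ → ℝ) x| / c₀ x) * (U t : ℝ → ℝ) x
        * |(U t : ℝ → ℝ) x| : ℝ)| ≤ f * ρ ^ 2 * M ^ 2 := by
      filter_upwards [hUM t ht, hc0] with x h1 h2
      rw [abs_mul, abs_mul, abs_abs, abs_of_nonneg (friction_nonneg hf), mul_assoc]
      have h3 := friction_le (ρ := ρ) hf (show 0 ≤ |(R t : ℝ → ℝ) x| / c₀ x by positivity)
      rw [sq M]
      have h4 : 0 ≤ M := (abs_nonneg _).trans h1
      gcongr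
    have hm : MemLp (fun x => friction f ρ (|(R t : ℝ → ℝ) x| / c₀ x) * (U t : ℝ → ℝ) x
        * |(U t : ℝ → ℝ) x|) 2 muI := by
      refine MemLp.of_bound (AEMeasurable.aestronglyMeasurable ?_) _ hb
      have h1 : AEMeasurable (R t : ℝ → ℝ) muI := (Lp.stronglyMeasurable _).measurable.aemeasurable
      have h2 : AEMeasurable (U t : ℝ → ℝ) muI := (Lp.stronglyMeasurable _).measurable.aemeasurable
      unfold friction
      fun_prop
    refine ⟨hm.toLp _, fun _ => ⟨hm.coeFn_toLp, ?_⟩⟩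
    filter_upwards [hm.coeFn_toLp, hb] with x h1 h2
    rwa [h1]
  choose H hH using hex
  refine ⟨H, ?_, fun t ht => (hH t ht).1⟩
  refine continuousOn_superposition (N := fun x r v => friction f ρ (|r| / c₀ x) * v * |v|) hR hU
    ?_ (fun t ht => (hH t ht).1) (fun t ht => (hH t ht).2)
  filter_upwards [hc0] with x hx using continuous_friction_comp f ρ _ hx.le

/-- The curve of pressures in `L²(0,1)`. -/
theorem exists_pressure_curve {γ M : ℝ} (hγ : 0 < γ) {R : ℝ → L2I}
    (hR : ContinuousOn R (Ici 0)) (hRM : ∀ t, 0 ≤ t → ∀ᵐ x ∂muI, (R t : ℝ → ℝ) x ∈ Icc 0 M) :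
    ∃ W : ℝ → L2I, ContinuousOn W (Ici 0) ∧
      ∀ t, 0 ≤ t → ∀ᵐ x ∂muI, (W t : ℝ → ℝ) x = (R t : ℝ → ℝ) x ^ γ := by
  have hex : ∀ t, ∃ k : L2I, 0 ≤ t → (∀ᵐ x ∂muI, (k : ℝ → ℝ) x = (R t : ℝ → ℝ) x ^ γ) ∧
      ∀ᵐ x ∂muI, |(k : ℝ → ℝ) x| ≤ M ^ γ := by
    intro t
    by_cases ht : 0 ≤ t
    swap
    · exact ⟨0, fun h => absurd h ht⟩
    have hb : ∀ᵐ x ∂muI, |(R t : ℝ → ℝ) x ^ γ| ≤ M ^ γ := by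
      filter_upwards [hRM t ht] with x h1
      rw [abs_of_nonneg (Real.rpow_nonneg h1.1 _)]
      exact Real.rpow_le_rpow h1.1 h1.2 hγ.le
    have hm : MemLp (fun x => (R t : ℝ → ℝ) x ^ γ) 2 muI := by
      refine MemLp.of_bound (AEMeasurable.aestronglyMeasurable ?_) _ hb
      exact (Lp.stronglyMeasurable _).measurable.aemeasurable.pow_const _
    refine ⟨hm.toLp _, fun _ => ⟨hm.coeFn_toLp, ?_⟩⟩
    filter_upwards [hm.coeFn_toLp, hb] with x h1 h2
    rwa [h1]
  choose W hW using hex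
  refine ⟨W, ?_, fun t ht => (hW t ht).1⟩
  refine continuousOn_superposition (N := fun _ r _ => r ^ γ) hR hR
    (Eventually.of_forall fun x => ?_) (fun t ht => (hW t ht).1) (fun t ht => (hW t ht).2)
  exact continuous_fst.rpow_const fun _ => Or.inr hγ.le

theorem Params.flux_eq (P : Params) {x m : ℝ} (hx : 0 < x) (hm : 0 ≤ m) (a : ℝ) :
    P.g * x * ((m / P.ℓ x) ^ P.γ - 1) + a = m ^ P.γ - P.g * x + a := by
  have hg := P.g_pos
  rw [Real.div_rpow hm (P.ℓ_pos hx).le, P.ℓ_rpow_γ hx]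
  field_simp

/-- The right-hand side of the differential equation for `cQ`, in terms of `s = cQ / ℓ`. -/
theorem Params.rhs_div (P : Params) {x m : ℝ} (hx : 0 < x) (hm : 0 ≤ m) (a : ℝ) :
    -(P.ρ * m ^ (1 - P.θ) * (m ^ P.γ - P.g * x + a)) / P.ℓ x =
      -(P.ρ * P.ℓ x ^ (-P.θ) * (m / P.ℓ x) ^ (1 - P.θ) *
        (P.g * x * ((m / P.ℓ x) ^ P.γ - 1) + a)) := by
  have hℓ := P.ℓ_pos hx
  have h1 : P.ℓ x ^ (1 - P.θ) = P.ℓ x * P.ℓ x ^ (-P.θ) := by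
    rw [sub_eq_add_neg, Real.rpow_add hℓ, Real.rpow_one]
  rw [P.flux_eq hx hm, Real.div_rpow hm hℓ.le, h1]
  have h2 : P.ℓ x ^ (-P.θ) ≠ 0 := (Real.rpow_pos_of_pos hℓ _).ne'
  field_simp

/-- The viscous flux determines the velocity gradient away from vacuum. -/
theorem Params.grad_eq (P : Params) {x c q v F : ℝ} (hx : 0 < x) (hc : 0 < c) (hq : 0 < c * q)
    (h : viscousFlux P.θ c q v = F) :
    v = c * P.ℓ x ^ (-(1 + P.θ)) * ((c * q / P.ℓ x) ^ (-(1 + P.θ)) * F) := by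
  have hℓ := P.ℓ_pos hx
  have hq' : 0 ≤ q := (pos_of_mul_pos_right hq hc.le).le
  rw [← h, viscousFlux_eq hc hq', Real.div_rpow hq.le hℓ.le, Real.rpow_neg hq.le]
  have h1 := (Real.rpow_pos_of_pos hℓ (-(1 + P.θ))).ne'
  have h2 := (Real.rpow_pos_of_pos hq (1 + P.θ)).ne'
  field_simp

/-- Weak solutions are solutions in relaxation form. -/
theorem exists_sol (P : Params) {f α C₁ C₂ C₃ : ℝ} {c₀ Q₀ u₀ : ℝ → ℝ} {Q u : ℝ → ℝ → ℝ}
    (hf : 0 ≤ f) (hα : 0 ≤ α) (hC₃ : 0 < C₃) (hk : f * P.ρ ^ 2 ≤ P.k)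
    (ha : P.a₀ * P.g ^ (1 / P.γ) ≤ C₁) (hb : C₂ ≤ P.b₀ * P.g ^ (1 / P.γ))
    (hdata : InitialBounds P.γ α C₁ C₂ C₃ P.κ c₀ Q₀)
    (h : IsWeakSolution P.γ P.θ P.g f P.ρ c₀ Q₀ u₀ Q u) :
    ∃ S : Sol P, (∀ x ∈ Ioo (0 : ℝ) 1, S.σ x = c₀ x * P.ℓ x ^ (-(1 + P.θ))) ∧
      (∀ t, 0 ≤ t → ∀ᵐ x ∂muI, c₀ x * Q x t = P.ℓ x * S.s x t) ∧
      (∀ t, 0 ≤ t → ∀ᵐ x ∂muI, (S.U t : ℝ → ℝ) x = u x t) ∧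
      (∀ᵐ x ∂muI, c₀ x * Q x 0 = c₀ x * Q₀ x) ∧ (∀ᵐ x ∂muI, u x 0 = u₀ x) ∧
      ∃ v, HasWeakDeriv (fun x => u x 0) v ∧
        ∀ᵐ x ∂muI, viscousFlux P.θ (c₀ x) (Q x 0) (v x) = S.F x 0 := by
  obtain ⟨ux, R, U, Fl, hc, hn0, hux, hnL, huL, hR, hRc, hU, hUc, hFL, hF, hFh, hode, hmom, hin,
    hiu, -, hbc⟩ := h
  have hudiff := uniqueDiffOn_Ici (0 : ℝ)
  set R' := derivWithin R (Ici 0) with hR'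
  set V := derivWithin U (Ici 0) with hV
  have hRd : ∀ t, 0 ≤ t → HasDerivWithinAt R (R' t) (Ici 0) t := fun t ht =>
    (hRc.differentiableOn one_ne_zero t ht).hasDerivWithinAt
  have hUd : ∀ t, 0 ≤ t → HasDerivWithinAt U (V t) (Ici 0) t := fun t ht =>
    (hUc.differentiableOn one_ne_zero t ht).hasDerivWithinAt
  have hR'c : ContinuousOn R' (Ici 0) := hRc.continuousOn_derivWithin hudiff le_rfl
  have hVc : ContinuousOn V (Ici 0) := hUc.continuousOn_derivWithin hudiff le_rfl
  have hFc : ContinuousOn Fl (Ici 0) := fun t ht => by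
    obtain ⟨K, hK⟩ := hFh (t + 1)
    refine (hK.continuousOn (by norm_num) t ⟨ht, by linarith⟩).mono_of_mem_nhdsWithin ?_
    exact mem_nhdsWithin.2 ⟨Iio (t + 1), isOpen_Iio, by simp, fun r hr => ⟨hr.2, hr.1.le⟩⟩
  obtain ⟨M, hM0, hM⟩ := hnL.exists_bound hR hRc.continuousOn
  obtain ⟨Mu, hMu0, hMu⟩ := huL.exists_bound hU hUc.continuousOn
  obtain ⟨MF, hMF0, hMF⟩ := hFL.exists_bound hF hFc
  have hcp : ∀ x ∈ Ioo (0 : ℝ) 1, 0 < c₀ x := fun x hx => hdata.c_pos hC₃ (Ioo_subset_Ioc_self hx)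
  have hI : ∀ᵐ x ∂muI, x ∈ Ioo (0 : ℝ) 1 := ae_restrict_mem measurableSet_Ioo
  have hcp' : ∀ᵐ x ∂muI, 0 < c₀ x := hI.mono hcp
  have hcc : ContinuousOn c₀ (Ioo 0 1) := hc.continuousOn.mono Ioo_subset_Ioc_self
  have hcm : AEMeasurable c₀ muI := hcc.aemeasurable measurableSet_Ioo
  have hnM : ∀ t, 0 ≤ t → ∀ᵐ x ∂muI, c₀ x * Q x t ∈ Icc 0 M := fun t ht => by
    filter_upwards [hn0 t ht, hM t ht] with x h1 h2 using ⟨h1, (le_abs_self _).trans h2⟩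
  have hQ : ∀ t, 0 ≤ t → ∀ᵐ x ∂muI, 0 ≤ Q x t := fun t ht => by
    filter_upwards [hn0 t ht, hcp'] with x h1 h2 using nonneg_of_mul_nonneg_right h1 h2
  obtain ⟨H, hHc, hH⟩ := exists_friction_curve (ρ := P.ρ) (M := Mu) hf hcm hcp' hRc.continuousOn
    hUc.continuousOn fun t ht => by
      filter_upwards [hU t ht, hMu t ht] with x h1 h2
      rwa [h1]
  obtain ⟨W, hWc, hW⟩ := exists_pressure_curve (γ := P.γ) (M := M) P.γ_pos hRc.continuousOn
    fun t ht => by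
      filter_upwards [hR t ht, hnM t ht] with x h1 h2
      rwa [h1]
  have hH' : ∀ t, 0 ≤ t → ∀ᵐ x ∂muI,
      (H t : ℝ → ℝ) x = friction f P.ρ (Q x t) * u x t * |u x t| := fun t ht => by
    filter_upwards [hH t ht, hR t ht, hU t ht, hQ t ht, hcp'] with x h1 h2 h3 h4 h5
    rw [h1, h2, h3, abs_of_nonneg (by positivity), mul_div_cancel_left₀ _ h5.ne']
  have hWF : ∀ t, 0 ≤ t → ∀ᵐ x ∂muI, ((W t - Fl t : L2I) : ℝ → ℝ) x =
      (c₀ x * Q x t) ^ P.γ - viscousFlux P.θ (c₀ x) (Q x t) (ux x t) := fun t ht => by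
    filter_upwards [hW t ht, hR t ht, hF t ht, Lp.coeFn_sub (W t) (Fl t)] with x h1 h2 h3 h4
    rw [h4, Pi.sub_apply, h1, h2, h3]
  -- the integrated momentum equation
  have hflux : ∀ t, 0 ≤ t → ∀ᵐ x ∂muI, viscousFlux P.θ (c₀ x) (Q x t) (ux x t) =
      (c₀ x * Q x t) ^ P.γ - P.g * x + prim (V t + H t) x := by
    have h1 := ae_eq_of_weak_momentum (g := P.g) (u₀ := u₀) (W := fun t => W t - Fl t) hUd hVc
      (hWc.sub hFc) hHc fun φ p1 p2 p3 => by
        refine Eq.trans (congrArg (· + _) ?_) (hmom φ p1 p2 p3)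
        refine setIntegral_congr_fun measurableSet_Ioi fun t ht => ?_
        have ht0 : 0 ≤ t := le_of_lt ht
        refine integral_congr_ae ?_
        filter_upwards [hU t ht0, hH' t ht0, hWF t ht0] with x h1 h2 h3
        rw [h1, h2, h3]
    intro t ht
    filter_upwards [h1 t ht, hWF t ht] with x h2 h3
    rw [h3] at h2
    linarith
  -- the mass equation
  have hR'n : ∀ᵐ t ∂(volume.restrict (Ici (0 : ℝ))), ∀ᵐ x ∂muI, (R' t : ℝ → ℝ) x =
      (fun p : ℝ × ℝ × ℝ => -(P.ρ * p.2.1 ^ (1 - P.θ) * (p.2.1 ^ P.γ - P.g * p.1 + p.2.2)))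
        (x, c₀ x * Q x t, prim (V t + H t) x) := by
    filter_upwards [hode, ae_restrict_mem measurableSet_Ici] with t h1 h2
    filter_upwards [h1, hflux t h2, hcp', hQ t h2] with x h3 h4 h5 h6
    have h7 := rpow_mul_viscousFlux P.θ_pos h5 h6 (ux x t)
    rw [← h4, mul_assoc, h7]
    field_simp at h3
    linarith
  have hΦ : Continuous fun p : ℝ × ℝ × ℝ =>
      -(P.ρ * p.2.1 ^ (1 - P.θ) * (p.2.1 ^ P.γ - P.g * p.1 + p.2.2)) := by
    have h1 : Continuous fun p : ℝ × ℝ × ℝ => p.2.1 ^ (1 - P.θ) :=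
      (continuous_fst.comp continuous_snd).rpow_const fun _ => Or.inr (sub_nonneg.2 P.θ_le_one)
    have h2 : Continuous fun p : ℝ × ℝ × ℝ => p.2.1 ^ P.γ :=
      (continuous_fst.comp continuous_snd).rpow_const fun _ => Or.inr P.γ_pos.le
    fun_prop
  obtain ⟨m, hmm, hnm, hmd⟩ := exists_pointwise_solution hΦ hRd hR'c (hVc.add hHc)
    hnL.aestronglyMeasurable hR hM0 hnM hR'n
  have hGae : ∀ᵐ x ∂muI, x ∈ {x | x ∈ Ioo (0 : ℝ) 1 ∧ m x 0 = c₀ x * Q₀ x ∧ ∀ t, 0 ≤ t →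
      m x t ∈ Icc 0 M ∧ HasDerivWithinAt (m x) (-(P.ρ * m x t ^ (1 - P.θ) *
        (m x t ^ P.γ - P.g * x + prim (V t + H t) x))) (Ici 0) t} := by
    filter_upwards [hI, hin, hnm 0 le_rfl, hmd] with x h1 h2 h3 h4 using ⟨h1, h3.symm.trans h2, h4⟩
  have hσle : ∀ x ∈ Ioo (0 : ℝ) 1, c₀ x * P.ℓ x ^ (-(1 + P.θ)) ≤ P.κ * P.ℓ x ^ (-(1 + P.θ)) :=
    fun x hx => mul_le_mul_of_nonneg_right
      (hdata.c_le hα P.κ_pos (Ioo_subset_Ioc_self hx)) (Real.rpow_pos_of_pos (P.ℓ_pos hx.1) _).le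
  have hσm : Measurable ((Ioo 0 1).indicator fun x => c₀ x * P.ℓ x ^ (-(1 + P.θ))) := by
    have h1 : Measurable ((Ioo (0 : ℝ) 1).indicator c₀) := by
      rw [← piecewise_eq_indicator]
      exact hcc.measurable_piecewise continuousOn_const measurableSet_Ioo
    have h2 := P.measurable_ℓ
    have h3 : ((Ioo (0 : ℝ) 1).indicator fun x => c₀ x * P.ℓ x ^ (-(1 + P.θ))) =
        fun x => (Ioo (0 : ℝ) 1).indicator c₀ x * P.ℓ x ^ (-(1 + P.θ)) :=
      funext fun x => indicator_mul_left _ _ _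
    rw [h3]
    fun_prop
  let S : Sol P :=
    { G := {x | x ∈ Ioo (0 : ℝ) 1 ∧ m x 0 = c₀ x * Q₀ x ∧ ∀ t, 0 ≤ t →
        m x t ∈ Icc 0 M ∧ HasDerivWithinAt (m x) (-(P.ρ * m x t ^ (1 - P.θ) *
          (m x t ^ P.γ - P.g * x + prim (V t + H t) x))) (Ici 0) t}
      σ := (Ioo 0 1).indicator fun x => c₀ x * P.ℓ x ^ (-(1 + P.θ))
      s := fun x t => m x t / P.ℓ x
      U := U
      V := V
      H := H
      G_sub := fun x hx => hx.1
      ae_G := hGae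
      σ_meas := hσm
      σ_nonneg := fun x => indicator_nonneg (fun x hx =>
        mul_nonneg (hcp x hx).le (Real.rpow_pos_of_pos (P.ℓ_pos hx.1) _).le) x
      σ_le := fun x hx => by rw [indicator_of_mem hx]; exact hσle x hx
      s_meas := fun t _ => ((hmm t).div P.measurable_ℓ).aemeasurable
      s_nonneg := fun x hx t ht => div_nonneg (hx.2.2 t ht).1.1 (P.ℓ_pos hx.1.1).le
      s_init := fun x hx => by
        have h1 := P.ℓ_pos hx.1.1
        have h2 := hdata x (Ioo_subset_Ioc_self hx.1)
        have h3 : P.ℓ x = P.g ^ (1 / P.γ) * x ^ (1 / P.γ) := by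
          simpa using P.ℓ_rpow hx.1.1 1
        have h4 : 0 < x ^ (1 / P.γ) := Real.rpow_pos_of_pos hx.1.1 _
        show m x 0 / P.ℓ x ∈ _
        rw [hx.2.1, mem_Icc, le_div_iff₀ h1, div_le_iff₀ h1, h3]
        constructor
        · nlinarith
        · nlinarith
      U_deriv := hUd
      V_cont := hVc
      H_cont := hHc
      H_le := fun t ht => by
        filter_upwards [hH' t ht, hU t ht, hQ t ht] with x h1 h2 h3
        rw [h1, h2, abs_mul, abs_mul, abs_abs, abs_of_nonneg (friction_nonneg hf), mul_assoc,
          ← sq, sq_abs]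
        gcongr
        exact (friction_le hf h3).trans hk
      UH_nonneg := fun t ht => by
        filter_upwards [hH' t ht, hU t ht] with x h1 h2
        rw [h1, h2]
        have := friction_nonneg (ρ := P.ρ) (q := Q x t) hf
        nlinarith [mul_nonneg (mul_nonneg this (abs_nonneg (u x t))) (sq_nonneg (u x t))]
      s_deriv := fun x hx t ht => by
        have h1 := ((hx.2.2 t ht).2.div_const (P.ℓ x))
        rwa [P.rhs_div hx.1.1 (hx.2.2 t ht).1.1] at h1
      U_repr := by
        rintro t ht ⟨a, ha0, has⟩
        have h1 : ∀ᵐ x ∂muI, a ≤ m x t / P.ℓ x := hGae.mono has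
        have hwq : (fun x => ux x t) =ᵐ[muI] fun y =>
            (Ioo 0 1).indicator (fun x => c₀ x * P.ℓ x ^ (-(1 + P.θ))) y *
              ((m y t / P.ℓ y) ^ (-(1 + P.θ)) *
                (P.g * y * ((m y t / P.ℓ y) ^ P.γ - 1) + prim (V t + H t) y)) := by
          filter_upwards [h1, hI, hcp', hflux t ht.le, hnm t ht.le] with x g1 g2 g3 g4 g5
          have hℓ := P.ℓ_pos g2.1
          have hm : 0 < m x t := by
            have := ha0.trans_le g1
            rwa [div_pos_iff_of_pos_right hℓ] at this
          rw [g5, ← P.flux_eq g2.1 hm.le] at g4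
          rw [indicator_of_mem g2, P.grad_eq g2.1 g3 (by rwa [g5]) g4, g5]
        have hq := (P.integrable_ℓ_rpow.const_mul (P.κ * (a ^ (-(1 + P.θ)) * MF))).mono'
          (f := fun y =>
            (Ioo 0 1).indicator (fun x => c₀ x * P.ℓ x ^ (-(1 + P.θ))) y *
              ((m y t / P.ℓ y) ^ (-(1 + P.θ)) *
                (P.g * y * ((m y t / P.ℓ y) ^ P.γ - 1) + prim (V t + H t) y)))
          (by
            have g1 := measurable_prim (V t + H t)
            have g2 := P.measurable_ℓ
            have g3 := hmm t
            exact Measurable.aestronglyMeasurable (by fun_prop))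
          (by
            filter_upwards [h1, hI, hflux t ht.le, hnm t ht.le, hMF t ht.le, hcp']
              with x g1 g2 g3 g4 g5 g6
            have hℓ := P.ℓ_pos g2.1
            have hs := ha0.trans_le g1
            have hm : 0 < m x t := by
              rwa [div_pos_iff_of_pos_right hℓ] at hs
            rw [g4, ← P.flux_eq g2.1 hm.le] at g3
            rw [← g3, indicator_of_mem g2, norm_mul,
              Real.norm_of_nonneg (mul_pos g6 (Real.rpow_pos_of_pos hℓ _)).le, norm_mul,
              Real.norm_of_nonneg (Real.rpow_pos_of_pos hs _).le, Real.norm_eq_abs]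
            have k1 := hσle x g2
            have k2 : (m x t / P.ℓ x) ^ (-(1 + P.θ)) ≤ a ^ (-(1 + P.θ)) :=
              Real.rpow_le_rpow_of_nonpos ha0 g1 (by linarith [P.θ_pos])
            calc _ ≤ P.κ * P.ℓ x ^ (-(1 + P.θ)) * (a ^ (-(1 + P.θ)) * MF) := by
                  have := P.κ_pos
                  gcongr
              _ = _ := by ring)
        have key := ae_eq_neg_tail ((integrable_coe (U t)).congr (hU t ht.le)) hq (hux t ht.le)
          hwq (hbc t ht)
        filter_upwards [key, hU t ht.le] with x k1 k2
        rw [k2, k1] }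
  refine ⟨S, ?_, fun t ht => ?_, hU, hin, hiu, _, hux 0 le_rfl, ?_⟩
  · intro x hx
    show (Ioo (0 : ℝ) 1).indicator (fun x => c₀ x * P.ℓ x ^ (-(1 + P.θ))) x = _
    exact indicator_of_mem hx _
  · filter_upwards [hnm t ht, hI] with x h1 h2
    have := (P.ℓ_pos h2.1).ne'
    show _ = P.ℓ x * (m x t / P.ℓ x)
    rw [h1]; field_simp
  · filter_upwards [hflux 0 le_rfl, hnm 0 le_rfl, hI, hn0 0 le_rfl] with x h1 h2 h3 h0
    have h4 : 0 ≤ m x 0 := by rw [← h2]; exact h0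
    show _ = P.g * x * ((m x 0 / P.ℓ x) ^ P.γ - 1) + prim (V 0 + H 0) x
    rw [P.flux_eq h3.1 h4, h1, h2]

/-! ### Energy and dissipation of the initial data -/

/-- The energy at time `0` in terms of the data. -/
theorem Sol.exists_E_zero_le (P : Params) : ∃ K, 0 < K ∧ ∀ (S : Sol P) (n₀ u₀ : ℝ → ℝ),
    (∀ᵐ x ∂muI, n₀ x = P.ℓ x * S.s x 0) → (∀ᵐ x ∂muI, (S.U 0 : ℝ → ℝ) x = u₀ x) →
    S.E 0 ≤ K * ((∫ x, u₀ x ^ 2 ∂muI) + ∫ x, x ^ (1 - 3 / P.γ) * (n₀ x - P.ℓ x) ^ 2 ∂muI) := by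
  obtain ⟨k, K, hk, hK, hphi⟩ := exists_phi_bounds P.one_lt_γ P.a₀_pos P.a₀_le_one P.one_le_b₀
  have hg := P.g_pos
  have hγ := P.γ_pos
  have hκ := P.κ_pos
  have hρ := P.ρ_pos
  set L := P.g ^ (1 - 3 / P.γ) with hL
  have hL0 : 0 < L := Real.rpow_pos_of_pos hg _
  have hpow : ∀ x, 0 < x → P.ℓ x ^ (P.γ - 3) = L * x ^ (1 - 3 / P.γ) := fun x hx => by
    rw [P.ℓ_rpow hx, sub_div, div_self hγ.ne']
  refine ⟨1 + P.ρ⁻¹ * (P.κ * K * L), by positivity, fun S n₀ u₀ hn hu => ?_⟩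
  have hI : ∀ᵐ x ∂muI, x ∈ Ioo (0 : ℝ) 1 := ae_restrict_mem measurableSet_Ioo
  have e1 : ‖S.U 0‖ ^ 2 = ∫ x, u₀ x ^ 2 ∂muI := by
    rw [norm_sq_eq_integral]
    exact integral_congr_ae (by filter_upwards [hu] with x hx; rw [hx])
  have hpt : ∀ x, 0 < x → n₀ x = P.ℓ x * S.s x 0 →
      L * (x ^ (1 - 3 / P.γ) * (n₀ x - P.ℓ x) ^ 2) = P.ℓ x ^ (P.γ - 1) * (S.s x 0 - 1) ^ 2 :=
    fun x hx h => by
      have hℓ := P.ℓ_pos hx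
      have h2 : P.ℓ x ^ (P.γ - 1) = P.ℓ x ^ (P.γ - 3) * P.ℓ x ^ 2 := by
        rw [← Real.rpow_natCast, ← Real.rpow_add hℓ]; congr 1; push_cast; ring
      rw [← mul_assoc, ← hpow x hx, h2, h]
      ring
  have hint : Integrable (fun x => L * (x ^ (1 - 3 / P.γ) * (n₀ x - P.ℓ x) ^ 2)) muI := by
    have h1 := S.s_meas 0 le_rfl
    have h2 := P.measurable_ℓ
    have h3 : Integrable (fun x => P.ℓ x ^ (P.γ - 1) * (S.s x 0 - 1) ^ 2) muI := by
      refine Integrable.of_bound (AEMeasurable.aestronglyMeasurable (by fun_prop))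
        (P.g ^ ((P.γ - 1) / P.γ) * P.b₀ ^ 2) ?_
      filter_upwards [hI, S.ae_G] with x h4 h5
      have h6 := S.s_init x h5
      have h7 := P.ℓ_rpow_le h4 (sub_nonneg.2 P.one_lt_γ.le)
      have h8 := (Real.rpow_pos_of_pos (P.ℓ_pos h4.1) (P.γ - 1)).le
      rw [Real.norm_of_nonneg (by positivity)]
      refine mul_le_mul h7 ?_ (sq_nonneg _) (by positivity)
      have h9 := P.a₀_pos
      have h10 := P.one_le_b₀
      exact sq_le_sq' (by linarith [h6.1]) (by linarith [h6.2])
    refine h3.congr ?_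
    filter_upwards [hI, hn] with x h4 h5
    exact (hpt x h4.1 h5).symm
  have e2 : ∫ x, P.ℓ x ^ (P.γ + P.θ) * phi P.γ (S.s x 0) ∂S.τ ≤
      P.κ * K * L * ∫ x, x ^ (1 - 3 / P.γ) * (n₀ x - P.ℓ x) ^ 2 ∂muI := by
    rw [S.integral_τ, mul_assoc (P.κ * K), ← integral_const_mul, ← integral_const_mul]
    refine integral_mono_of_nonneg ?_ (hint.const_mul _) ?_
    · filter_upwards [hI, S.ae_G] with x h1 h2
      have h3 := (hphi _ (S.s_init x h2)).1
      have h4 := (Real.rpow_pos_of_pos (P.ℓ_pos h1.1) (P.γ + P.θ)).le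
      exact mul_nonneg (S.σ_nonneg x) (mul_nonneg h4 (le_trans (by positivity) h3))
    · filter_upwards [hI, S.ae_G, hn] with x h1 h2 h3
      have h4 := (hphi _ (S.s_init x h2))
      have h5 := (Real.rpow_pos_of_pos (P.ℓ_pos h1.1) (P.γ + P.θ)).le
      have h6 := (Real.rpow_pos_of_pos (P.ℓ_pos h1.1) (-(1 + P.θ))).le
      have h7 : P.ℓ x ^ (-(1 + P.θ)) * P.ℓ x ^ (P.γ + P.θ) = P.ℓ x ^ (P.γ - 1) := by
        rw [← Real.rpow_add (P.ℓ_pos h1.1)]; ring_nf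
      rw [hpt x h1.1 h3, ← h7]
      have h8 : 0 ≤ phi P.γ (S.s x 0) := le_trans (by positivity) h4.1
      calc S.σ x * (P.ℓ x ^ (P.γ + P.θ) * phi P.γ (S.s x 0))
          ≤ P.κ * P.ℓ x ^ (-(1 + P.θ)) * (P.ℓ x ^ (P.γ + P.θ) * (K * (S.s x 0 - 1) ^ 2)) := by
            refine mul_le_mul (S.σ_le x h1) (mul_le_mul_of_nonneg_left h4.2 h5)
              (mul_nonneg h5 h8) (by positivity)
        _ = _ := by ring
  set A := ∫ x, u₀ x ^ 2 ∂muI with hA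
  set B := ∫ x, x ^ (1 - 3 / P.γ) * (n₀ x - P.ℓ x) ^ 2 ∂muI with hB
  have hA0 : 0 ≤ A := integral_nonneg fun x => sq_nonneg _
  have hB0 : 0 ≤ B := integral_nonneg_of_ae (by
    filter_upwards [hI] with x hx
    have := (Real.rpow_pos_of_pos hx.1 (1 - 3 / P.γ)).le
    exact mul_nonneg this (sq_nonneg _))
  have e3 : P.ρ⁻¹ * ∫ x, P.ℓ x ^ (P.γ + P.θ) * phi P.γ (S.s x 0) ∂S.τ ≤
      P.ρ⁻¹ * (P.κ * K * L) * B := by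
    rw [mul_assoc]
    exact mul_le_mul_of_nonneg_left e2 (by positivity)
  have e4 : 0 ≤ P.ρ⁻¹ * (P.κ * K * L) * A := by positivity
  rw [Sol.E, e1]
  nlinarith

/-- The dissipation at time `0` in terms of the derivative `v` of the initial velocity. -/
theorem Sol.D_zero_le {P : Params} (S : Sol P) {α C₁ C₂ C₃ C₄ : ℝ} {c₀ Q₀ q v : ℝ → ℝ}
    (hα : α < 1 / P.γ) (hC₁ : 0 < C₁) (hC₂ : 0 ≤ C₂) (hC₃ : 0 < C₃)
    (hdata : InitialBounds P.γ α C₁ C₂ C₃ C₄ c₀ Q₀)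
    (hσ : ∀ x ∈ Ioo (0 : ℝ) 1, S.σ x = c₀ x * P.ℓ x ^ (-(1 + P.θ)))
    (hq : ∀ᵐ x ∂muI, c₀ x * q x = c₀ x * Q₀ x)
    (hs : ∀ᵐ x ∂muI, c₀ x * q x = P.ℓ x * S.s x 0)
    (hv : MemLp v 2 muI)
    (hF : ∀ᵐ x ∂muI, viscousFlux P.θ (c₀ x) (q x) (v x) = S.F x 0) :
    S.D 0 ≤ C₂ ^ (1 + P.θ) / C₃ * ∫ x, v x ^ 2 ∂muI := by
  have hθ := P.θ_pos
  have hγ := P.γ_pos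
  have hpt : ∀ᵐ x ∂muI, S.σ x * (S.grad x 0 * S.F x 0) =
        (c₀ x * Q₀ x) ^ (1 + P.θ) / c₀ x * v x ^ 2 ∧
      0 ≤ (c₀ x * Q₀ x) ^ (1 + P.θ) / c₀ x ∧
      (c₀ x * Q₀ x) ^ (1 + P.θ) / c₀ x ≤ C₂ ^ (1 + P.θ) / C₃ := by
    filter_upwards [ae_restrict_mem measurableSet_Ioo, hq, hs, hF] with x h1 h2 h3 h4
    have hx := Ioo_subset_Ioc_self h1
    have hb := hdata x hx
    have hc := hdata.c_pos hC₃ hx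
    have hℓ := P.ℓ_pos h1.1
    have hxγ := Real.rpow_pos_of_pos h1.1 (1 / P.γ)
    have hn : 0 < c₀ x * Q₀ x := (mul_pos hC₁ hxγ).trans_le hb.1
    have hn' : 0 < c₀ x * q x := h2 ▸ hn
    have hq0 : 0 ≤ q x := (pos_of_mul_pos_right hn' hc.le).le
    have hsx : S.s x 0 = c₀ x * q x / P.ℓ x := by
      rw [h3]; field_simp
    refine ⟨?_, by positivity, ?_⟩
    · have k1 := P.grad_eq h1.1 hc hn' h4
      rw [← hsx, ← hσ x h1] at k1
      have k2 : S.σ x * (S.grad x 0 * S.F x 0) = v x * S.F x 0 := by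
        rw [k1, Sol.grad]; ring
      rw [k2, ← h4, viscousFlux_eq hc hq0, h2]
      ring
    · have hxα := Real.rpow_pos_of_pos h1.1 α
      rw [div_le_div_iff₀ hc hC₃]
      have k1 : (c₀ x * Q₀ x) ^ (1 + P.θ) ≤ C₂ ^ (1 + P.θ) * x ^ ((1 + P.θ) / P.γ) := by
        refine (Real.rpow_le_rpow hn.le hb.2.1 (by positivity)).trans_eq ?_
        rw [Real.mul_rpow hC₂ hxγ.le, ← Real.rpow_mul h1.1.le]
        ring_nf
      have k2 : x ^ ((1 + P.θ) / P.γ) ≤ x ^ α := by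
        refine Real.rpow_le_rpow_of_exponent_ge h1.1 h1.2.le (hα.le.trans ?_)
        gcongr
        linarith
      have k3 : 0 ≤ C₂ ^ (1 + P.θ) := Real.rpow_nonneg hC₂ _
      calc (c₀ x * Q₀ x) ^ (1 + P.θ) * C₃ ≤ C₂ ^ (1 + P.θ) * x ^ α * C₃ := by
            gcongr
            exact k1.trans (by gcongr)
        _ ≤ C₂ ^ (1 + P.θ) * c₀ x := by
            rw [mul_assoc, mul_comm (x ^ α)]
            gcongr
            exact hb.2.2.1
  rw [Sol.D, S.integral_τ, ← integral_const_mul]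
  refine integral_mono_of_nonneg ?_ (hv.integrable_sq.const_mul _) ?_
  · filter_upwards [hpt] with x hx
    rw [hx.1]
    exact mul_nonneg hx.2.1 (sq_nonneg _)
  · filter_upwards [hpt] with x hx
    rw [hx.1]
    exact mul_le_mul_of_nonneg_right hx.2.2 (sq_nonneg _)

end GasLiquid

end

theorem theorem2p4
    (γ θ α g f ρ : ℝ) (hγ : 1 < γ) (hg : 0 < g) (hf : 0 ≤ f) (hρ : 0 < ρ)
    (hα0 : 0 ≤ α) (hα1 : α < 1 / γ)
    (hθ0 : 0 < θ) (hθ1 : θ ≤ γ / 2) (hθ2 : θ < γ - 1) (hθ3 : θ ≤ 1 - α * γ)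
    (C₁ C₂ C₃ C₄ : ℝ) (hC₁ : 0 < C₁) (hC₁₂ : C₁ ≤ C₂) (hC₃ : 0 < C₃) (hC₃₄ : C₃ ≤ C₄) :
    ∃ ε₀ : ℝ, 0 < ε₀ ∧ ε₀ < 1 ∧
      ∀ c₀ Q₀ u₀ : ℝ → ℝ,
        GasLiquid.InitialBounds γ α C₁ C₂ C₃ C₄ c₀ Q₀ →
        GasLiquid.InitialRegularity γ θ α g c₀ Q₀ u₀ →
        (∫ x in Ioo (0 : ℝ) 1, (u₀ x) ^ 2) ≤ ε₀ →
        (∫ x in Ioo (0 : ℝ) 1,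
          x ^ (1 - 3 / γ) * (c₀ x * Q₀ x - GasLiquid.cQinf γ g x) ^ 2) ≤ ε₀ →
        ∃ C : ℝ, 0 < C ∧
          ∀ Q u : ℝ → ℝ → ℝ, GasLiquid.IsWeakSolution γ θ g f ρ c₀ Q₀ u₀ Q u →
            ∀ t : ℝ, 0 ≤ t →
              eLpNorm (fun x => (c₀ x * Q x t) ^ θ - (GasLiquid.cQinf γ g x) ^ θ) ⊤
                  GasLiquid.muI
                ≤ ENNReal.ofReal (C * (1 + t) ^ (-(2 * θ / (4 * γ + α * γ - 2)))) ∧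
              eLpNorm (fun x => u x t) ⊤ GasLiquid.muI
                ≤ ENNReal.ofReal (C * (1 + t) ^ (-(1 / 2 : ℝ))) := by
  have hγ0 : 0 < γ := by linarith
  have hαγ : 0 ≤ α * γ := by positivity
  have hG : 0 < g ^ (1 / γ) := Real.rpow_pos_of_pos hg _
  have hC₂ : 0 < C₂ := hC₁.trans_le hC₁₂
  -- Here `θ ≤ 1` follows from `θ ≤ 1 - α γ`, and `a₀`, `b₀` are chosen such that
  -- `a₀ ℓ ≤ c₀ Q₀ ≤ b₀ ℓ` with `a₀ ≤ 1 ≤ b₀`.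
  let P : GasLiquid.Params :=
    { γ := γ, θ := θ, g := g, ρ := ρ, k := f * ρ ^ 2, κ := C₄
      a₀ := min 1 (C₁ / g ^ (1 / γ)), b₀ := max 1 (C₂ / g ^ (1 / γ))
      one_lt_γ := hγ, g_pos := hg, ρ_pos := hρ, k_nonneg := by positivity
      κ_pos := hC₃.trans_le hC₃₄, θ_pos := hθ0, θ_le_one := by linarith
      θ_le_half := hθ1, θ_lt := by linarith
      a₀_pos := lt_min one_pos (div_pos hC₁ hG), a₀_le_one := min_le_left _ _
      one_le_b₀ := le_max_left _ _ }
  have hden : 0 < 4 * γ + α * γ - 2 := by linarith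
  -- The exponent satisfies `q ≤ 1 / 2` because `θ < γ - 1`, and `q (γ - θ) ≤ θ` because `1 < γ`.
  obtain ⟨ε, hε, hdec⟩ := GasLiquid.Sol.exists_decay P (q := 2 * θ / (4 * γ + α * γ - 2))
    (by positivity) (by rw [div_le_iff₀ hden]; linarith)
    (by
      show 2 * θ / (4 * γ + α * γ - 2) * (γ - θ) ≤ θ
      rw [div_mul_eq_mul_div, div_le_iff₀ hden]
      nlinarith)
  obtain ⟨K, hK, hE⟩ := GasLiquid.Sol.exists_E_zero_le P
  -- Each of the two small quantities accounts for half of the admissible energy `ε`.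
  refine ⟨min (1 / 2) (ε / (2 * K)), lt_min (by norm_num) (by positivity),
    (min_le_left _ _).trans_lt (by norm_num), ?_⟩
  rintro c₀ Q₀ u₀ hdata ⟨u₀x, w₀, s₀, ⟨-, hu₀x, hu₀x2⟩, -, -, -⟩ hsmall₁ hsmall₂
  obtain ⟨C, hC, hdecC⟩ := hdec (C₂ ^ (1 + θ) / C₃ * ∫ x, u₀x x ^ 2 ∂GasLiquid.muI)
  refine ⟨C, hC, fun Q u hsol t ht => ?_⟩
  obtain ⟨S, hσ, hs, hU, hn0, hu0, v, hv, hF⟩ := GasLiquid.exists_sol P (α := α) (C₁ := C₁)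
    (C₂ := C₂) (C₃ := C₃) hf hα0 hC₃ le_rfl
    (by
      show min 1 (C₁ / g ^ (1 / γ)) * g ^ (1 / γ) ≤ C₁
      rw [← le_div_iff₀ hG]
      exact min_le_right _ _)
    (by
      show C₂ ≤ max 1 (C₂ / g ^ (1 / γ)) * g ^ (1 / γ)
      rw [← div_le_iff₀ hG]
      exact le_max_right _ _) hdata hsol
  have hvx : v =ᵐ[GasLiquid.muI] u₀x := hv.ae_eq hu₀x hu0
  have hE0 : S.E 0 ≤ ε := by
    refine (hE S (fun x => c₀ x * Q₀ x) u₀ ?_ ?_).trans ?_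
    · filter_upwards [hs 0 le_rfl, hn0] with x h1 h2
      rw [← h1, h2]
    · filter_upwards [hU 0 le_rfl, hu0] with x h1 h2
      rw [h1, h2]
    · have h1 := (add_le_add hsmall₁ hsmall₂).trans
        (add_le_add (min_le_right _ _) (min_le_right _ _))
      calc _ ≤ K * (ε / (2 * K) + ε / (2 * K)) := mul_le_mul_of_nonneg_left h1 hK.le
        _ = ε := by field_simp; ring
  have hD0 : S.D 0 ≤ C₂ ^ (1 + θ) / C₃ * ∫ x, u₀x x ^ 2 ∂GasLiquid.muI := by
    refine (S.D_zero_le hα1 hC₁ hC₂.le hC₃ hdata hσ hn0 (hs 0 le_rfl)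
      (hu₀x2.ae_eq hvx.symm) hF).trans_eq ?_
    congr 1
    refine integral_congr_ae ?_
    filter_upwards [hvx] with x hx
    rw [hx]
  obtain ⟨h1, h2⟩ := hdecC S hE0 hD0 t ht
  constructor
  · rw [eLpNorm_exponent_top]
    refine eLpNormEssSup_le_of_ae_bound ?_
    filter_upwards [hs t ht, S.ae_G] with x h3 h4
    have h5 := P.ℓ_pos (S.pos_of_mem h4)
    have h6 := h1 x h4
    rw [h3, Real.mul_rpow h5.le (S.s_nonneg x h4 t ht), Real.norm_eq_abs]
    rwa [mul_sub, mul_one] at h6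
  · rw [eLpNorm_exponent_top]
    refine eLpNormEssSup_le_of_ae_bound ?_
    filter_upwards [h2, hU t ht] with x h3 h4
    rw [Real.norm_eq_abs, ← h4]
    exact h3
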